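/- **Setting.** Let $d\ge 2$, $s\in(0,1)$, $\gamma>-d$ with $\gamma+2s\in[0,2]$, and $0<\lambda\le\Lambda$. Write $z=(t,x,v)\in\mathbb R\times\mathbb R^d\times\mathbb R^d$. *Collision kernel.* $B(r,\cos\theta)=r^\gamma b(\cos\theta)$, where $b\ge 0$ is measurable, $b(\cos\theta)\ge\lambda\,\sin(\theta/2)^{-(d-1)-2s}$ for $\theta\in(0,\pi/2]$, and $b(\cos\theta)\le\Lambda\,\sin(\theta/2)^{-(d-1)-2s}\cos(\theta/2)^{\gamma+2s+1}$ for $\theta\in(0,\pi)$. For a function $f=f(t,x,v)$ put $$K_f(t,x,v,v')=\frac{2^{d-1}}{|v'-v|}\int_{w\perp v'-v} f(t,x,v+w)\,B(r,\cos\theta)\,r^{-d+2}\,dw,\qquad r^2=|v'-v|^2+|w|^2,\quad \cos\theta=\frac{w-(v'-v)}{|w-(v'-v)|}\cdot\frac{w+(v'-v)}{|w+(v'-v)|},$$ $$\mathcal Q_1(f,g)(t,x,v)=\mathrm{PV}\int_{\mathbb R^d}\big(g(t,x,v')-g(t,x,v)\big)K_f(t,x,v,v')\,dv'=\lim_{\varepsilon\to0^+}\int_{|v'-v|>\varepsilon}(\dots)\,dv'.$$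 *Kinetic Hölder spaces.* Let $Q_r(z_0)=\{z: t_0-r^{2s}<t\le t_0,\ |x-x_0-(t-t_0)v_0|<r^{1+2s},\ |v-v_0|<r\}$ and $$d_\ell(z_1,z_2)=\min_{w\in\mathbb R^d}\max\big(|t_1-t_2|^{\frac1{2s}},\,|x_1-x_2-(t_1-t_2)w|^{\frac1{1+2s}},\,|v_1-w|,\,|v_2-w|\big).$$ The kinetic degree of a polynomial in $(t,x,v)$ is the largest degree of its monomials, where $t$ counts $2s$, each $x_i$ counts $1+2s$ and each $v_i$ counts $1$; it is $-\infty$ for the zero polynomial. For $\beta\ge0$, $[f]_{C^\beta_\ell(D)}$ is the smallest $C$ such that for every $z_0\in D$ there is a polynomial $p$ of kinetic degree $<\beta$ with $|f(z)-p(z)|\le C\,d_\ell(z,z_0)^\beta$ for all $z\in D$. For $\tau<T$ and $q\in\mathbb R$, $$[f]_{C^\beta_{\ell,q}}=\sup\big\{(1+|v|)^q[f]_{C^\beta_\ell(Q_r(z))}: z=(t,x,v),\ r\in(0,1],\ Q_r(z)\subset[\tau,T]\times\mathbb R^d\times\mathbb R^d\big\},\qquad \|f\|_{C^\beta_{\ell,q}}=[f]_{C^0_{\ell,q}}+[f]_{C^\beta_{\ell,q}}.$$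 $C^\beta_{\ell,\mathrm{fast}}$ is the space of functions $f$ on $[\tau,T]\times\mathbb R^d\times\mathbb R^d$ that are continuous on all these cylinders and satisfy $\|f\|_{C^\beta_{\ell,q}}<\infty$ for every $q>0$. **Lemma (Bound for $\mathcal Q_1$).** Let $0<\alpha\le\min(1,2s)$ and $\alpha'=\frac{2s\alpha}{1+2s}$. Let $f\in C^\alpha_{\ell,\mathrm{fast}}$ and $g\in C^{2s+\alpha}_{\ell,\mathrm{fast}}$. Then for every $z$ with $\tau<t\le T$ the integrals over the hyperplanes and the truncated integrals converge absolutely and the principal value $\mathcal Q_1(f,g)(z)$ exists, and $\mathcal Q_1(f,g)\in C^{\alpha'}_{\ell,\mathrm{fast}}$. Moreover, for every $q>d+\gamma+2s+\frac{\alpha}{1+2s}$ and every $\delta>0$ there is a constant $C$ depending only on $\alpha,d,s,\gamma,q,\delta$ and the constants $\lambda,\Lambda$ of $B$ such that, whenever $T-\tau\ge\delta$, $$\|\mathcal Q_1(f,g)\|_{C^{\alpha'}_{\ell,\,q-\gamma-2s-\alpha/(1+2s)}}\le C\,\|f\|_{C^\alpha_{\ell,q}}\,\|g\|_{C^{2s+\alpha}_{\ell,q}}.$$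 -/

import Mathlib

open MeasureTheory Filter Topology Set
open scoped ENNReal NNReal

noncomputable section

namespace KineticBoltzmann

/-- Velocity (or position) space `ℝ^d` with the Euclidean norm. -/
abbrev Vel (d : ℕ) : Type := EuclideanSpace ℝ (Fin d)

/-- Points `z = (t, x, v)` of `ℝ^{1+2d}`. -/
abbrev Pt (d : ℕ) : Type := ℝ × Vel d × Vel d

/-- The kinetic cylinder `Q_r(z₀)`: `t₀ - r^{2s} < t ≤ t₀`,
`|x - x₀ - (t - t₀) v₀| < r^{1+2s}`, `|v - v₀| < r`. -/
def cylinder {d : ℕ} (s r : ℝ) (z₀ : Pt d) : Set (Pt d) :=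
  {z | z₀.1 - r ^ (2 * s) < z.1 ∧ z.1 ≤ z₀.1 ∧
    ‖z.2.1 - z₀.2.1 - (z.1 - z₀.1) • z₀.2.2‖ < r ^ (1 + 2 * s) ∧ ‖z.2.2 - z₀.2.2‖ < r}

/-- The kinetic distance `d_ℓ`. The minimum over `w` is written as an infimum
(it is attained). -/
def kdist {d : ℕ} (s : ℝ) (z₁ z₂ : Pt d) : ℝ :=
  ⨅ w : Vel d,
    max (max (|z₁.1 - z₂.1| ^ (1 / (2 * s)))
      (‖z₁.2.1 - z₂.2.1 - (z₁.1 - z₂.1) • w‖ ^ (1 / (1 + 2 * s))))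
      (max ‖z₁.2.2 - w‖ ‖z₂.2.2 - w‖)

/-- Index set of the variables `t`, `x₁, …, x_d`, `v₁, …, v_d`. -/
abbrev Var (d : ℕ) : Type := Unit ⊕ (Fin d ⊕ Fin d)

/-- The values of the variables at a point. -/
def coords {d : ℕ} (z : Pt d) : Var d → ℝ :=
  Sum.elim (fun _ => z.1) (Sum.elim (fun i => z.2.1 i) (fun i => z.2.2 i))

/-- The kinetic degree of a monomial with exponents `m`. -/
def monomialDegree {d : ℕ} (s : ℝ) (m : Var d →₀ ℕ) : ℝ :=
  2 * s * (m (Sum.inl ()) : ℝ)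
    + (1 + 2 * s) * ∑ i : Fin d, (m (Sum.inr (Sum.inl i)) : ℝ)
    + ∑ i : Fin d, (m (Sum.inr (Sum.inr i)) : ℝ)

/-- `p` has kinetic degree `< α`; the zero polynomial has kinetic degree `-∞`. -/
def KDegLT {d : ℕ} (s α : ℝ) (p : MvPolynomial (Var d) ℝ) : Prop :=
  ∀ m ∈ p.support, monomialDegree s m < α

/-- `C` is an admissible constant in the definition of `[f]_{C_ℓ^α(D)}`. -/
def HolderBound {d : ℕ} (s α : ℝ) (f : Pt d → ℝ) (D : Set (Pt d)) (C : ℝ≥0) : Prop :=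
  ∀ z₀ ∈ D, ∃ p : MvPolynomial (Var d) ℝ, KDegLT s α p ∧
    ∀ z ∈ D, |f z - MvPolynomial.eval (coords z) p| ≤ (C : ℝ) * kdist s z z₀ ^ α

/-- The semi-norm `[f]_{C_ℓ^α(D)}` (equal to `∞` if there is no admissible constant).
For `α = 0` only `p = 0` is allowed and `0 ^ 0 = 1`, so it is the supremum of `|f|` on `D`. -/
def holderSeminorm {d : ℕ} (s α : ℝ) (f : Pt d → ℝ) (D : Set (Pt d)) : ℝ≥0∞ :=
  ⨅ (C : ℝ≥0) (_ : HolderBound s α f D C), (C : ℝ≥0∞)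

/-- `[τ, T] × ℝ^d × ℝ^d`. -/
def slab (d : ℕ) (τ T : ℝ) : Set (Pt d) := {z | τ ≤ z.1 ∧ z.1 ≤ T}

/-- The weighted semi-norm `[f]_{C^α_{ℓ,q}([τ,T] × ℝ^d × ℝ^d)}`: the supremum of
`(1 + |v|)^q [f]_{C_ℓ^α(Q_r(z))}` over `z = (t, x, v)` and `r ∈ (0, 1]` with
`Q_r(z) ⊆ [τ,T] × ℝ^d × ℝ^d`. -/
def weightedSeminorm {d : ℕ} (s α q τ T : ℝ) (f : Pt d → ℝ) : ℝ≥0∞ :=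
  ⨆ (z : Pt d) (r : ℝ) (_ : 0 < r ∧ r ≤ 1 ∧ cylinder s r z ⊆ slab d τ T),
    ENNReal.ofReal ((1 + ‖z.2.2‖) ^ q) * holderSeminorm s α f (cylinder s r z)

/-- The norm `‖f‖_{C^α_{ℓ,q}} = ‖f‖_{C^0_{ℓ,q}} + [f]_{C^α_{ℓ,q}}`. -/
def weightedNorm {d : ℕ} (s α q τ T : ℝ) (f : Pt d → ℝ) : ℝ≥0∞ :=
  weightedSeminorm s 0 q τ T f + weightedSeminorm s α q τ T f

/-- `f ∈ C^α_{ℓ,fast}([τ,T] × ℝ^d × ℝ^d)`. Only the values of `f` on the slab matter. -/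
def MemFast {d : ℕ} (s α τ T : ℝ) (f : Pt d → ℝ) : Prop :=
  (∀ (z : Pt d) (r : ℝ), 0 < r → r ≤ 1 → cylinder s r z ⊆ slab d τ T →
      ContinuousOn f (cylinder s r z)) ∧
  ∀ q : ℝ, 0 < q → weightedNorm s α q τ T f < ⊤

/-- Non-cutoff collision kernels `B(r, cos θ) = r^γ b(cos θ)`: for `θ ∈ (0, π/2]` the
function `b(cos θ)` is comparable to `sin(θ/2)^{-(d-1)-2s}`, and for `θ ∈ (π/2, π)` it is
non-negative and at most of the order `cos(θ/2)^{γ+2s+1}`, which is the usual normalization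
of the irrelevant backward half of the angular function. All kernels for which
`K_f(v,v') = |v'-v|^{-d-2s} ∫_{w ⊥ v'-v} f(v+w) A(|v'-v|,|w|) |w|^{γ+2s+1} dw` with `A ≃ 1`
are included. -/
structure IsNonCutoff (d : ℕ) (s γ lam Lam : ℝ) (b : ℝ → ℝ) : Prop where
  measurable : Measurable b
  nonneg : ∀ θ ∈ Ioo 0 Real.pi, 0 ≤ b (Real.cos θ)
  lower : ∀ θ ∈ Ioc 0 (Real.pi / 2),
    lam * Real.sin (θ / 2) ^ (-((d : ℝ) - 1) - 2 * s) ≤ b (Real.cos θ)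
  upper : ∀ θ ∈ Ioo 0 Real.pi,
    b (Real.cos θ) ≤ Lam * Real.sin (θ / 2) ^ (-((d : ℝ) - 1) - 2 * s)
      * Real.cos (θ / 2) ^ (γ + 2 * s + 1)

/-- The collision kernel `B(r, c) = r^γ b(c)`. -/
def collisionB (γ : ℝ) (b : ℝ → ℝ) (r c : ℝ) : ℝ := r ^ γ * b c

/-- The relative speed `r = (|a|² + |w|²)^{1/2}`, where `a = v' - v`. -/
def relSpeed {d : ℕ} (a w : Vel d) : ℝ := Real.sqrt (‖a‖ ^ 2 + ‖w‖ ^ 2)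

/-- The cosine of the deviation angle. With `a = v' - v`, `w = v'_* - v` and
`v_* = v + a + w`, it is the cosine of the angle between `v - v_* = -(w + a)` and
`v' - v'_* = -(w - a)`. -/
def cosDeviation {d : ℕ} (a w : Vel d) : ℝ :=
  inner ℝ (w - a) (w + a) / (‖w - a‖ * ‖w + a‖)

/-- The integrand `f(t,x,v+w) B(r, cos θ) r^{-d+2}` in the formula for `K_f(v,v')`. -/
def kernelIntegrand {d : ℕ} (γ : ℝ) (b : ℝ → ℝ) (f : Pt d → ℝ) (z : Pt d) (v' : Vel d)
    (w : Vel d) : ℝ :=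
  f (z.1, z.2.1, z.2.2 + w)
    * collisionB γ b (relSpeed (v' - z.2.2) w) (cosDeviation (v' - z.2.2) w)
    * relSpeed (v' - z.2.2) w ^ (-(d : ℝ) + 2)

/-- The Boltzmann kernel `K_f(t,x,v,v')`, an integral over the hyperplane orthogonal to
`v' - v` with its `(d-1)`-dimensional Lebesgue measure. -/
def boltzmannKernel {d : ℕ} (γ : ℝ) (b : ℝ → ℝ) (f : Pt d → ℝ) (z : Pt d) (v' : Vel d) : ℝ :=
  (2 : ℝ) ^ (d - 1) / ‖v' - z.2.2‖
    * ∫ w : (Submodule.span ℝ {v' - z.2.2})ᗮ, kernelIntegrand γ b f z v' (w : Vel d)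

/-- The integrand `(g(t,x,v') - g(t,x,v)) K_f(t,x,v,v')`. -/
def collisionIntegrand {d : ℕ} (γ : ℝ) (b : ℝ → ℝ) (f g : Pt d → ℝ) (z : Pt d)
    (v' : Vel d) : ℝ :=
  (g (z.1, z.2.1, v') - g z) * boltzmannKernel γ b f z v'

/-- The truncated integral over `|v' - v| > ε`. -/
def truncQ₁ {d : ℕ} (γ : ℝ) (b : ℝ → ℝ) (f g : Pt d → ℝ) (z : Pt d) (ε : ℝ) : ℝ :=
  ∫ v' in {v' : Vel d | ε < ‖v' - z.2.2‖}, collisionIntegrand γ b f g z v'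

/-- `Q₁(f,g)(z) = PV ∫ (g(t,x,v') - g(t,x,v)) K_f(t,x,v,v') dv'`. -/
def Q₁ {d : ℕ} (γ : ℝ) (b : ℝ → ℝ) (f g : Pt d → ℝ) (z : Pt d) : ℝ :=
  limUnder (𝓝[>] (0 : ℝ)) (truncQ₁ γ b f g z)

/-- The principal value defining `Q₁(f,g)(z)` is meaningful: all integrals that enter it
converge absolutely, and the limit exists and is `Q₁(f,g)(z)`. -/
def Q₁WellDefined {d : ℕ} (γ : ℝ) (b : ℝ → ℝ) (f g : Pt d → ℝ) (z : Pt d) : Prop :=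
  (∀ v' : Vel d, v' ≠ z.2.2 →
    Integrable (fun w : (Submodule.span ℝ {v' - z.2.2})ᗮ =>
      kernelIntegrand γ b f z v' (w : Vel d))) ∧
  (∀ ε : ℝ, 0 < ε →
    IntegrableOn (collisionIntegrand γ b f g z) {v' : Vel d | ε < ‖v' - z.2.2‖}) ∧
  Tendsto (truncQ₁ γ b f g z) (𝓝[>] (0 : ℝ)) (𝓝 (Q₁ γ b f g z))

end KineticBoltzmann

end

/-!
The kernel `K_f(v, v + a)` is an integral over the hyperplane `v + a^⊥` and is even in `a`. Hence
the principal value is one half of the absolutely convergent integral of `E(a) K(a)`, where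
`E(a) = g(v+a) + g(v-a) - 2 g(v)` and `K(a) = K_f(v, v + a)` (`Q₁_principal_value`), and
only the absolute size of `E` and `K` matters.

*Size of the kernel.* The upper bound for `b` cancels all powers of the relative speed, which leaves
`|a|^{-d-2s}` times the integral of `|f(v+w)| |w|^{γ+2s+1}` over `w ⊥ a`. If `f` decays like
`(1+|v|)^{-q}`, this integral is bounded by `planeWeight`, a weight that only depends on `v` and on
the distance of the hyperplane from the origin and that is homogeneous of degree zero in `a`
(`exists_planeOp_le`). In polar coordinates the average of the weight over all directions gains a
factor `(1+|v|)⁻¹`, because most hyperplanes through `v` stay at a distance comparable to `|v|` from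
the origin. If `E` is smaller than the critical size `|a|^{2s}` by a power of `|a|/R` below some
scale `R` and of `R/|a|` above it, this bounds `∫ E K` (`exists_lintegral_collision_le`); where
`v ± a` is close to the origin and `E` is not small, the hyperplane is far from the origin.

*Regularity of `g`.* A polynomial of kinetic degree `< 2s + α ≤ 3` has no dependence on `x`, is
affine in `t` and at most quadratic in `v` (`isSlabQuadratic_eval`). Thus `g` has Taylor expansions
in `v` at fixed `(t, x)`, and their second differences are `O(|a|^{2s+c})` for some `c > 0`.

*Hölder continuity.* For two points at kinetic distance `ρ` one writes
`E₁ K₁ - E₂ K₂ = E₁ (K₁ - K₂) + (E₁ - E₂) K₂`. Evaluating `f` and `g` at the velocity `v + a` instead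
of `v` shears the positions by `ρ^{2s} |a|`, so the kinetic distance becomes `R (1+|a|)^{1/(1+2s)}`
with `R = ρ^{2s/(1+2s)}` (`KNear.shift`). This explains both the exponent `2sα/(1+2s)`, for which
`ρ^{2sα/(1+2s)} = R^α`, and the loss of `α/(1+2s)` powers of `|v|`. For small `|a|` the difference
`E₁ - E₂` is bounded by `R^α |a|^{2s}` with a gain on both sides of the scale `R`
(`exists_secondDiff_sub_le`), so that the same integral bound applies (`exists_Q₁_holder`).

All constants depend on the time interval only through a radius `r ≤ 1` with `r^{2s} ≤ T - τ`: then
every point of the slab after the initial time lies in a cylinder of radius `r` inside the slab.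
-/

open MeasureTheory Filter Topology Set
open scoped ENNReal NNReal

noncomputable section

namespace KineticBoltzmann

/-! ### Integrals of decaying weights over hyperplanes -/

theorem integrable_shifted_weight {V : Type*} [NormedAddCommGroup V] [InnerProductSpace ℝ V]
    [FiniteDimensional ℝ V] [MeasurableSpace V] [BorelSpace V] {k h : ℝ}
    (hk : (Module.finrank ℝ V : ℝ) < k) (hh : 0 ≤ h) :
    Integrable (fun u : V => (1 + h + ‖u‖) ^ (-k)) := by
  have hk0 : 0 ≤ k := le_trans (Nat.cast_nonneg _) hk.le
  refine (integrable_one_add_norm (μ := (volume : Measure V)) hk).mono' ?_ ?_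
  · exact Measurable.aestronglyMeasurable (by fun_prop)
  · refine Eventually.of_forall fun u => ?_
    rw [Real.norm_of_nonneg (by positivity)]
    exact Real.rpow_le_rpow_of_nonpos (by positivity) (by linarith) (by linarith)

theorem integral_shifted_weight {V : Type*} [NormedAddCommGroup V] [InnerProductSpace ℝ V]
    [FiniteDimensional ℝ V] [MeasurableSpace V] [BorelSpace V] {n : ℕ}
    (hn : Module.finrank ℝ V = n) {k h : ℝ} (hh : 0 ≤ h) :
    ∫ u : V, (1 + h + ‖u‖) ^ (-k)
      = (1 + h) ^ ((n : ℝ) - k) * ∫ u : EuclideanSpace ℝ (Fin n), (1 + ‖u‖) ^ (-k) := by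
  have h1 : 0 < 1 + h := by linarith
  have key := Measure.integral_comp_smul (volume : Measure V)
    (fun u : V => (1 + h + ‖u‖) ^ (-k)) (1 + h)
  have e1 : ∀ x : V, (1 + h + ‖(1 + h) • x‖) ^ (-k) = (1 + h) ^ (-k) * (1 + ‖x‖) ^ (-k) := by
    intro x
    rw [norm_smul, Real.norm_of_nonneg h1.le, ← Real.mul_rpow h1.le (by positivity)]
    congr 1; ring
  simp only [e1] at key
  rw [integral_const_mul, hn, abs_of_pos (by positivity), smul_eq_mul] at key
  have e2 : ∫ u : V, (1 + ‖u‖) ^ (-k) = ∫ u : EuclideanSpace ℝ (Fin n), (1 + ‖u‖) ^ (-k) := by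
    let L : V ≃ₗᵢ[ℝ] EuclideanSpace ℝ (Fin n) :=
      ((stdOrthonormalBasis ℝ V).reindex (finCongr hn)).repr
    rw [← L.measurePreserving.integral_comp L.toHomeomorph.measurableEmbedding]
    simp
  rw [e2] at key
  rw [Real.rpow_sub h1, Real.rpow_natCast, div_eq_mul_inv, ← Real.rpow_neg h1.le, mul_assoc, key]
  field_simp

/-- The weight `(1+|v|)^m (1+h)^{d-1-q} + (1+h)^{m+d-1-q}` with `h = |v·a|/|a|`, the distance from
the origin to the hyperplane `v + a^⊥`. It controls the integral of `(1+|v+w|)^{-q} (1+|w|)^m` over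
`w ⊥ a`. -/
def planeWeight {d : ℕ} (q m : ℝ) (v a : Vel d) : ℝ :=
  (1 + ‖v‖) ^ m * (1 + |inner ℝ v a| / ‖a‖) ^ ((d : ℝ) - 1 - q)
    + (1 + |inner ℝ v a| / ‖a‖) ^ (m + ((d : ℝ) - 1) - q)

theorem planeWeight_nonneg {d : ℕ} (q m : ℝ) (v a : Vel d) : 0 ≤ planeWeight q m v a := by
  unfold planeWeight; positivity

theorem planeWeight_neg {d : ℕ} (q m : ℝ) (v a : Vel d) :
    planeWeight q m v (-a) = planeWeight q m v a := by
  simp [planeWeight]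

theorem measurable_planeWeight {d : ℕ} (q m : ℝ) (v : Vel d) :
    Measurable (planeWeight q m v) := by
  unfold planeWeight; fun_prop

theorem add_rpow_le_two_rpow {x y m : ℝ} (hx : 0 ≤ x) (hy : 0 ≤ y) (hm : 0 ≤ m) :
    (x + y) ^ m ≤ 2 ^ m * (x ^ m + y ^ m) := by
  have h1 : (x + y) ^ m ≤ (2 * max x y) ^ m :=
    Real.rpow_le_rpow (by positivity) (by linarith [le_max_left x y, le_max_right x y]) hm
  rw [Real.mul_rpow (by norm_num) (le_max_of_le_left hx)] at h1
  refine h1.trans (mul_le_mul_of_nonneg_left ?_ (by positivity))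
  rcases max_cases x y with ⟨h, _⟩ | ⟨h, _⟩ <;> rw [h] <;>
    linarith [Real.rpow_nonneg hx m, Real.rpow_nonneg hy m]

theorem finrank_hyperplane {d : ℕ} {a : Vel d} (ha : a ≠ 0) :
    Module.finrank ℝ (Submodule.span ℝ {a})ᗮ = d - 1 := by
  have h := Submodule.finrank_add_finrank_orthogonal (Submodule.span ℝ {a})
  rw [finrank_span_singleton ha, finrank_euclideanSpace, Fintype.card_fin] at h
  omega

/-- Pythagoras splits `|v + w|` into the distance `h` of the hyperplane from the origin and the
distance of `w` from the foot of the perpendicular; after a translation the integrand is radial. -/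
theorem exists_integral_plane_le {d : ℕ} (hd : 2 ≤ d) {q m : ℝ} (hm : 0 ≤ m)
    (hq : (d : ℝ) - 1 + m < q) :
    ∃ C : ℝ, 0 ≤ C ∧ ∀ v a : Vel d, a ≠ 0 →
      Integrable (fun w : (Submodule.span ℝ {a})ᗮ =>
        (1 + ‖v + (w : Vel d)‖) ^ (-q) * (1 + ‖(w : Vel d)‖) ^ m) ∧
      ∫ w : (Submodule.span ℝ {a})ᗮ, (1 + ‖v + (w : Vel d)‖) ^ (-q) * (1 + ‖(w : Vel d)‖) ^ m
        ≤ C * planeWeight q m v a := by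
  set n := d - 1
  have hn : (n : ℝ) = (d : ℝ) - 1 := by
    simp only [n]; rw [Nat.cast_sub (by omega)]; simp
  set I : ℝ → ℝ := fun k => ∫ u : EuclideanSpace ℝ (Fin n), (1 + ‖u‖) ^ (-k)
  have hI : ∀ k, 0 ≤ I k := fun k => integral_nonneg fun u => by positivity
  have hq0 : 0 ≤ q := by
    have : (2 : ℝ) ≤ d := by exact_mod_cast hd
    linarith
  refine ⟨2 ^ q * 2 ^ m * (I q + I (q - m)), by have := hI q; have := hI (q - m); positivity, ?_⟩
  intro v a ha
  set S := (Submodule.span ℝ {a})ᗮ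
  have hfr : Module.finrank ℝ S = n := finrank_hyperplane ha
  set h : ℝ := |inner ℝ v a| / ‖a‖
  have hna : 0 < ‖a‖ := norm_pos_iff.mpr ha
  have hh : 0 ≤ h := by positivity
  set p : S := S.orthogonalProjectionOnto v
  have hvp : v - (p : Vel d) = (inner ℝ a v / ‖a‖ ^ 2) • a := by
    have h1 := Submodule.starProjection_orthogonal_val (K := Submodule.span ℝ {a}) v
    have h2 := Submodule.starProjection_singleton ℝ (v := a) v
    have h3 : (p : Vel d) = v - (Submodule.span ℝ {a}).starProjection v := h1
    rw [h3, h2]; simp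
  have hnvp : ‖v - (p : Vel d)‖ = h := by
    rw [hvp, norm_smul, Real.norm_eq_abs, abs_div, abs_of_nonneg (sq_nonneg ‖a‖), real_inner_comm]
    simp only [h]; field_simp
  have hhv : h ≤ ‖v‖ := by
    simp only [h]; rw [div_le_iff₀ hna]; exact abs_real_inner_le_norm v a
  have horth : ∀ u : S, inner ℝ (v - (p : Vel d)) (u : Vel d) = 0 := by
    intro u
    rw [hvp, inner_smul_left]
    have : inner ℝ a (u : Vel d) = 0 := by
      have := u.2
      rw [Submodule.mem_orthogonal_singleton_iff_inner_right] at this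
      exact this
    simp [this]
  set G : S → ℝ := fun u => 2 ^ q * 2 ^ m *
    ((1 + ‖v‖) ^ m * (1 + h + ‖u‖) ^ (-q) + (1 + h + ‖u‖) ^ (-(q - m)))
  have hGi : Integrable G := by
    refine Integrable.const_mul (Integrable.add (Integrable.const_mul ?_ _) ?_) _
    · exact integrable_shifted_weight (by rw [hfr, hn]; linarith) hh
    · exact integrable_shifted_weight (by rw [hfr, hn]; linarith) hh
  have hGint : ∫ u, G u ≤ 2 ^ q * 2 ^ m * (I q + I (q - m)) * planeWeight q m v a := by
    simp only [G]
    rw [integral_const_mul, integral_add, integral_const_mul, integral_shifted_weight hfr hh,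
      integral_shifted_weight hfr hh]
    · rw [mul_assoc (2 ^ q * 2 ^ m)]
      refine mul_le_mul_of_nonneg_left ?_ (by positivity)
      unfold planeWeight
      have e : (n : ℝ) - (q - m) = m + ((d : ℝ) - 1) - q := by rw [hn]; ring
      rw [e, hn]
      change (1 + ‖v‖) ^ m * ((1 + h) ^ ((d : ℝ) - 1 - q) * I q) +
        (1 + h) ^ (m + ((d : ℝ) - 1) - q) * I (q - m) ≤ (I q + I (q - m)) *
        ((1 + ‖v‖) ^ m * (1 + h) ^ ((d : ℝ) - 1 - q) + (1 + h) ^ (m + ((d : ℝ) - 1) - q))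
      have a1 : 0 ≤ (1 + ‖v‖) ^ m * (1 + h) ^ ((d : ℝ) - 1 - q) * I (q - m) := by
        have := hI (q - m); positivity
      have a2 : 0 ≤ (1 + h) ^ (m + ((d : ℝ) - 1) - q) * I q := by have := hI q; positivity
      linarith
    · exact (integrable_shifted_weight (by rw [hfr, hn]; linarith) hh).const_mul _
    · exact integrable_shifted_weight (by rw [hfr, hn]; linarith) hh
  have hpt : ∀ w : S, (1 + ‖v + (w : Vel d)‖) ^ (-q) * (1 + ‖(w : Vel d)‖) ^ m ≤ G (w + p) := by
    intro w
    have hsplit : v + (w : Vel d) = (v - (p : Vel d)) + ((w + p : S) : Vel d) := by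
      simp
    have hpyth : ‖v + (w : Vel d)‖ ^ 2 = h ^ 2 + ‖w + p‖ ^ 2 := by
      rw [hsplit, norm_add_sq_real, horth, hnvp]; simp
    have hlow : h + ‖w + p‖ ≤ 2 * ‖v + (w : Vel d)‖ := by
      refine le_of_sq_le_sq ?_ (by positivity)
      nlinarith [sq_nonneg (h - ‖w + p‖), sq_nonneg h, sq_nonneg ‖w + p‖]
    have hlow' : (1 + h + ‖w + p‖) / 2 ≤ 1 + ‖v + (w : Vel d)‖ := by linarith
    have hpos : 0 < 1 + h + ‖w + p‖ := by positivity
    have h1 : (1 + ‖v + (w : Vel d)‖) ^ (-q) ≤ 2 ^ q * (1 + h + ‖w + p‖) ^ (-q) := by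
      refine (Real.rpow_le_rpow_of_nonpos (by positivity) hlow' (by linarith)).trans_eq ?_
      rw [Real.div_rpow hpos.le (by norm_num), Real.rpow_neg (by norm_num : (0:ℝ) ≤ 2)]
      field_simp
    have hw : ‖(w : Vel d)‖ ≤ ‖v‖ + ‖w + p‖ := by
      have e : (w : Vel d) = ((w + p : S) : Vel d) - (p : Vel d) := by simp
      have hp : ‖(p : Vel d)‖ ≤ ‖v‖ := by
        have := Submodule.norm_orthogonalProjectionOnto_apply_le S v
        exact this
      calc ‖(w : Vel d)‖ = ‖((w + p : S) : Vel d) - (p : Vel d)‖ := by rw [← e]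
        _ ≤ ‖((w + p : S) : Vel d)‖ + ‖(p : Vel d)‖ := norm_sub_le _ _
        _ ≤ _ := by rw [add_comm]; exact add_le_add hp le_rfl
    have h2 : (1 + ‖(w : Vel d)‖) ^ m
        ≤ 2 ^ m * ((1 + ‖v‖) ^ m + (1 + h + ‖w + p‖) ^ m) := by
      refine (Real.rpow_le_rpow (by positivity) ?_ hm).trans
        (add_rpow_le_two_rpow (by positivity) hpos.le hm)
      linarith
    calc _ ≤ (2 ^ q * (1 + h + ‖w + p‖) ^ (-q)) *
          (2 ^ m * ((1 + ‖v‖) ^ m + (1 + h + ‖w + p‖) ^ m)) := by gcongr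
      _ = G (w + p) := by
          simp only [G]
          rw [show -(q - m) = -q + m by ring, Real.rpow_add hpos]
          ring
  have hGi' : Integrable (fun w : S => G (w + p)) := hGi.comp_add_right p
  have hint : Integrable (fun w : S =>
      (1 + ‖v + (w : Vel d)‖) ^ (-q) * (1 + ‖(w : Vel d)‖) ^ m) := by
    refine hGi'.mono' (Measurable.aestronglyMeasurable (by fun_prop)) ?_
    refine Eventually.of_forall fun w => ?_
    rw [Real.norm_of_nonneg (by positivity)]
    exact hpt w
  refine ⟨hint, ?_⟩
  calc _ ≤ ∫ w : S, G (w + p) := integral_mono hint hGi' hpt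
    _ = ∫ w : S, G w := integral_add_right_eq_self G p
    _ ≤ _ := hGint

/-! ### Integrals in polar coordinates -/

theorem lintegral_volumeIoiPow (n : ℕ) {φ : ℝ → ℝ≥0∞} (hφ : Measurable φ) :
    ∫⁻ r : Ioi (0 : ℝ), φ r ∂(Measure.volumeIoiPow n)
      = ∫⁻ r in Ioi (0 : ℝ), ENNReal.ofReal (r ^ n) * φ r := by
  rw [Measure.volumeIoiPow, lintegral_withDensity_eq_lintegral_mul _ (by fun_prop) (by fun_prop)]
  exact lintegral_subtype_comap measurableSet_Ioi (fun r : ℝ => ENNReal.ofReal (r ^ n) * φ r)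

/-- Polar coordinates for a radial function times a function that is homogeneous of degree zero. -/
theorem lintegral_norm_mul_homogeneous {d : ℕ} (hd : 2 ≤ d) {φ : ℝ → ℝ≥0∞} (hφ : Measurable φ)
    {h : Vel d → ℝ≥0∞} (hh : Measurable h) (hom : ∀ r : ℝ, 0 < r → ∀ a, h (r • a) = h a) :
    ∫⁻ a : Vel d, φ ‖a‖ * h a
      = (∫⁻ σ, h σ ∂(volume : Measure (Vel d)).toSphere)
        * ∫⁻ r in Ioi (0 : ℝ), ENNReal.ofReal (r ^ (d - 1)) * φ r := by
  have hfr : Module.finrank ℝ (Vel d) = d := by simp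
  have : Nontrivial (Vel d) := Module.nontrivial_of_finrank_pos (R := ℝ) (by rw [hfr]; omega)
  have mp := (volume : Measure (Vel d)).measurePreserving_homeomorphUnitSphereProd
  rw [hfr] at mp
  have e := mp.lintegral_comp (f := fun p => h p.1 * φ p.2) (by fun_prop)
  rw [lintegral_prod_mul (f := fun σ : Metric.sphere (0 : Vel d) 1 => h σ)
    (g := fun r : Ioi (0 : ℝ) => φ r) (by fun_prop) (by fun_prop),
    lintegral_volumeIoiPow _ hφ] at e
  rw [← e]
  have e2 : ∀ x : ({0}ᶜ : Set (Vel d)),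
      h ((homeomorphUnitSphereProd (Vel d) x).1) * φ ((homeomorphUnitSphereProd (Vel d) x).2)
        = φ ‖(x : Vel d)‖ * h x := by
    intro x
    have hx : 0 < ‖(x : Vel d)‖ := norm_pos_iff.mpr x.2
    simp only [homeomorphUnitSphereProd_apply_fst_coe, homeomorphUnitSphereProd_apply_snd_coe]
    rw [hom _ (inv_pos.mpr hx), mul_comm]
  simp only [e2]
  rw [lintegral_subtype_comap (measurableSet_singleton (0 : Vel d)).compl
    (fun x => φ ‖x‖ * h x), restrict_compl_singleton]

theorem lintegral_Ioo_rpow {ε R : ℝ} (hε : 0 < ε) (hR : 0 < R) :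
    ∫⁻ r in Ioo 0 R, ENNReal.ofReal (r ^ (ε - 1)) = ENNReal.ofReal (R ^ ε / ε) := by
  have hi : IntervalIntegrable (fun r : ℝ => r ^ (ε - 1)) volume 0 R :=
    intervalIntegral.intervalIntegrable_rpow' (by linarith)
  rw [intervalIntegrable_iff_integrableOn_Ioo_of_le hR.le] at hi
  rw [← ofReal_integral_eq_lintegral_ofReal hi]
  · rw [← integral_Ioc_eq_integral_Ioo, ← intervalIntegral.integral_of_le hR.le,
      integral_rpow (Or.inl (by linarith))]
    simp [Real.zero_rpow hε.ne']
  · filter_upwards [ae_restrict_mem measurableSet_Ioo] with r hr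
    exact Real.rpow_nonneg hr.1.le _

theorem lintegral_Ioi_rpow_neg {ε R : ℝ} (hε : 0 < ε) (hR : 0 < R) :
    ∫⁻ r in Ioi R, ENNReal.ofReal (r ^ (-ε - 1)) = ENNReal.ofReal (R ^ (-ε) / ε) := by
  rw [← ofReal_integral_eq_lintegral_ofReal (integrableOn_Ioi_rpow_of_lt (by linarith) hR)]
  · rw [integral_Ioi_rpow_of_lt (by linarith) hR]
    congr 1
    rw [show -ε - 1 + 1 = -ε by ring, neg_div_neg_eq]
  · filter_upwards [ae_restrict_mem measurableSet_Ioi] with r hr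
    exact Real.rpow_nonneg (hR.trans hr).le _

/-- Integrals over the sphere are traded for integrals over the unit ball, where Cartesian coordinates
are available. -/
theorem lintegral_sphere_eq_ball {d : ℕ} (hd : 2 ≤ d)
    {h : Vel d → ℝ≥0∞} (hh : Measurable h) (hom : ∀ r : ℝ, 0 < r → ∀ a, h (r • a) = h a) :
    ∫⁻ σ, h σ ∂(volume : Measure (Vel d)).toSphere
      = ENNReal.ofReal d * ∫⁻ a in Metric.ball (0 : Vel d) 1, h a := by
  have hd0 : (0 : ℝ) < d := by positivity
  have e := lintegral_norm_mul_homogeneous hd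
    (φ := (Iio (1 : ℝ)).indicator 1) (measurable_one.indicator measurableSet_Iio) hh hom
  have e1 : ∫⁻ a : Vel d, (Iio (1 : ℝ)).indicator 1 ‖a‖ * h a
      = ∫⁻ a in Metric.ball (0 : Vel d) 1, h a := by
    rw [← lintegral_indicator Metric.isOpen_ball.measurableSet]
    congr 1; ext a
    by_cases ha : ‖a‖ < 1 <;> simp [indicator, ha]
  have e2 : ∫⁻ r in Ioi (0 : ℝ), ENNReal.ofReal (r ^ (d - 1)) * (Iio (1 : ℝ)).indicator 1 r
      = ENNReal.ofReal (1 / d) := by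
    have : ∀ r : ℝ, ENNReal.ofReal (r ^ (d - 1)) * (Iio (1 : ℝ)).indicator 1 r
        = (Iio (1 : ℝ)).indicator (fun r => ENNReal.ofReal (r ^ ((d : ℝ) - 1))) r := by
      intro r
      by_cases hr : r < 1
      · simp only [indicator, mem_Iio, hr, if_true, Pi.one_apply, mul_one]
        congr 1
        rw [← Real.rpow_natCast, Nat.cast_sub (by omega)]; simp
      · simp [indicator, hr]
    simp only [this]
    rw [lintegral_indicator measurableSet_Iio, Measure.restrict_restrict measurableSet_Iio,
      inter_comm, Ioi_inter_Iio, lintegral_Ioo_rpow hd0 one_pos]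
    simp
  rw [e1, e2] at e
  rw [e, mul_comm, mul_assoc, ← ENNReal.ofReal_mul (by positivity)]
  simp [hd0.ne']

theorem lintegral_ball_rpow_mul {d : ℕ} (hd : 2 ≤ d) {ε R : ℝ} (hε : 0 < ε) (hR : 0 < R)
    {h : Vel d → ℝ≥0∞} (hh : Measurable h) (hom : ∀ r : ℝ, 0 < r → ∀ a, h (r • a) = h a) :
    ∫⁻ a in {a : Vel d | ‖a‖ < R}, ENNReal.ofReal (‖a‖ ^ (ε - d)) * h a
      = ENNReal.ofReal (d * (R ^ ε / ε)) * ∫⁻ a in Metric.ball (0 : Vel d) 1, h a := by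
  have e := lintegral_norm_mul_homogeneous hd
    (φ := (Iio R).indicator (fun r => ENNReal.ofReal (r ^ (ε - d))))
    (Measurable.indicator (by fun_prop) measurableSet_Iio) hh hom
  have e1 : ∫⁻ a : Vel d, (Iio R).indicator (fun r => ENNReal.ofReal (r ^ (ε - d))) ‖a‖ * h a
      = ∫⁻ a in {a : Vel d | ‖a‖ < R}, ENNReal.ofReal (‖a‖ ^ (ε - d)) * h a := by
    rw [← lintegral_indicator (measurableSet_lt measurable_norm measurable_const)]
    congr 1; ext a
    by_cases ha : ‖a‖ < R <;> simp [indicator, ha]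
  have e2 : ∫⁻ r in Ioi (0 : ℝ), ENNReal.ofReal (r ^ (d - 1)) *
      (Iio R).indicator (fun r => ENNReal.ofReal (r ^ (ε - d))) r
      = ENNReal.ofReal (R ^ ε / ε) := by
    rw [← lintegral_Ioo_rpow hε hR, ← Ioi_inter_Iio, inter_comm,
      ← Measure.restrict_restrict measurableSet_Iio, ← lintegral_indicator measurableSet_Iio]
    refine setLIntegral_congr_fun measurableSet_Ioi fun r (hr : 0 < r) => ?_
    by_cases hr' : r < R
    · simp only [indicator, mem_Iio, hr', if_true]
      rw [← ENNReal.ofReal_mul (by positivity), ← Real.rpow_natCast, ← Real.rpow_add hr,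
        Nat.cast_sub (by omega)]
      congr 2; push_cast; ring
    · simp [indicator, hr']
  rw [← e1, e, e2, lintegral_sphere_eq_ball hd hh hom, mul_comm, ← mul_assoc,
    ← ENNReal.ofReal_mul (by positivity), mul_comm (d : ℝ)]

theorem lintegral_compl_ball_rpow_mul {d : ℕ} (hd : 2 ≤ d) {ε R : ℝ} (hε : 0 < ε) (hR : 0 < R)
    {h : Vel d → ℝ≥0∞} (hh : Measurable h) (hom : ∀ r : ℝ, 0 < r → ∀ a, h (r • a) = h a) :
    ∫⁻ a in {a : Vel d | R ≤ ‖a‖}, ENNReal.ofReal (‖a‖ ^ (-ε - d)) * h a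
      = ENNReal.ofReal (d * (R ^ (-ε) / ε)) * ∫⁻ a in Metric.ball (0 : Vel d) 1, h a := by
  have e := lintegral_norm_mul_homogeneous hd
    (φ := (Ici R).indicator (fun r => ENNReal.ofReal (r ^ (-ε - d))))
    (Measurable.indicator (by fun_prop) measurableSet_Ici) hh hom
  have e1 : ∫⁻ a : Vel d, (Ici R).indicator (fun r => ENNReal.ofReal (r ^ (-ε - d))) ‖a‖ * h a
      = ∫⁻ a in {a : Vel d | R ≤ ‖a‖}, ENNReal.ofReal (‖a‖ ^ (-ε - d)) * h a := by
    rw [← lintegral_indicator (measurableSet_le measurable_const measurable_norm)]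
    congr 1; ext a
    by_cases ha : R ≤ ‖a‖ <;> simp [indicator, ha]
  have e2 : ∫⁻ r in Ioi (0 : ℝ), ENNReal.ofReal (r ^ (d - 1)) *
      (Ici R).indicator (fun r => ENNReal.ofReal (r ^ (-ε - d))) r
      = ENNReal.ofReal (R ^ (-ε) / ε) := by
    have hs : Ici R ∩ Ioi 0 = Ici R := inter_eq_left.mpr fun r (hr : R ≤ r) => hR.trans_le hr
    rw [← lintegral_Ioi_rpow_neg hε hR, setLIntegral_congr (Ioi_ae_eq_Ici (a := R)), ← hs,
      ← Measure.restrict_restrict measurableSet_Ici, ← lintegral_indicator measurableSet_Ici, hs]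
    refine setLIntegral_congr_fun measurableSet_Ioi fun r (hr : 0 < r) => ?_
    by_cases hr' : R ≤ r
    · simp only [indicator, mem_Ici, hr', if_true]
      rw [← ENNReal.ofReal_mul (by positivity), ← Real.rpow_natCast, ← Real.rpow_add hr,
        Nat.cast_sub (by omega)]
      congr 2; push_cast; ring
    · simp [indicator, hr']
  rw [← e1, e, e2, lintegral_sphere_eq_ball hd hh hom, mul_comm, ← mul_assoc,
    ← ENNReal.ofReal_mul (by positivity), mul_comm (d : ℝ)]

/-! ### The spherical average of the hyperplane weight -/

/-- The exponent `M > 1` makes the weight integrable in the direction of `v`, which is what gains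
the factor `(1+|v|)⁻¹`. -/
theorem exists_lintegral_ball_inner_le {d : ℕ} (hd : 2 ≤ d) {M : ℝ} (hM : 1 < M) :
    ∃ C : ℝ, 0 ≤ C ∧ ∀ v : Vel d,
      ∫⁻ a in Metric.ball (0 : Vel d) 1, ENNReal.ofReal ((1 + |inner ℝ v a|) ^ (-M))
        ≤ ENNReal.ofReal (C * (1 + ‖v‖)⁻¹) := by
  set J : ℝ := ∫ y : ℝ, (1 + ‖y‖) ^ (-M)
  have hJi : Integrable (fun y : ℝ => (1 + ‖y‖) ^ (-M)) :=
    integrable_one_add_norm (by simpa using hM)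
  have hJ : 0 ≤ J := integral_nonneg fun y => by positivity
  set B : ℝ := (volume (Metric.ball (0 : Vel d) 1)).toReal
  have hB : volume (Metric.ball (0 : Vel d) 1) = ENNReal.ofReal B :=
    (ENNReal.ofReal_toReal measure_ball_lt_top.ne).symm
  refine ⟨2 * B + 2 * (2 ^ (d - 1) * J), by positivity, fun v => ?_⟩
  have hvp : 0 < 1 + ‖v‖ := by positivity
  rcases le_or_gt ‖v‖ 1 with hv | hv
  · calc _ ≤ ∫⁻ a in Metric.ball (0 : Vel d) 1, 1 := by
          refine lintegral_mono fun a => ?_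
          rw [ENNReal.ofReal_le_one]
          refine Real.rpow_le_one_of_one_le_of_nonpos ?_ (by linarith)
          linarith [abs_nonneg (inner ℝ v a)]
      _ = ENNReal.ofReal B := by simp [hB]
      _ ≤ _ := by
          refine ENNReal.ofReal_le_ofReal ?_
          rw [← div_eq_mul_inv, le_div_iff₀ hvp]
          have : 0 ≤ 2 * (2 ^ (d - 1) * J) := by positivity
          nlinarith [ENNReal.toReal_nonneg (a := volume (Metric.ball (0 : Vel d) 1))]
  · have hv0 : 0 < ‖v‖ := by linarith
    let i0 : Fin d := ⟨0, by omega⟩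
    -- an isometry that sends `v` to a multiple of a coordinate vector
    set e0 : Vel d := EuclideanSpace.single i0 ‖v‖
    have hne : ‖e0‖ = ‖v‖ := by simp [e0]
    set L : Vel d ≃ₗᵢ[ℝ] Vel d := (Submodule.span ℝ {e0 - v})ᗮ.reflection
    have hL : L e0 = v := Submodule.reflection_sub hne
    set g : Fin d → ℝ → ℝ := fun i y =>
      if i = i0 then (1 + ‖‖v‖ * y‖) ^ (-M) else (Icc (-1 : ℝ) 1).indicator 1 y
    have hg0 : ∀ i y, 0 ≤ g i y := by
      intro i y; simp only [g]; split_ifs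
      · positivity
      · exact indicator_nonneg (by simp) _
    have hgi : ∀ i, Integrable (g i) := by
      intro i
      by_cases hi : i = i0
      · simp only [g, hi, if_true]
        exact hJi.comp_mul_left' hv0.ne'
      · simp only [g, hi, if_false]
        exact (integrable_indicator_iff measurableSet_Icc).mpr (integrableOn_const (by simp))
    have hprod : ∏ i, ∫ y, g i y = 2 ^ (d - 1) * (‖v‖⁻¹ * J) := by
      rw [← Finset.mul_prod_erase _ _ (Finset.mem_univ i0), mul_comm]
      congr 1
      · rw [Finset.prod_congr rfl (g := fun _ => (2 : ℝ))]
        · simp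
        · intro i hi
          have : i ≠ i0 := Finset.ne_of_mem_erase hi
          simp only [g, this, if_false]
          rw [integral_indicator measurableSet_Icc]
          simp; norm_num
      · simp only [g, if_true]
        rw [Measure.integral_comp_mul_left (fun y : ℝ => (1 + ‖y‖) ^ (-M)), abs_of_pos (by positivity)]
        rfl
    have hint : Integrable (fun x : Fin d → ℝ => ∏ i, g i (x i)) := Integrable.fintype_prod hgi
    have hint' : Integrable (fun x : Vel d => ∏ i, g i (x i)) :=
      (PiLp.volume_preserving_ofLp (Fin d)).integrable_comp_of_integrable hint
    have hval : ∫ x : Vel d, ∏ i, g i (x i) = 2 ^ (d - 1) * (‖v‖⁻¹ * J) := by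
      have := (PiLp.volume_preserving_ofLp (Fin d)).integral_comp
        (MeasurableEquiv.toLp 2 (Fin d → ℝ)).symm.measurableEmbedding
        (fun x : Fin d → ℝ => ∏ i, g i (x i))
      rw [integral_fintype_prod_volume_eq_prod, hprod] at this
      exact this
    calc ∫⁻ a in Metric.ball (0 : Vel d) 1, ENNReal.ofReal ((1 + |inner ℝ v a|) ^ (-M))
        = ∫⁻ a in Metric.ball (0 : Vel d) 1, ENNReal.ofReal ((1 + |inner ℝ v (L a)|) ^ (-M)) := by
          rw [← lintegral_indicator Metric.isOpen_ball.measurableSet,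
            ← lintegral_indicator Metric.isOpen_ball.measurableSet,
            ← L.measurePreserving.lintegral_comp
              (Measurable.indicator (by fun_prop) Metric.isOpen_ball.measurableSet)]
          congr 1; ext a
          by_cases ha : ‖a‖ < 1 <;> simp [indicator, ha]
      _ ≤ ∫⁻ x : Vel d, ENNReal.ofReal (∏ i, g i (x i)) := by
          rw [← lintegral_indicator Metric.isOpen_ball.measurableSet]
          refine lintegral_mono fun x => ?_
          by_cases hx : x ∈ Metric.ball (0 : Vel d) 1
          · rw [indicator_of_mem hx]
            refine ENNReal.ofReal_le_ofReal (le_of_eq ?_)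
            rw [mem_ball_zero_iff] at hx
            rw [← Finset.mul_prod_erase _ _ (Finset.mem_univ i0),
              Finset.prod_eq_one (s := Finset.univ.erase i0)]
            · have : inner ℝ v (L x) = ‖v‖ * x i0 := by
                conv_lhs => rw [← hL, L.inner_map_map]
                simp [e0, EuclideanSpace.inner_single_left]
              simp only [g, if_true, mul_one, this, Real.norm_eq_abs]
            · intro i hi
              have hi' : i ≠ i0 := Finset.ne_of_mem_erase hi
              have : ‖x i‖ ≤ 1 := (PiLp.norm_apply_le x i).trans hx.le
              rw [Real.norm_eq_abs, abs_le] at this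
              simp [g, hi', indicator, this]
          · simp [indicator_of_notMem hx]
      _ = ENNReal.ofReal (2 ^ (d - 1) * (‖v‖⁻¹ * J)) := by
          rw [← hval, ofReal_integral_eq_lintegral_ofReal hint']
          exact Eventually.of_forall fun x => Finset.prod_nonneg fun i _ => hg0 i _
      _ ≤ _ := by
          refine ENNReal.ofReal_le_ofReal ?_
          have h1 : ‖v‖⁻¹ ≤ 2 * (1 + ‖v‖)⁻¹ := by
            rw [← div_eq_mul_inv, inv_eq_one_div, div_le_div_iff₀ hv0 hvp]; linarith
          have h2 : 0 ≤ 2 * B * (1 + ‖v‖)⁻¹ := by positivity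
          calc 2 ^ (d - 1) * (‖v‖⁻¹ * J) ≤ 2 ^ (d - 1) * ((2 * (1 + ‖v‖)⁻¹) * J) := by gcongr
            _ ≤ _ := by linarith

/-- The average over the directions lowers the power `(1+|v|)^m` in `planeWeight` by one. -/
theorem exists_lintegral_ball_planeWeight_le {d : ℕ} (hd : 2 ≤ d) {q m : ℝ} (hm : 1 ≤ m)
    (hq : (d : ℝ) - 1 + m < q) :
    ∃ C : ℝ, 0 ≤ C ∧ ∀ v : Vel d,
      ∫⁻ a in Metric.ball (0 : Vel d) 1, ENNReal.ofReal (planeWeight q m v a)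
        ≤ ENNReal.ofReal (C * (1 + ‖v‖) ^ (m - 1)) := by
  obtain ⟨C, hC, h⟩ := exists_lintegral_ball_inner_le hd (M := q - ((d : ℝ) - 1)) (by linarith)
  set B : ℝ := (volume (Metric.ball (0 : Vel d) 1)).toReal
  have hB : volume (Metric.ball (0 : Vel d) 1) = ENNReal.ofReal B :=
    (ENNReal.ofReal_toReal measure_ball_lt_top.ne).symm
  refine ⟨C + B, by positivity, fun v => ?_⟩
  have hvp : 0 < 1 + ‖v‖ := by positivity
  calc _ ≤ ∫⁻ a in Metric.ball (0 : Vel d) 1, (ENNReal.ofReal ((1 + ‖v‖) ^ m) *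
          ENNReal.ofReal ((1 + |inner ℝ v a|) ^ (-(q - ((d : ℝ) - 1)))) + 1) := by
        refine setLIntegral_mono (by fun_prop) fun a ha => ?_
        rw [mem_ball_zero_iff] at ha
        rw [← ENNReal.ofReal_mul (by positivity), ← ENNReal.ofReal_one,
          ← ENNReal.ofReal_add (by positivity) zero_le_one]
        refine ENNReal.ofReal_le_ofReal ?_
        unfold planeWeight
        refine add_le_add (mul_le_mul_of_nonneg_left ?_ (by positivity)) ?_
        · rw [show -(q - ((d : ℝ) - 1)) = (d : ℝ) - 1 - q by ring]
          refine Real.rpow_le_rpow_of_nonpos (by positivity) ?_ (by linarith)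
          rcases eq_or_ne a 0 with rfl | h0
          · simp
          · have : 0 < ‖a‖ := norm_pos_iff.mpr h0
            have := le_div_self (abs_nonneg (inner ℝ v a)) this ha.le
            linarith
        · exact Real.rpow_le_one_of_one_le_of_nonpos
            (by linarith [show 0 ≤ |inner ℝ v a| / ‖a‖ by positivity]) (by linarith)
    _ = ENNReal.ofReal ((1 + ‖v‖) ^ m) * (∫⁻ a in Metric.ball (0 : Vel d) 1,
          ENNReal.ofReal ((1 + |inner ℝ v a|) ^ (-(q - ((d : ℝ) - 1))))) + ENNReal.ofReal B := by
        rw [lintegral_add_right _ measurable_const, lintegral_const_mul _ (by fun_prop)]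
        simp [hB]
    _ ≤ ENNReal.ofReal ((1 + ‖v‖) ^ m) * ENNReal.ofReal (C * (1 + ‖v‖)⁻¹) + ENNReal.ofReal B := by
        gcongr; exact h v
    _ ≤ _ := by
        rw [← ENNReal.ofReal_mul (by positivity), ← ENNReal.ofReal_add (by positivity) (by positivity)]
        refine ENNReal.ofReal_le_ofReal ?_
        rw [Real.rpow_sub_one hvp.ne']
        have : 1 ≤ (1 + ‖v‖) ^ m / (1 + ‖v‖) := by
          rw [← Real.rpow_sub_one hvp.ne']
          exact Real.one_le_rpow (by linarith [norm_nonneg v]) (by linarith)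
        have hB0 : 0 ≤ B := ENNReal.toReal_nonneg
        have e : (1 + ‖v‖) ^ m * (C * (1 + ‖v‖)⁻¹) = C * ((1 + ‖v‖) ^ m / (1 + ‖v‖)) := by
          field_simp
        rw [e]; nlinarith

/-! ### The collision integral against the hyperplane weight -/

theorem planeWeight_smul {d : ℕ} (q m : ℝ) (v : Vel d) {r : ℝ} (hr : 0 < r) (a : Vel d) :
    planeWeight q m v (r • a) = planeWeight q m v a := by
  have : |inner ℝ v (r • a)| / ‖r • a‖ = |inner ℝ v a| / ‖a‖ := by
    rw [inner_smul_right, norm_smul, abs_mul, Real.norm_eq_abs, mul_div_mul_left _ _ (by positivity)]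
  simp only [planeWeight, this]

theorem exists_lintegral_planeWeight_le {d : ℕ} (hd : 2 ≤ d) {q m : ℝ} (hm : 1 ≤ m)
    (hq : (d : ℝ) - 1 + m < q) {ε : ℝ} (hε : 0 < ε) :
    ∃ C : ℝ, 0 ≤ C ∧ ∀ (v : Vel d) (R : ℝ), 0 < R →
      ∫⁻ a in {a : Vel d | ‖a‖ < R}, ENNReal.ofReal (‖a‖ ^ (ε - d) * planeWeight q m v a)
        ≤ ENNReal.ofReal (C * R ^ ε * (1 + ‖v‖) ^ (m - 1)) ∧
      ∫⁻ a in {a : Vel d | R ≤ ‖a‖}, ENNReal.ofReal (‖a‖ ^ (-ε - d) * planeWeight q m v a)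
        ≤ ENNReal.ofReal (C * R ^ (-ε) * (1 + ‖v‖) ^ (m - 1)) := by
  obtain ⟨C, hC, h⟩ := exists_lintegral_ball_planeWeight_le hd hm hq
  refine ⟨d / ε * C, by positivity, fun v R hR => ?_⟩
  have hmeas : Measurable fun a : Vel d => ENNReal.ofReal (planeWeight q m v a) :=
    (measurable_planeWeight q m v).ennreal_ofReal
  have hom : ∀ r : ℝ, 0 < r → ∀ a : Vel d,
      ENNReal.ofReal (planeWeight q m v (r • a)) = ENNReal.ofReal (planeWeight q m v a) :=
    fun r hr a => by rw [planeWeight_smul q m v hr a]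
  constructor
  · have e := lintegral_ball_rpow_mul hd hε hR hmeas hom
    simp_rw [← ENNReal.ofReal_mul (Real.rpow_nonneg (norm_nonneg _) _)] at e
    rw [e]
    refine (mul_le_mul_right (h v) _).trans ?_
    rw [← ENNReal.ofReal_mul (by positivity)]
    exact ENNReal.ofReal_le_ofReal (le_of_eq (by ring))
  · have e := lintegral_compl_ball_rpow_mul hd hε hR hmeas hom
    simp_rw [← ENNReal.ofReal_mul (Real.rpow_nonneg (norm_nonneg _) _)] at e
    rw [e]
    refine (mul_le_mul_right (h v) _).trans ?_
    rw [← ENNReal.ofReal_mul (by positivity)]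
    exact ENNReal.ofReal_le_ofReal (le_of_eq (by ring))

/-- When `|v + a| < |v|/2` the hyperplane `v + a^⊥` stays at distance `≥ |v|/3` from the origin,
so that the weight decays although `v + a` may be small. -/
theorem rpow_mul_planeWeight_le {d : ℕ} (hd : 2 ≤ d) {q m k r : ℝ} (hm : 1 ≤ m)
    (hq : (d : ℝ) - 1 + m < q) (hk : 0 ≤ k) (hr : 0 < r) {v a : Vel d} (har : r ≤ ‖a‖)
    (hva : ‖v + a‖ < ‖v‖ / 2) :
    ‖a‖ ^ (-k) * planeWeight q m v a
      ≤ (r⁻¹ + 2) ^ k * (2 * 3 ^ q) * (1 + ‖v‖) ^ (m + ((d : ℝ) - 1) - q - k) := by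
  have hd1 : (1 : ℝ) ≤ (d : ℝ) - 1 := by
    have : (2 : ℝ) ≤ d := by exact_mod_cast hd
    linarith
  have hvp : 0 < 1 + ‖v‖ := by positivity
  have hapos : 0 < ‖a‖ := hr.trans_le har
  have ha1 : ‖a‖ ≤ 3 / 2 * ‖v‖ := by
    have : ‖a‖ ≤ ‖v + a‖ + ‖v‖ := by
      simpa using norm_sub_le (v + a) v
    linarith
  have ha2 : ‖v‖ / 2 ≤ ‖a‖ := by
    have : ‖v‖ ≤ ‖v + a‖ + ‖a‖ := by
      simpa using norm_sub_le (v + a) a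
    linarith
  have hin : ‖v‖ ^ 2 / 2 ≤ |inner ℝ v a| := by
    have h1 : inner ℝ v (v + a) ≤ ‖v‖ * (‖v‖ / 2) :=
      (real_inner_le_norm v (v + a)).trans (by gcongr)
    rw [inner_add_right, real_inner_self_eq_norm_sq] at h1
    have := neg_abs_le (inner ℝ v a)
    nlinarith
  have hh : (1 + ‖v‖) / 3 ≤ 1 + |inner ℝ v a| / ‖a‖ := by
    have : ‖v‖ / 3 ≤ |inner ℝ v a| / ‖a‖ := by
      rw [div_le_div_iff₀ (by norm_num) hapos]
      nlinarith [norm_nonneg v]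
    linarith
  have hpow : ∀ e : ℝ, -q ≤ e → e ≤ 0 →
      (1 + |inner ℝ v a| / ‖a‖) ^ e ≤ 3 ^ q * (1 + ‖v‖) ^ e := by
    intro e he1 he
    refine (Real.rpow_le_rpow_of_nonpos (by positivity) hh he).trans ?_
    rw [Real.div_rpow hvp.le (by norm_num), div_eq_mul_inv, ← Real.rpow_neg (by norm_num), mul_comm]
    gcongr
    · norm_num
    · linarith
  have hH : planeWeight q m v a ≤ 2 * 3 ^ q * (1 + ‖v‖) ^ (m + ((d : ℝ) - 1) - q) := by
    unfold planeWeight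
    have h1 := hpow ((d : ℝ) - 1 - q) (by linarith) (by linarith)
    have h2 := hpow (m + ((d : ℝ) - 1) - q) (by linarith) (by linarith)
    have h3 : (1 + ‖v‖) ^ m * (1 + |inner ℝ v a| / ‖a‖) ^ ((d : ℝ) - 1 - q)
        ≤ 3 ^ q * (1 + ‖v‖) ^ (m + ((d : ℝ) - 1) - q) := by
      refine (mul_le_mul_of_nonneg_left h1 (by positivity)).trans_eq ?_
      rw [show m + ((d : ℝ) - 1) - q = m + ((d : ℝ) - 1 - q) by ring, Real.rpow_add hvp]
      ring
    linarith
  have hA : ‖a‖ ^ (-k) ≤ (r⁻¹ + 2) ^ k * (1 + ‖v‖) ^ (-k) := by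
    have h1 : (1 + ‖v‖) / (r⁻¹ + 2) ≤ ‖a‖ := by
      rw [div_le_iff₀ (by positivity)]
      have : 1 ≤ ‖a‖ * r⁻¹ := by rw [← div_eq_mul_inv, le_div_iff₀ hr]; linarith
      linarith
    refine (Real.rpow_le_rpow_of_nonpos (by positivity) h1 (by linarith)).trans_eq ?_
    rw [Real.div_rpow hvp.le (by positivity), div_eq_mul_inv, ← Real.rpow_neg (by positivity),
      neg_neg, mul_comm]
  calc _ ≤ ((r⁻¹ + 2) ^ k * (1 + ‖v‖) ^ (-k)) *
        (2 * 3 ^ q * (1 + ‖v‖) ^ (m + ((d : ℝ) - 1) - q)) := by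
        gcongr
        exact planeWeight_nonneg _ _ _ _
    _ = _ := by
        rw [sub_eq_add_neg (m + ((d : ℝ) - 1) - q) k, Real.rpow_add hvp]; ring

/-- Either `|v + a|` is comparable to `|v|`, so that the decay at `v` is available, or the weight of
the hyperplane decays. -/
theorem far_term_le {d : ℕ} (hd : 2 ≤ d) {q m k r : ℝ} (hm : 1 ≤ m)
    (hq : (d : ℝ) - 1 + m < q) (hk : 0 ≤ k) (hr : 0 < r) {v a : Vel d} (har : r ≤ ‖a‖) :
    (1 + ‖v + a‖) ^ (-q) * (‖a‖ ^ (-k) * planeWeight q m v a)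
      ≤ 2 ^ q * (1 + ‖v‖) ^ (-q) * (‖a‖ ^ (-k) * planeWeight q m v a)
        + (r⁻¹ + 2) ^ k * (2 * 3 ^ q) * (1 + ‖v‖) ^ (m + ((d : ℝ) - 1) - q - k)
          * (1 + ‖v + a‖) ^ (-q) := by
  have hH := planeWeight_nonneg q m v a
  have hq0 : 0 ≤ q := by
    have : (0 : ℝ) ≤ d := by positivity
    linarith
  have hvp : 0 < 1 + ‖v‖ := by positivity
  rcases lt_or_ge ‖v + a‖ (‖v‖ / 2) with h | h
  · have := rpow_mul_planeWeight_le hd hm hq hk hr har h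
    rw [mul_comm]
    refine (mul_le_mul_of_nonneg_right this (by positivity)).trans ?_
    have : 0 ≤ 2 ^ q * (1 + ‖v‖) ^ (-q) * (‖a‖ ^ (-k) * planeWeight q m v a) := by positivity
    linarith
  · have h1 : (1 + ‖v + a‖) ^ (-q) ≤ 2 ^ q * (1 + ‖v‖) ^ (-q) := by
      have h2 : (1 + ‖v‖) / 2 ≤ 1 + ‖v + a‖ := by linarith
      refine (Real.rpow_le_rpow_of_nonpos (by positivity) h2 (by linarith)).trans_eq ?_
      rw [Real.div_rpow hvp.le (by norm_num), div_eq_mul_inv, ← Real.rpow_neg (by norm_num),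
        neg_neg, mul_comm]
    refine (mul_le_mul_of_nonneg_right h1 (by positivity)).trans ?_
    have : 0 ≤ (r⁻¹ + 2) ^ k * (2 * 3 ^ q) * (1 + ‖v‖) ^ (m + ((d : ℝ) - 1) - q - k)
          * (1 + ‖v + a‖) ^ (-q) := by positivity
    linarith

/-- Absolute bound for `∫ E K` when `K` has the size of a Boltzmann kernel and `E` gains a power of
`|a|/R` below the scale `R` and of `R/|a|` above it, relative to the critical size `|a|^{2s}`. For
`|a| > r₁` only decay of `E` is available, in one of the three points `v`, `v + a`, `v - a`. -/
theorem exists_lintegral_collision_le {d : ℕ} (hd : 2 ≤ d) {s q m κ c r₁ : ℝ} (hm : 1 ≤ m)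
    (hq : (d : ℝ) - 1 + m < q) (hκ0 : 0 ≤ κ) (hκ : κ < 2 * s) (hc : 0 < c) (hr₁ : 0 < r₁) :
    ∃ C : ℝ, 0 ≤ C ∧ ∀ (v : Vel d) (R M B : ℝ) (E K : Vel d → ℝ), 0 < R → R ≤ r₁ →
      0 ≤ M → 0 ≤ B →
      (∀ a, a ≠ 0 → |K a| ≤ B * (‖a‖ ^ (-2 * s - d) * planeWeight q m v a)) →
      (∀ a, ‖a‖ < R → |E a| ≤ M * ((1 + ‖v‖) ^ (-q) * (‖a‖ ^ (2 * s) * (‖a‖ / R) ^ c))) →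
      (∀ a, R ≤ ‖a‖ → ‖a‖ ≤ r₁ →
        |E a| ≤ M * ((1 + ‖v‖) ^ (-q) * (‖a‖ ^ (2 * s) * (R / ‖a‖) ^ c))) →
      (∀ a, r₁ < ‖a‖ → |E a| ≤ M * (‖a‖ ^ κ *
        ((1 + ‖v‖) ^ (-q) + (1 + ‖v + a‖) ^ (-q) + (1 + ‖v - a‖) ^ (-q)))) →
      ∫⁻ a, ENNReal.ofReal |E a * K a|
        ≤ ENNReal.ofReal (C * B * M * (1 + ‖v‖) ^ (m - 1 - q + κ)) := by
  obtain ⟨C1, hC1, h1⟩ := exists_lintegral_planeWeight_le hd hm hq hc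
  obtain ⟨C2, hC2, h2⟩ := exists_lintegral_planeWeight_le hd hm hq
    (ε := 2 * s - κ) (by linarith)
  have : Nontrivial (Vel d) := Module.nontrivial_of_finrank_pos (R := ℝ) (by simp; omega)
  have hdq : (d : ℝ) < q := by linarith
  have hq0 : 0 < q := lt_of_le_of_lt (by positivity) hdq
  set I : ℝ := ∫ u : Vel d, (1 + ‖u‖) ^ (-q)
  have hIi : Integrable (fun u : Vel d => (1 + ‖u‖) ^ (-q)) :=
    integrable_one_add_norm (by simpa using hdq)
  have hI : 0 ≤ I := integral_nonneg fun y => by positivity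
  have hIl : ∫⁻ u : Vel d, ENNReal.ofReal ((1 + ‖u‖) ^ (-q)) = ENNReal.ofReal I :=
    (ofReal_integral_eq_lintegral_ofReal hIi (Eventually.of_forall fun y => by positivity)).symm
  set k : ℝ := 2 * s - κ + d
  have hk : 0 ≤ k := by
    have : (0 : ℝ) ≤ d := by positivity
    simp only [k]; linarith
  set D : ℝ := (r₁⁻¹ + 2) ^ k * (2 * 3 ^ q)
  have hD : 0 ≤ D := by positivity
  set F : ℝ := (1 + 2 * 2 ^ q) * (C2 * r₁ ^ (-(2 * s - κ))) + 2 * D * I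
  have hF : 0 ≤ F := by positivity
  refine ⟨2 * C1 + F, by positivity, ?_⟩
  intro v R M B E K hR hRr hM hB hK hE1 hE2 hE3
  have hvp : 0 < 1 + ‖v‖ := by positivity
  have hv1 : 1 ≤ 1 + ‖v‖ := by linarith [norm_nonneg v]
  set Y : ℝ := (1 + ‖v‖) ^ (-q)
  set H := planeWeight q m v
  have hH : ∀ a, 0 ≤ H a := planeWeight_nonneg q m v
  have hY : 0 < Y := by positivity
  have hYm : (1 + ‖v‖) ^ (m - 1) * Y ≤ (1 + ‖v‖) ^ (m - 1 - q + κ) := by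
    rw [← Real.rpow_add hvp]
    exact Real.rpow_le_rpow_of_exponent_le hv1 (by linarith)
  -- the part below the scale `R`
  have i1 : ∫⁻ a in {a : Vel d | ‖a‖ < R}, ENNReal.ofReal |E a * K a|
      ≤ ENNReal.ofReal (C1 * B * M * (1 + ‖v‖) ^ (m - 1 - q + κ)) := by
    calc _ ≤ ∫⁻ a in {a : Vel d | ‖a‖ < R}, ENNReal.ofReal (B * M * Y * R ^ (-c)) *
          ENNReal.ofReal (‖a‖ ^ (c - d) * H a) := by
          refine lintegral_mono_ae ?_
          filter_upwards [ae_restrict_mem (measurableSet_lt measurable_norm measurable_const),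
            ae_restrict_of_ae (Measure.ae_ne volume (0 : Vel d))] with a ha ha0
          have hapos : 0 < ‖a‖ := norm_pos_iff.mpr ha0
          rw [← ENNReal.ofReal_mul (by positivity)]
          refine ENNReal.ofReal_le_ofReal ?_
          rw [abs_mul]
          refine (mul_le_mul (hE1 a ha) (hK a ha0) (abs_nonneg _) (by positivity)).trans_eq ?_
          rw [Real.div_rpow hapos.le hR.le, Real.rpow_neg hR.le, div_eq_mul_inv,
            show c - (d : ℝ) = 2 * s + c + (-2 * s - d) by ring, Real.rpow_add hapos,
            Real.rpow_add hapos]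
          ring
      _ ≤ ENNReal.ofReal (B * M * Y * R ^ (-c)) *
            ENNReal.ofReal (C1 * R ^ c * (1 + ‖v‖) ^ (m - 1)) := by
          rw [lintegral_const_mul' _ _ ENNReal.ofReal_ne_top]
          gcongr
          exact (h1 v R hR).1
      _ ≤ _ := by
          rw [← ENNReal.ofReal_mul (by positivity)]
          refine ENNReal.ofReal_le_ofReal ?_
          calc _ = C1 * B * M * ((1 + ‖v‖) ^ (m - 1) * Y) := by
                rw [Real.rpow_neg hR.le]; field_simp
            _ ≤ _ := by gcongr
  -- the part between `R` and `r₁`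
  have i2 : ∫⁻ a in {a : Vel d | R ≤ ‖a‖} ∩ {a | ‖a‖ ≤ r₁}, ENNReal.ofReal |E a * K a|
      ≤ ENNReal.ofReal (C1 * B * M * (1 + ‖v‖) ^ (m - 1 - q + κ)) := by
    calc _ ≤ ∫⁻ a in {a : Vel d | R ≤ ‖a‖} ∩ {a | ‖a‖ ≤ r₁},
          ENNReal.ofReal (B * M * Y * R ^ c) * ENNReal.ofReal (‖a‖ ^ (-c - d) * H a) := by
          refine setLIntegral_mono' ((measurableSet_le measurable_const measurable_norm).inter
            (measurableSet_le measurable_norm measurable_const)) fun a ha => ?_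
          have hapos : 0 < ‖a‖ := hR.trans_le ha.1
          rw [← ENNReal.ofReal_mul (by positivity)]
          refine ENNReal.ofReal_le_ofReal ?_
          rw [abs_mul]
          refine (mul_le_mul (hE2 a ha.1 ha.2) (hK a (norm_pos_iff.mp hapos)) (abs_nonneg _)
            (by positivity)).trans_eq ?_
          rw [Real.div_rpow hR.le hapos.le, div_eq_mul_inv, ← Real.rpow_neg hapos.le,
            show -c - (d : ℝ) = 2 * s + -c + (-2 * s - d) by ring, Real.rpow_add hapos,
            Real.rpow_add hapos]
          ring
      _ ≤ ∫⁻ a in {a : Vel d | R ≤ ‖a‖},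
          ENNReal.ofReal (B * M * Y * R ^ c) * ENNReal.ofReal (‖a‖ ^ (-c - d) * H a) :=
          lintegral_mono_set inter_subset_left
      _ ≤ ENNReal.ofReal (B * M * Y * R ^ c) *
            ENNReal.ofReal (C1 * R ^ (-c) * (1 + ‖v‖) ^ (m - 1)) := by
          rw [lintegral_const_mul' _ _ ENNReal.ofReal_ne_top]
          gcongr
          exact (h1 v R hR).2
      _ ≤ _ := by
          rw [← ENNReal.ofReal_mul (by positivity)]
          refine ENNReal.ofReal_le_ofReal ?_
          calc _ = C1 * B * M * ((1 + ‖v‖) ^ (m - 1) * Y) := by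
                rw [Real.rpow_neg hR.le]; field_simp
            _ ≤ _ := by gcongr
  -- the part beyond `r₁`
  have i3 : ∫⁻ a in {a : Vel d | R ≤ ‖a‖} ∩ {a | ‖a‖ ≤ r₁}ᶜ, ENNReal.ofReal |E a * K a|
      ≤ ENNReal.ofReal (F * B * M * (1 + ‖v‖) ^ (m - 1 - q + κ)) := by
    set Z : ℝ := D * (1 + ‖v‖) ^ (m + ((d : ℝ) - 1) - q - k)
    have hZ0 : 0 ≤ Z := by positivity
    have hZ : Z ≤ D * (1 + ‖v‖) ^ (m - 1 - q + κ) := by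
      simp only [Z]
      refine mul_le_mul_of_nonneg_left (Real.rpow_le_rpow_of_exponent_le hv1 ?_) hD
      simp only [k]; linarith
    calc _ ≤ ∫⁻ a in {a : Vel d | r₁ ≤ ‖a‖},
          ENNReal.ofReal |E a * K a| := by
          refine lintegral_mono_set fun a ha => ?_
          exact (not_le.mp (show ¬ ‖a‖ ≤ r₁ from ha.2)).le
      _ ≤ ∫⁻ a in {a : Vel d | r₁ ≤ ‖a‖},
          (ENNReal.ofReal (B * M * ((1 + 2 * 2 ^ q) * Y)) *
            ENNReal.ofReal (‖a‖ ^ (-(2 * s - κ) - d) * H a)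
          + ENNReal.ofReal (B * M * Z) * (ENNReal.ofReal ((1 + ‖v + a‖) ^ (-q)) +
            ENNReal.ofReal ((1 + ‖v - a‖) ^ (-q)))) := by
          refine lintegral_mono_ae ?_
          have hnull : ∀ᵐ a : Vel d ∂(volume.restrict {a : Vel d | r₁ ≤ ‖a‖}), ‖a‖ ≠ r₁ := by
            refine ae_restrict_of_ae ?_
            have : volume (Metric.sphere (0 : Vel d) r₁) = 0 :=
              Measure.addHaar_sphere_of_ne_zero _ _ hr₁.ne'
            rw [ae_iff]
            refine measure_mono_null (fun a ha => ?_) this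
            simpa using ha
          filter_upwards [ae_restrict_mem (measurableSet_le measurable_const measurable_norm),
            hnull] with a ha ha'
          have hapos : 0 < ‖a‖ := hr₁.trans_le ha
          have hlt : r₁ < ‖a‖ := lt_of_le_of_ne ha (Ne.symm ha')
          rw [← ENNReal.ofReal_add (by positivity) (by positivity),
            ← ENNReal.ofReal_mul (by positivity), ← ENNReal.ofReal_mul (by positivity),
            ← ENNReal.ofReal_add (by have := hH a; positivity) (by positivity)]
          refine ENNReal.ofReal_le_ofReal ?_
          have t1 := far_term_le hd hm hq hk hr₁ (v := v) ha
          have t2 := far_term_le hd hm hq hk hr₁ (v := v) (a := -a) (by rwa [norm_neg])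
          rw [planeWeight_neg, norm_neg, ← sub_eq_add_neg] at t2
          rw [abs_mul]
          refine (mul_le_mul (hE3 a hlt) (hK a (norm_pos_iff.mp hapos)) (abs_nonneg _)
            (by positivity)).trans ?_
          have e : M * (‖a‖ ^ κ * (Y + (1 + ‖v + a‖) ^ (-q) + (1 + ‖v - a‖) ^ (-q))) *
              (B * (‖a‖ ^ (-2 * s - d) * H a)) = B * M * (Y * (‖a‖ ^ (-k) * H a) +
                (1 + ‖v + a‖) ^ (-q) * (‖a‖ ^ (-k) * H a) +
                (1 + ‖v - a‖) ^ (-q) * (‖a‖ ^ (-k) * H a)) := by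
            rw [show -k = κ + (-2 * s - d) by simp only [k]; ring, Real.rpow_add hapos]; ring
          rw [e, show -(2 * s - κ) - (d : ℝ) = -k by simp only [k]; ring, mul_assoc (B * M),
            mul_assoc (B * M), ← mul_add]
          refine mul_le_mul_of_nonneg_left ?_ (by positivity)
          linarith
      _ ≤ ENNReal.ofReal (B * M * ((1 + 2 * 2 ^ q) * Y)) *
            ENNReal.ofReal (C2 * r₁ ^ (-(2 * s - κ)) * (1 + ‖v‖) ^ (m - 1))
          + ENNReal.ofReal (B * M * Z) * (ENNReal.ofReal I + ENNReal.ofReal I) := by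
          rw [lintegral_add_right _ (by fun_prop), lintegral_const_mul' _ _ ENNReal.ofReal_ne_top,
            lintegral_const_mul' _ _ ENNReal.ofReal_ne_top]
          gcongr
          · exact (h2 v r₁ hr₁).2
          · refine (setLIntegral_le_lintegral _ _).trans ?_
            rw [lintegral_add_left (by fun_prop),
              lintegral_add_left_eq_self (fun u : Vel d => ENNReal.ofReal ((1 + ‖u‖) ^ (-q))) v,
              lintegral_sub_left_eq_self (fun u : Vel d => ENNReal.ofReal ((1 + ‖u‖) ^ (-q))) v, hIl]
      _ ≤ _ := by
          rw [← ENNReal.ofReal_add hI hI, ← ENNReal.ofReal_mul (by positivity),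
            ← ENNReal.ofReal_mul (by positivity),
            ← ENNReal.ofReal_add (by positivity) (by positivity)]
          refine ENNReal.ofReal_le_ofReal ?_
          calc _ = B * M * ((1 + 2 * 2 ^ q) * (C2 * r₁ ^ (-(2 * s - κ)))) *
                ((1 + ‖v‖) ^ (m - 1) * Y) + B * M * (2 * I) * Z := by ring
            _ ≤ B * M * ((1 + 2 * 2 ^ q) * (C2 * r₁ ^ (-(2 * s - κ)))) *
                (1 + ‖v‖) ^ (m - 1 - q + κ) + B * M * (2 * I) *
                (D * (1 + ‖v‖) ^ (m - 1 - q + κ)) := by gcongr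
            _ = _ := by simp only [F]; ring
  have hms : MeasurableSet {a : Vel d | ‖a‖ < R} := measurableSet_lt measurable_norm measurable_const
  have hms' : MeasurableSet {a : Vel d | ‖a‖ ≤ r₁} :=
    measurableSet_le measurable_norm measurable_const
  have hcompl : {a : Vel d | ‖a‖ < R}ᶜ = {a | R ≤ ‖a‖} := by ext a; simp
  calc _ = (∫⁻ a in {a : Vel d | ‖a‖ < R}, ENNReal.ofReal |E a * K a|)
        + ((∫⁻ a in {a : Vel d | R ≤ ‖a‖} ∩ {a | ‖a‖ ≤ r₁}, ENNReal.ofReal |E a * K a|)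
        + ∫⁻ a in {a : Vel d | R ≤ ‖a‖} ∩ {a | ‖a‖ ≤ r₁}ᶜ, ENNReal.ofReal |E a * K a|) := by
        have e := lintegral_inter_add_sdiff (μ := volume)
          (fun a : Vel d => ENNReal.ofReal |E a * K a|) {a : Vel d | R ≤ ‖a‖} hms'
        rw [Set.sdiff_eq] at e
        rw [e, ← hcompl, lintegral_add_compl _ hms]
    _ ≤ _ := add_le_add i1 (add_le_add i2 i3)
    _ = _ := by
        rw [← ENNReal.ofReal_add (by positivity) (by positivity),
          ← ENNReal.ofReal_add (by positivity) (by positivity)]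
        congr 1; ring

/-! ### The Boltzmann kernel as an operator on velocity profiles -/

/-- The kernel `K_f(v, v + a)` as a function of `a`, for the velocity profile `F(w) = f(v + w)`. -/
def planeOp {d : ℕ} (γ : ℝ) (b : ℝ → ℝ) (F : Vel d → ℝ) (a : Vel d) : ℝ :=
  (2 : ℝ) ^ (d - 1) / ‖a‖ * ∫ w : (Submodule.span ℝ {a})ᗮ,
    F w * collisionB γ b (relSpeed a (w : Vel d)) (cosDeviation a (w : Vel d))
      * relSpeed a (w : Vel d) ^ (-(d : ℝ) + 2)

theorem boltzmannKernel_eq_planeOp {d : ℕ} (γ : ℝ) (b : ℝ → ℝ) (f : Pt d → ℝ) (z : Pt d)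
    (v' : Vel d) :
    boltzmannKernel γ b f z v' = planeOp γ b (fun w => f (z.1, z.2.1, z.2.2 + w)) (v' - z.2.2) :=
  rfl

theorem cosDeviation_of_orthogonal {d : ℕ} {a w : Vel d} (h : inner ℝ a w = 0) :
    cosDeviation a w = (‖w‖ ^ 2 - ‖a‖ ^ 2) / (‖a‖ ^ 2 + ‖w‖ ^ 2) := by
  have h' : inner ℝ w a = 0 := by rw [real_inner_comm]; exact h
  have e1 : ‖w - a‖ ^ 2 = ‖a‖ ^ 2 + ‖w‖ ^ 2 := by rw [norm_sub_sq_real, h']; ring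
  have e2 : ‖w + a‖ ^ 2 = ‖a‖ ^ 2 + ‖w‖ ^ 2 := by rw [norm_add_sq_real, h']; ring
  have e3 : ‖w - a‖ = ‖w + a‖ := by
    rw [← Real.sqrt_sq (norm_nonneg (w - a)), e1, ← e2, Real.sqrt_sq (norm_nonneg _)]
  unfold cosDeviation
  rw [e3, ← sq, e2]
  congr 1
  rw [inner_add_right, inner_sub_left, inner_sub_left, h, h', real_inner_self_eq_norm_sq,
    real_inner_self_eq_norm_sq]
  ring

/-- The upper bound for `b` cancels all powers of the relative speed: with `sin(θ/2) = |a|/r` and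
`cos(θ/2) = |w|/r` the exponents of `r` add up to zero. -/
theorem scattering_nonneg_and_le {d : ℕ} {s γ lam Lam : ℝ} {b : ℝ → ℝ}
    (hb : IsNonCutoff d s γ lam Lam b) {a w : Vel d} (ha : a ≠ 0) (hw : w ≠ 0)
    (h : inner ℝ a w = 0) :
    0 ≤ collisionB γ b (relSpeed a w) (cosDeviation a w) * relSpeed a w ^ (-(d : ℝ) + 2) ∧
    collisionB γ b (relSpeed a w) (cosDeviation a w) * relSpeed a w ^ (-(d : ℝ) + 2)
      ≤ |Lam| * ‖a‖ ^ (-((d : ℝ) - 1) - 2 * s) * ‖w‖ ^ (γ + 2 * s + 1) := by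
  have ha' : 0 < ‖a‖ := norm_pos_iff.mpr ha
  have hw' : 0 < ‖w‖ := norm_pos_iff.mpr hw
  set r := relSpeed a w
  have hr2 : r ^ 2 = ‖a‖ ^ 2 + ‖w‖ ^ 2 := Real.sq_sqrt (by positivity)
  have hr : 0 < r := Real.sqrt_pos.mpr (by positivity)
  set c := cosDeviation a w
  have hc : c = (‖w‖ ^ 2 - ‖a‖ ^ 2) / r ^ 2 := by rw [hr2]; exact cosDeviation_of_orthogonal h
  have hc1 : c < 1 := by
    rw [hc, div_lt_one (by positivity), hr2]; nlinarith
  have hc2 : -1 < c := by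
    rw [hc, lt_div_iff₀ (by positivity), hr2]; nlinarith
  set θ := Real.arccos c
  have hθ : θ ∈ Ioo 0 Real.pi := by
    refine ⟨Real.arccos_pos.mpr hc1, lt_of_le_of_ne (Real.arccos_le_pi c) fun h => ?_⟩
    have := Real.arccos_eq_pi.mp h
    linarith
  have hcos : Real.cos θ = c := Real.cos_arccos hc2.le hc1.le
  have hsin2 : Real.sin (θ / 2) = ‖a‖ / r := by
    rw [Real.sin_half_eq_sqrt hθ.1.le (by linarith [hθ.2, Real.pi_pos]), hcos, hc]
    rw [← Real.sqrt_sq (show 0 ≤ ‖a‖ / r by positivity)]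
    congr 1; field_simp; rw [hr2]; ring
  have hcos2 : Real.cos (θ / 2) = ‖w‖ / r := by
    rw [Real.cos_half (by linarith [hθ.1, Real.pi_pos]) (by linarith [hθ.2]), hcos, hc]
    rw [← Real.sqrt_sq (show 0 ≤ ‖w‖ / r by positivity)]
    congr 1; field_simp; rw [hr2]; ring
  have h0 := hb.nonneg θ hθ
  have h1 := hb.upper θ hθ
  rw [hcos] at h0 h1
  rw [hsin2, hcos2] at h1
  refine ⟨by unfold collisionB; positivity, ?_⟩
  have h2 : b c ≤ |Lam| * (‖a‖ / r) ^ (-((d : ℝ) - 1) - 2 * s) * (‖w‖ / r) ^ (γ + 2 * s + 1) := by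
    refine h1.trans ?_
    gcongr
    exact le_abs_self _
  unfold collisionB
  calc r ^ γ * b c * r ^ (-(d : ℝ) + 2) ≤ r ^ γ * (|Lam| * (‖a‖ / r) ^ (-((d : ℝ) - 1) - 2 * s) *
        (‖w‖ / r) ^ (γ + 2 * s + 1)) * r ^ (-(d : ℝ) + 2) := by gcongr
    _ = |Lam| * ‖a‖ ^ (-((d : ℝ) - 1) - 2 * s) * ‖w‖ ^ (γ + 2 * s + 1) *
        (r ^ γ * r ^ (-(-((d : ℝ) - 1) - 2 * s)) * r ^ (-(γ + 2 * s + 1)) * r ^ (-(d : ℝ) + 2)) := by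
        rw [Real.div_rpow ha'.le hr.le, Real.div_rpow hw'.le hr.le, Real.rpow_neg hr.le,
          Real.rpow_neg hr.le]
        ring
    _ = _ := by
        rw [← Real.rpow_add hr, ← Real.rpow_add hr, ← Real.rpow_add hr]
        ring_nf
        rw [Real.rpow_zero, mul_one]

theorem measurable_scattering {d : ℕ} (γ : ℝ) {b : ℝ → ℝ} (hb : Measurable b) :
    Measurable (fun p : Vel d × Vel d =>
      collisionB γ b (relSpeed p.1 p.2) (cosDeviation p.1 p.2)
        * relSpeed p.1 p.2 ^ (-(d : ℝ) + 2)) := by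
  unfold collisionB relSpeed cosDeviation
  fun_prop

/-- Absolute convergence of the hyperplane integrals, and the size of the kernel for a profile that is
allowed to grow by `(1+|w|)^κ` relative to the decay `(1+|v+w|)^{-q}`. -/
theorem exists_planeOp_le {d : ℕ} (hd : 2 ≤ d) {s γ q κ : ℝ} (Lam : ℝ) (hγ : 0 ≤ γ + 2 * s)
    (hκ : 0 ≤ κ) (hq : (d : ℝ) + γ + 2 * s + κ < q) :
    ∃ C : ℝ, 0 ≤ C ∧ ∀ (lam : ℝ) (b : ℝ → ℝ), IsNonCutoff d s γ lam Lam b →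
      ∀ (F : Vel d → ℝ) (v : Vel d) (M : ℝ), Measurable F → 0 ≤ M →
      (∀ w, |F w| ≤ M * ((1 + ‖v + w‖) ^ (-q) * (1 + ‖w‖) ^ κ)) → ∀ a, a ≠ 0 →
      Integrable (fun w : (Submodule.span ℝ {a})ᗮ =>
        F w * collisionB γ b (relSpeed a (w : Vel d)) (cosDeviation a (w : Vel d))
          * relSpeed a (w : Vel d) ^ (-(d : ℝ) + 2)) ∧
      |planeOp γ b F a| ≤ C * M * (‖a‖ ^ (-2 * s - d) * planeWeight q (γ + 2 * s + 1 + κ) v a) := by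
  obtain ⟨C, hC, hI⟩ := exists_integral_plane_le hd (q := q) (m := γ + 2 * s + 1 + κ)
    (by linarith) (by linarith)
  refine ⟨2 ^ (d - 1) * (|Lam| * C), by positivity, ?_⟩
  intro lam b hb F v M hF hM hFb a ha
  have ha' : 0 < ‖a‖ := norm_pos_iff.mpr ha
  set S := (Submodule.span ℝ {a})ᗮ
  have : Nontrivial S := by
    refine Module.nontrivial_of_finrank_pos (R := ℝ) ?_
    have : Module.finrank ℝ S = d - 1 := finrank_hyperplane ha
    omega
  obtain ⟨hi, hle⟩ := hI v a ha
  set G : S → ℝ := fun w => (|Lam| * ‖a‖ ^ (-((d : ℝ) - 1) - 2 * s) * M) *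
    ((1 + ‖v + (w : Vel d)‖) ^ (-q) * (1 + ‖(w : Vel d)‖) ^ (γ + 2 * s + 1 + κ))
  have hG : Integrable G := hi.const_mul _
  -- the point `w = 0`, where `b` is not controlled, is a null set of the hyperplane
  have hbound : ∀ᵐ w : S, ‖F w * collisionB γ b (relSpeed a (w : Vel d))
      (cosDeviation a (w : Vel d)) * relSpeed a (w : Vel d) ^ (-(d : ℝ) + 2)‖ ≤ G w := by
    filter_upwards [Measure.ae_ne volume (0 : S)] with w hw
    have hw' : (w : Vel d) ≠ 0 := by simpa using hw
    have horth : inner ℝ a (w : Vel d) = 0 :=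
      Submodule.mem_orthogonal_singleton_iff_inner_right.mp w.2
    obtain ⟨k0, k1⟩ := scattering_nonneg_and_le hb ha hw' horth
    rw [mul_assoc, Real.norm_eq_abs, abs_mul, abs_of_nonneg k0]
    refine (mul_le_mul (hFb w) k1 k0 (by positivity)).trans ?_
    have e : ‖(w : Vel d)‖ ^ (γ + 2 * s + 1) ≤ (1 + ‖(w : Vel d)‖) ^ (γ + 2 * s + 1) :=
      Real.rpow_le_rpow (norm_nonneg _) (by linarith) (by linarith)
    calc _ ≤ M * ((1 + ‖v + (w : Vel d)‖) ^ (-q) * (1 + ‖(w : Vel d)‖) ^ κ) *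
          (|Lam| * ‖a‖ ^ (-((d : ℝ) - 1) - 2 * s) * (1 + ‖(w : Vel d)‖) ^ (γ + 2 * s + 1)) := by
          gcongr
      _ = G w := by
          simp only [G]
          rw [Real.rpow_add (by positivity) (γ + 2 * s + 1) κ]
          ring
  have hmeas : AEStronglyMeasurable (fun w : S => F w * collisionB γ b (relSpeed a (w : Vel d))
      (cosDeviation a (w : Vel d)) * relSpeed a (w : Vel d) ^ (-(d : ℝ) + 2)) := by
    have h1 := (measurable_scattering (d := d) γ hb.measurable).comp
      (measurable_const (a := a) |>.prodMk (measurable_subtype_coe (p := fun x => x ∈ S)))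
    have h2 : Measurable fun w : S => F w := hF.comp measurable_subtype_coe
    have h3 := h2.mul h1
    refine Measurable.aestronglyMeasurable ?_
    simp only [mul_assoc]
    exact h3
  refine ⟨hG.mono' hmeas hbound, ?_⟩
  unfold planeOp
  rw [abs_mul, abs_of_nonneg (by positivity : (0 : ℝ) ≤ 2 ^ (d - 1) / ‖a‖)]
  have h1 := norm_integral_le_of_norm_le hG hbound
  rw [Real.norm_eq_abs] at h1
  simp only [G] at h1
  rw [integral_const_mul] at h1
  have hW := planeWeight_nonneg q (γ + 2 * s + 1 + κ) v a
  calc _ ≤ 2 ^ (d - 1) / ‖a‖ * ((|Lam| * ‖a‖ ^ (-((d : ℝ) - 1) - 2 * s) * M) *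
        (C * planeWeight q (γ + 2 * s + 1 + κ) v a)) := by
        gcongr
        exact h1.trans (by gcongr)
    _ = _ := by
        rw [show -2 * s - (d : ℝ) = -((d : ℝ) - 1) - 2 * s - 1 by ring, Real.rpow_sub_one ha'.ne']
        field_simp

theorem planeOp_sub {d : ℕ} (γ : ℝ) (b : ℝ → ℝ) (F G : Vel d → ℝ) (a : Vel d)
    (hF : Integrable (fun w : (Submodule.span ℝ {a})ᗮ =>
        F w * collisionB γ b (relSpeed a (w : Vel d)) (cosDeviation a (w : Vel d))
          * relSpeed a (w : Vel d) ^ (-(d : ℝ) + 2)))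
    (hG : Integrable (fun w : (Submodule.span ℝ {a})ᗮ =>
        G w * collisionB γ b (relSpeed a (w : Vel d)) (cosDeviation a (w : Vel d))
          * relSpeed a (w : Vel d) ^ (-(d : ℝ) + 2))) :
    planeOp γ b (fun w => F w - G w) a = planeOp γ b F a - planeOp γ b G a := by
  unfold planeOp
  rw [← mul_sub, ← integral_sub hF hG]
  simp only [sub_mul]

theorem integral_submodule_map {d : ℕ} (L : Vel d ≃ₗᵢ[ℝ] Vel d) {S T : Submodule ℝ (Vel d)}
    (h : S.map (L.toLinearEquiv : Vel d →ₗ[ℝ] Vel d) = T) (G : Vel d → ℝ) :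
    ∫ w : T, G w = ∫ u : S, G (L u) := by
  subst h
  have mp := (L.submoduleMap S).measurePreserving
  exact (mp.integral_comp (L.submoduleMap S).toHomeomorph.measurableEmbedding
    (fun w => G w)).symm

theorem planeOp_neg {d : ℕ} (γ : ℝ) (b : ℝ → ℝ) (F : Vel d → ℝ) (a : Vel d) :
    planeOp γ b F (-a) = planeOp γ b F a := by
  have hc : ∀ w : Vel d, cosDeviation (-a) w = cosDeviation a w := by
    intro w
    unfold cosDeviation
    rw [sub_neg_eq_add, ← sub_eq_add_neg, real_inner_comm, mul_comm ‖w + a‖]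
  have hr : ∀ w : Vel d, relSpeed (-a) w = relSpeed a w := by
    intro w; simp [relSpeed]
  have hs : (Submodule.span ℝ {a})ᗮ.map
      ((LinearIsometryEquiv.refl ℝ (Vel d)).toLinearEquiv : Vel d →ₗ[ℝ] Vel d)
      = (Submodule.span ℝ {-a})ᗮ := by
    rw [← Set.neg_singleton, Submodule.span_neg]
    exact Submodule.map_id _
  unfold planeOp
  simp only [hc, hr, norm_neg]
  rw [integral_submodule_map _ hs (fun w => F w * collisionB γ b (relSpeed a w) (cosDeviation a w)
    * relSpeed a w ^ (-(d : ℝ) + 2))]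
  rfl

/-- The hyperplanes `a^⊥` are parametrized by a fixed one through reflections that depend measurably
on `a`. -/
theorem measurable_planeOp {d : ℕ} (hd : 2 ≤ d) (γ : ℝ) {b : ℝ → ℝ} (hb : Measurable b)
    {F : Vel d → ℝ} (hF : Measurable F) : StronglyMeasurable (planeOp γ b F) := by
  set e : Vel d := EuclideanSpace.single ⟨0, by omega⟩ 1
  have he : ‖e‖ = 1 := by simp [e]
  set T : Vel d → Vel d → Vel d := fun a u =>
    u - (2 * (inner ℝ (e - ‖a‖⁻¹ • a) u / ‖e - ‖a‖⁻¹ • a‖ ^ 2)) • (e - ‖a‖⁻¹ • a)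
  have hT : Measurable fun p : Vel d × Vel d => T p.1 p.2 := by
    simp only [T]
    fun_prop
  set S := (Submodule.span ℝ {e})ᗮ
  set k : Vel d → Vel d → ℝ := fun a w =>
    F w * collisionB γ b (relSpeed a w) (cosDeviation a w) * relSpeed a w ^ (-(d : ℝ) + 2)
  have hk : Measurable fun p : Vel d × Vel d => k p.1 p.2 := by
    have h1 := (hF.comp measurable_snd).mul (measurable_scattering (d := d) γ hb)
    simp only [k, mul_assoc]
    exact h1
  have key : planeOp γ b F = fun a => (2 : ℝ) ^ (d - 1) / ‖a‖ * ∫ u : S, k a (T a u) := by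
    funext a
    rcases eq_or_ne a 0 with rfl | ha
    · simp [planeOp]
    have ha' : 0 < ‖a‖ := norm_pos_iff.mpr ha
    set L : Vel d ≃ₗᵢ[ℝ] Vel d := (Submodule.span ℝ {e - ‖a‖⁻¹ • a})ᗮ.reflection
    have hLe : L e = ‖a‖⁻¹ • a := by
      refine Submodule.reflection_sub ?_
      rw [he, norm_smul, norm_inv, norm_norm, inv_mul_cancel₀ ha'.ne']
    have hLT : ∀ u, L u = T a u := by
      intro u
      simp only [L, T]
      rw [Submodule.reflection_orthogonal_apply, Submodule.reflection_singleton_apply, neg_sub,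
        two_smul, ← add_smul, ← two_mul]
      simp
    have hmap : S.map (L.toLinearEquiv : Vel d →ₗ[ℝ] Vel d) = (Submodule.span ℝ {a})ᗮ := by
      simp only [S]
      rw [Submodule.map_orthogonal_equiv, Submodule.map_span, image_singleton]
      congr 1
      have : (L.toLinearEquiv : Vel d →ₗ[ℝ] Vel d) e = ‖a‖⁻¹ • a := hLe
      rw [this]
      exact Submodule.span_singleton_smul_eq (IsUnit.mk0 _ (inv_ne_zero ha'.ne')) a
    unfold planeOp
    have := integral_submodule_map L hmap (k a)
    simp only [hLT] at this
    rw [← this]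
  rw [key]
  have hm : Measurable fun p : Vel d × S => k p.1 (T p.1 p.2) := by
    have h1 : Measurable fun p : Vel d × S => (p.1, (p.2 : Vel d)) :=
      measurable_fst.prodMk (measurable_subtype_coe.comp measurable_snd)
    exact hk.comp (measurable_fst.prodMk (hT.comp h1))
  have hint : StronglyMeasurable fun a : Vel d => ∫ u : S, k a (T a u) :=
    hm.stronglyMeasurable.integral_prod_right'
  refine StronglyMeasurable.mul ?_ hint
  exact Measurable.stronglyMeasurable (by fun_prop)

/-! ### The principal value as an absolutely convergent integral -/

/-- The symmetric second difference `φ(v+a) + φ(v-a) - 2φ(v)`. -/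
def secondDiff {d : ℕ} (φ : Vel d → ℝ) (v a : Vel d) : ℝ := φ (v + a) + φ (v - a) - 2 * φ v

theorem integrable_of_lintegral_ofReal_abs_le {d : ℕ} {G : Vel d → ℝ}
    (hG : AEStronglyMeasurable G) {C : ℝ}
    (h : ∫⁻ a, ENNReal.ofReal |G a| ≤ ENNReal.ofReal C) : Integrable G :=
  ⟨hG, (hasFiniteIntegral_iff_norm _).mpr (h.trans_lt ENNReal.ofReal_lt_top)⟩

theorem abs_integral_le_of_lintegral {d : ℕ} {G : Vel d → ℝ} {C : ℝ} (hC : 0 ≤ C)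
    (h : ∫⁻ a, ENNReal.ofReal |G a| ≤ ENNReal.ofReal C) : |∫ a, G a| ≤ C := by
  have h1 := norm_integral_le_lintegral_norm G (μ := (volume : Measure (Vel d)))
  exact h1.trans (ENNReal.toReal_le_of_le_ofReal hC h)

theorem truncQ₁_eq {d : ℕ} (γ : ℝ) (b : ℝ → ℝ) (f g : Pt d → ℝ) (z : Pt d) (ε : ℝ) :
    truncQ₁ γ b f g z ε = ∫ a in {a : Vel d | ε < ‖a‖}, (g (z.1, z.2.1, z.2.2 + a) - g z)
      * planeOp γ b (fun w => f (z.1, z.2.1, z.2.2 + w)) a := by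
  have m1 : MeasurableSet {v' : Vel d | ε < ‖v' - z.2.2‖} :=
    measurableSet_lt measurable_const (by fun_prop)
  have m2 : MeasurableSet {a : Vel d | ε < ‖a‖} := measurableSet_lt measurable_const (by fun_prop)
  unfold truncQ₁
  rw [← integral_indicator m1, ← integral_indicator m2, ← integral_add_left_eq_self _ z.2.2]
  congr 1; ext a
  simp [indicator, collisionIntegrand, boltzmannKernel_eq_planeOp]

theorem integrableOn_collisionIntegrand {d : ℕ} {γ : ℝ} {b : ℝ → ℝ} {f g : Pt d → ℝ} {z : Pt d}
    {ε : ℝ} (h : IntegrableOn (fun a => (g (z.1, z.2.1, z.2.2 + a) - g z)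
      * planeOp γ b (fun w => f (z.1, z.2.1, z.2.2 + w)) a) {a : Vel d | ε < ‖a‖}) :
    IntegrableOn (collisionIntegrand γ b f g z) {v' : Vel d | ε < ‖v' - z.2.2‖} := by
  have m1 : MeasurableSet {v' : Vel d | ε < ‖v' - z.2.2‖} :=
    measurableSet_lt measurable_const (by fun_prop)
  have m2 : MeasurableSet {a : Vel d | ε < ‖a‖} := measurableSet_lt measurable_const (by fun_prop)
  rw [← integrable_indicator_iff m1]
  rw [← integrable_indicator_iff m2] at h
  have h' := h.comp_sub_right z.2.2
  refine h'.congr (Eventually.of_forall fun v' => ?_)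
  simp [indicator, collisionIntegrand, boltzmannKernel_eq_planeOp]

/-- Since `K_f(v, v + a)` is even in `a`, the truncated integrals only see the second difference of
`g`, for which no principal value is needed. -/
theorem Q₁_principal_value {d : ℕ} {γ : ℝ} {b : ℝ → ℝ} {f g : Pt d → ℝ} {z : Pt d}
    (h1 : ∀ ε : ℝ, 0 < ε → IntegrableOn (fun a => (g (z.1, z.2.1, z.2.2 + a) - g z)
      * planeOp γ b (fun w => f (z.1, z.2.1, z.2.2 + w)) a) {a : Vel d | ε < ‖a‖})
    (h2 : Integrable (fun a => secondDiff (fun u => g (z.1, z.2.1, u)) z.2.2 a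
      * planeOp γ b (fun w => f (z.1, z.2.1, z.2.2 + w)) a)) :
    Tendsto (truncQ₁ γ b f g z) (𝓝[>] (0 : ℝ)) (𝓝 (Q₁ γ b f g z)) ∧
    Q₁ γ b f g z = (1 / 2) * ∫ a, secondDiff (fun u => g (z.1, z.2.1, u)) z.2.2 a
      * planeOp γ b (fun w => f (z.1, z.2.1, z.2.2 + w)) a := by
  set K := planeOp γ b (fun w => f (z.1, z.2.1, z.2.2 + w))
  set H : Vel d → ℝ := fun a => secondDiff (fun u => g (z.1, z.2.1, u)) z.2.2 a * K a
  set G : Vel d → ℝ := fun a => (g (z.1, z.2.1, z.2.2 + a) - g z) * K a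
  have m2 : ∀ ε : ℝ, MeasurableSet {a : Vel d | ε < ‖a‖} := fun ε =>
    measurableSet_lt measurable_const (by fun_prop)
  have hev : ∀ ε : ℝ, 0 < ε → truncQ₁ γ b f g z ε
      = (1 / 2) * ∫ a, {a : Vel d | ε < ‖a‖}.indicator H a := by
    intro ε hε
    rw [truncQ₁_eq, ← integral_indicator (m2 ε)]
    have hi : Integrable ({a : Vel d | ε < ‖a‖}.indicator G) :=
      (integrable_indicator_iff (m2 ε)).mpr (h1 ε hε)
    have e1 : ∫ a, {a : Vel d | ε < ‖a‖}.indicator H a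
        = ∫ a, ({a : Vel d | ε < ‖a‖}.indicator G a + {a : Vel d | ε < ‖a‖}.indicator G (-a)) := by
      congr 1; ext a
      by_cases ha : ε < ‖a‖
      · simp only [indicator, mem_ofPred_eq, ha, norm_neg, if_true, H, G, secondDiff, K,
          planeOp_neg]
        rw [← sub_eq_add_neg]
        ring
      · simp [indicator, ha]
    rw [e1, integral_add hi hi.comp_neg, integral_neg_eq_self]
    ring
  have hlim : Tendsto (fun ε : ℝ => ∫ a, {a : Vel d | ε < ‖a‖}.indicator H a) (𝓝[>] (0 : ℝ))
      (𝓝 (∫ a, H a)) := by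
    refine tendsto_integral_filter_of_dominated_convergence (fun a => ‖H a‖) ?_ ?_ h2.norm ?_
    · exact Eventually.of_forall fun ε => h2.aestronglyMeasurable.indicator (m2 ε)
    · exact Eventually.of_forall fun ε => Eventually.of_forall fun a => norm_indicator_le_norm_self _ _
    · have : ∀ᵐ a : Vel d, a = 0 ∨ a ≠ 0 := Eventually.of_forall fun a => em _
      filter_upwards [this] with a ha
      rcases ha with rfl | ha
      · have h0 : H 0 = 0 := by simp only [H, secondDiff]; simp; left; ring
        refine tendsto_const_nhds.congr fun ε => ?_
        rw [h0]
        by_cases h : ε < ‖(0 : Vel d)‖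
        · rw [indicator_of_mem (by exact h), h0]
        · rw [indicator_of_notMem (by exact h)]
      · have hp : 0 < ‖a‖ := norm_pos_iff.mpr ha
        refine tendsto_const_nhds.congr' ?_
        filter_upwards [nhdsWithin_le_nhds (Iio_mem_nhds hp)] with ε hε
        rw [indicator_of_mem (by exact hε)]
  have ht : Tendsto (truncQ₁ γ b f g z) (𝓝[>] (0 : ℝ)) (𝓝 ((1 / 2) * ∫ a, H a)) := by
    refine (hlim.const_mul (1 / 2)).congr' ?_
    filter_upwards [self_mem_nhdsWithin] with ε hε
    exact (hev ε hε).symm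
  have hq : Q₁ γ b f g z = (1 / 2) * ∫ a, H a := ht.limUnder_eq
  exact ⟨by rw [hq]; exact ht, hq⟩

/-! ### Polynomials of small kinetic degree -/

theorem exists_prod_pow_eq_mul {d n : ℕ} (k : Fin d → ℕ) (hk : ∑ i, k i = n + 1) :
    ∃ (i : Fin d) (k' : Fin d → ℕ), ∑ j, k' j = n ∧
      ∀ x : Fin d → ℝ, ∏ j, x j ^ k j = x i * ∏ j, x j ^ k' j := by
  obtain ⟨i, hi⟩ : ∃ i, k i ≠ 0 := by
    by_contra! h
    simp [h] at hk
  obtain ⟨l, hl⟩ := Nat.exists_eq_succ_of_ne_zero hi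
  have hne : ∀ j ∈ Finset.univ.erase i, Function.update k i l j = k j := fun j hj =>
    Function.update_of_ne (Finset.ne_of_mem_erase hj) _ _
  refine ⟨i, Function.update k i l, ?_, fun x => ?_⟩
  · have e1 := Finset.add_sum_erase Finset.univ k (Finset.mem_univ i)
    have e2 := Finset.add_sum_erase Finset.univ (Function.update k i l) (Finset.mem_univ i)
    have e3 : ∑ x ∈ Finset.univ.erase i, Function.update k i l x = ∑ x ∈ Finset.univ.erase i, k x :=
      Finset.sum_congr rfl hne
    rw [Function.update_self] at e2
    omega
  · rw [← Finset.mul_prod_erase _ _ (Finset.mem_univ i),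
      ← Finset.mul_prod_erase _ (fun j => x j ^ Function.update k i l j) (Finset.mem_univ i),
      Finset.prod_congr rfl (fun j hj => congrArg (x j ^ ·) (hne j hj)), Function.update_self, hl,
      pow_succ]
    ring

/-- The functions `e + c t + ℓ(v) + Q(v, v)`, with `ℓ = 0` if `β ≤ 1` and `Q = 0` if `β ≤ 2`. All
polynomials of kinetic degree `< β = 2s + α` are of this form. -/
def IsSlabQuadratic {d : ℕ} (β : ℝ) (P : Pt d → ℝ) : Prop :=
  ∃ (e c : ℝ) (ℓ : Vel d →ₗ[ℝ] ℝ) (Q : Vel d →ₗ[ℝ] Vel d →ₗ[ℝ] ℝ),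
    (β ≤ 1 → ℓ = 0) ∧ (β ≤ 2 → Q = 0) ∧ ∀ z, P z = e + c * z.1 + ℓ z.2.2 + Q z.2.2 z.2.2

theorem IsSlabQuadratic.add {d : ℕ} {β : ℝ} {P P' : Pt d → ℝ} (h : IsSlabQuadratic β P)
    (h' : IsSlabQuadratic β P') : IsSlabQuadratic β (P + P') := by
  obtain ⟨e, c, ℓ, Q, h1, h2, h3⟩ := h
  obtain ⟨e', c', ℓ', Q', h1', h2', h3'⟩ := h'
  refine ⟨e + e', c + c', ℓ + ℓ', Q + Q', fun h => by rw [h1 h, h1' h, add_zero],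
    fun h => by rw [h2 h, h2' h, add_zero], fun z => ?_⟩
  simp only [Pi.add_apply, h3, h3', LinearMap.add_apply]
  ring

theorem isSlabQuadratic_monomial {d : ℕ} {s α : ℝ} (hs0 : 0 < s) (hs1 : s < 1)
    (hα : α ≤ min 1 (2 * s)) {m : Var d →₀ ℕ} (hm : monomialDegree s m < 2 * s + α) (a : ℝ) :
    IsSlabQuadratic (2 * s + α) (fun z : Pt d => a * ∏ i, coords z i ^ m i) := by
  have hα1 : α ≤ 1 := hα.trans (min_le_left _ _)
  have hα2 : α ≤ 2 * s := hα.trans (min_le_right _ _)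
  unfold monomialDegree at hm
  set n0 : ℕ := m (Sum.inl ())
  set kx : Fin d → ℕ := fun i => m (Sum.inr (Sum.inl i))
  set kv : Fin d → ℕ := fun i => m (Sum.inr (Sum.inr i))
  have hprod : ∀ z : Pt d, ∏ i, coords z i ^ m i
      = z.1 ^ n0 * ((∏ i, z.2.1 i ^ kx i) * ∏ i, z.2.2 i ^ kv i) := by
    intro z
    rw [Fintype.prod_sum_type, Fintype.prod_sum_type]
    simp [coords, n0, kx, kv]
  have hm' : 2 * s * (n0 : ℝ) + (1 + 2 * s) * ((∑ i, kx i : ℕ) : ℝ) + ((∑ i, kv i : ℕ) : ℝ)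
      < 2 * s + α := by
    push_cast; exact hm
  set nx : ℕ := ∑ i, kx i
  set nv : ℕ := ∑ i, kv i with hnv
  have hx0 : nx = 0 := by
    by_contra h
    have h1 : (1 : ℝ) ≤ nx := by exact_mod_cast Nat.one_le_iff_ne_zero.mpr h
    have h2 : (0 : ℝ) ≤ n0 := by positivity
    have h3 : (0 : ℝ) ≤ nv := by positivity
    nlinarith [mul_nonneg hs0.le h2]
  have hkx : ∀ i, kx i = 0 := fun i =>
    Finset.sum_eq_zero_iff.mp hx0 i (Finset.mem_univ i)
  have hn0 : n0 ≤ 1 := by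
    by_contra h
    have h1 : (2 : ℝ) ≤ n0 := by exact_mod_cast (by omega : 2 ≤ n0)
    have h3 : (0 : ℝ) ≤ nv := by positivity
    rw [hx0] at hm'
    simp only [Nat.cast_zero, mul_zero, add_zero] at hm'
    nlinarith
  have hzero : ∀ k : Fin d → ℕ, ∑ i, k i = 0 → ∀ x : Fin d → ℝ, ∏ i, x i ^ k i = 1 := by
    intro k hk x
    refine Finset.prod_eq_one fun i hi => ?_
    rw [Finset.sum_eq_zero_iff.mp hk i hi, pow_zero]
  simp only [hprod, hkx, pow_zero, Finset.prod_const_one, one_mul]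
  rw [hx0] at hm'
  simp only [Nat.cast_zero, mul_zero, add_zero] at hm'
  rcases Nat.le_one_iff_eq_zero_or_eq_one.mp hn0 with h0 | h1
  · rw [h0] at hm'
    simp only [Nat.cast_zero, mul_zero, zero_add] at hm'
    simp only [h0, pow_zero, one_mul]
    have hv2 : nv < 3 := by
      have : (nv : ℝ) < 3 := by linarith
      exact_mod_cast this
    interval_cases hn : nv
    · exact ⟨a, 0, 0, 0, fun _ => rfl, fun _ => rfl, fun z => by simp [hzero kv hnv.symm]⟩
    · obtain ⟨i, k', hk', h⟩ := exists_prod_pow_eq_mul kv (n := 0) hnv.symm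
      refine ⟨0, 0, a • (EuclideanSpace.proj i : Vel d →L[ℝ] ℝ).toLinearMap, 0, fun h => ?_,
        fun _ => rfl, fun z => ?_⟩
      · norm_num at hm'; linarith
      · simp [h, hzero k' hk']
    · obtain ⟨i, k', hk', h⟩ := exists_prod_pow_eq_mul kv (n := 1) hnv.symm
      obtain ⟨j, k'', hk'', h''⟩ := exists_prod_pow_eq_mul k' (n := 0) hk'
      refine ⟨0, 0, 0, a • (LinearMap.mul ℝ ℝ).compl₁₂
        (EuclideanSpace.proj i : Vel d →L[ℝ] ℝ).toLinearMap
        (EuclideanSpace.proj j : Vel d →L[ℝ] ℝ).toLinearMap, fun _ => rfl,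
        fun h => ?_, fun z => ?_⟩
      · norm_num at hm'; linarith
      · simp [h, h'', hzero k'' hk'']
  · rw [h1] at hm'
    have hv0 : nv = 0 := by
      have : (nv : ℝ) < 1 := by push_cast at hm'; linarith
      have : nv < 1 := by exact_mod_cast this
      omega
    refine ⟨0, a, 0, 0, fun _ => rfl, fun _ => rfl, fun z => ?_⟩
    simp [h1, hzero kv hv0]

/-- Since `2s + α ≤ min (1 + 2s) (4s)`, the variables `x` and all powers of `t` beyond the first are
excluded, and a factor `t` leaves no room for a factor `v`. -/
theorem isSlabQuadratic_eval {d : ℕ} {s α : ℝ} (hs0 : 0 < s) (hs1 : s < 1)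
    (hα : α ≤ min 1 (2 * s)) {p : MvPolynomial (Var d) ℝ} (hp : KDegLT s (2 * s + α) p) :
    IsSlabQuadratic (2 * s + α) (fun z : Pt d => MvPolynomial.eval (coords z) p) := by
  have e : (fun z : Pt d => MvPolynomial.eval (coords z) p)
      = ∑ m ∈ p.support, fun z : Pt d => p.coeff m * ∏ i, coords z i ^ m i := by
    funext z
    rw [MvPolynomial.eval_eq', Finset.sum_apply]
  rw [e]
  refine Finset.sum_induction _ _ (fun _ _ => IsSlabQuadratic.add) ?_ fun m hm =>
    isSlabQuadratic_monomial hs0 hs1 hα (hp m hm) _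
  exact ⟨0, 0, 0, 0, fun _ => rfl, fun _ => rfl, fun z => by simp⟩

/-- Every variable has kinetic degree at least `min 1 (2s)`, so that only constants remain. -/
theorem exists_eval_eq_const {d : ℕ} {s α : ℝ} (hs0 : 0 < s)
    (hα : α ≤ min 1 (2 * s)) {p : MvPolynomial (Var d) ℝ} (hp : KDegLT s α p) :
    ∃ c : ℝ, ∀ z : Pt d, MvPolynomial.eval (coords z) p = c := by
  have hα1 : α ≤ 1 := hα.trans (min_le_left _ _)
  have hα2 : α ≤ 2 * s := hα.trans (min_le_right _ _)
  refine ⟨p.coeff 0, fun z => ?_⟩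
  rw [MvPolynomial.eval_eq']
  have hz : ∀ m ∈ p.support, m = 0 := by
    intro m hm
    have h := hp m hm
    unfold monomialDegree at h
    have a1 : ∀ i : Fin d, (0 : ℝ) ≤ m (Sum.inr (Sum.inl i)) := fun i => by positivity
    have a2 : ∀ i : Fin d, (0 : ℝ) ≤ m (Sum.inr (Sum.inr i)) := fun i => by positivity
    have b1 := Finset.sum_nonneg fun i (_ : i ∈ Finset.univ) => a1 i
    have b2 := Finset.sum_nonneg fun i (_ : i ∈ Finset.univ) => a2 i
    have b0 : (0 : ℝ) ≤ m (Sum.inl ()) := by positivity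
    have c0 := mul_nonneg hs0.le b0
    have c1 := mul_nonneg hs0.le b1
    ext i
    by_contra hi
    have hi1 : (1 : ℝ) ≤ m i := by exact_mod_cast Nat.one_le_iff_ne_zero.mpr hi
    rcases i with ⟨⟩ | i | i
    · nlinarith
    · have := Finset.single_le_sum (fun i _ => a1 i) (Finset.mem_univ i)
      nlinarith
    · have := Finset.single_le_sum (fun i _ => a2 i) (Finset.mem_univ i)
      nlinarith
  by_cases h0 : (0 : Var d →₀ ℕ) ∈ p.support
  · rw [Finset.sum_eq_single 0 (fun m hm h => absurd (hz m hm) h) (fun h => absurd h0 h)]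
    simp
  · rw [Finset.sum_eq_zero fun m hm => absurd (hz m hm ▸ hm) h0]
    exact (MvPolynomial.notMem_support_iff.mp h0).symm

/-! ### Kinetic distance and cylinders -/

theorem kdist_nonneg {d : ℕ} (s : ℝ) (z₁ z₂ : Pt d) : 0 ≤ kdist s z₁ z₂ :=
  Real.iInf_nonneg fun _ => le_max_of_le_right (le_max_of_le_left (norm_nonneg _))

theorem kdist_le {d : ℕ} {s ρ : ℝ} (hs : 0 < s) (hρ : 0 ≤ ρ) {z₁ z₂ : Pt d} (w : Vel d)
    (ht : |z₁.1 - z₂.1| ≤ ρ ^ (2 * s))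
    (hx : ‖z₁.2.1 - z₂.2.1 - (z₁.1 - z₂.1) • w‖ ≤ ρ ^ (1 + 2 * s))
    (h1 : ‖z₁.2.2 - w‖ ≤ ρ) (h2 : ‖z₂.2.2 - w‖ ≤ ρ) : kdist s z₁ z₂ ≤ ρ := by
  have hpow : ∀ {x e : ℝ}, 0 < e → 0 ≤ x → x ≤ ρ ^ e → x ^ (1 / e) ≤ ρ := by
    intro x e he hx hxe
    refine (Real.rpow_le_rpow hx hxe (by positivity)).trans_eq ?_
    rw [← Real.rpow_mul hρ, mul_one_div_cancel he.ne', Real.rpow_one]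
  refine (ciInf_le ⟨0, ?_⟩ w).trans ?_
  · rintro _ ⟨w, rfl⟩
    exact le_max_of_le_right (le_max_of_le_left (norm_nonneg _))
  · exact max_le (max_le (hpow (by positivity) (abs_nonneg _) ht)
      (hpow (by positivity) (norm_nonneg _) hx)) (max_le h1 h2)

theorem kdist_self {d : ℕ} {s : ℝ} (hs : 0 < s) (z : Pt d) : kdist s z z = 0 := by
  refine le_antisymm (kdist_le hs le_rfl z.2.2 ?_ ?_ ?_ ?_) (kdist_nonneg _ _ _)
  · rw [sub_self, abs_zero, Real.zero_rpow (by positivity)]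
  · simp only [sub_self, zero_smul, norm_zero]
    exact Real.rpow_nonneg le_rfl _
  · simp
  · simp

/-- `y₂` lies within kinetic distance `ρ` of `y₁`, with the shear measured along the velocity of
`y₁`; up to a factor this is the same as `kdist s y₁ y₂ ≤ ρ`. -/
structure KNear {d : ℕ} (s ρ : ℝ) (y₁ y₂ : Pt d) : Prop where
  time : |y₁.1 - y₂.1| ≤ ρ ^ (2 * s)
  pos : ‖y₁.2.1 - y₂.2.1 - (y₁.1 - y₂.1) • y₁.2.2‖ ≤ ρ ^ (1 + 2 * s)
  vel : ‖y₁.2.2 - y₂.2.2‖ ≤ ρ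

theorem KNear.kdist_le {d : ℕ} {s ρ : ℝ} (hs : 0 < s) (hρ : 0 ≤ ρ) {y₁ y₂ : Pt d}
    (h : KNear s ρ y₁ y₂) : kdist s y₂ y₁ ≤ ρ := by
  refine KineticBoltzmann.kdist_le hs hρ y₁.2.2 ?_ ?_ ?_ (by simpa using hρ)
  · rw [abs_sub_comm]; exact h.time
  · refine le_trans (le_of_eq ?_) h.pos
    rw [← norm_neg]
    congr 1
    module
  · rw [norm_sub_rev]; exact h.vel

theorem two_mul_rpow_le {x e : ℝ} (hx : 0 ≤ x) (he : 1 ≤ e) : 2 * x ^ e ≤ (2 * x) ^ e := by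
  rw [Real.mul_rpow (by norm_num) hx]
  refine mul_le_mul_of_nonneg_right ?_ (by positivity)
  simpa using Real.rpow_le_rpow_of_exponent_le (by norm_num : (1 : ℝ) ≤ 2) he

theorem KNear.of_kdist_lt {d : ℕ} {s ρ : ℝ} (hs : 0 < s) (hρ : 0 < ρ) {y₁ y₂ : Pt d}
    (h : kdist s y₁ y₂ < ρ) : KNear s (2 * ρ) y₁ y₂ := by
  obtain ⟨w, hw⟩ := exists_lt_of_ciInf_lt h
  have hpow : ∀ {x e : ℝ}, 0 < e → 0 ≤ x → x ^ (1 / e) < ρ → x ≤ ρ ^ e := by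
    intro x e he hx hxe
    have := Real.rpow_le_rpow (by positivity) hxe.le he.le
    rwa [← Real.rpow_mul hx, one_div_mul_cancel he.ne', Real.rpow_one] at this
  have ht := hpow (by positivity) (abs_nonneg _) ((le_max_left _ _).trans_lt
    ((le_max_left _ _).trans_lt hw))
  have hx := hpow (by positivity) (norm_nonneg _) ((le_max_right _ _).trans_lt
    ((le_max_left _ _).trans_lt hw))
  have h1 : ‖y₁.2.2 - w‖ < ρ := (le_max_left _ _).trans_lt ((le_max_right _ _).trans_lt hw)
  have h2 : ‖y₂.2.2 - w‖ < ρ := (le_max_right _ _).trans_lt ((le_max_right _ _).trans_lt hw)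
  refine ⟨ht.trans (Real.rpow_le_rpow hρ.le (by linarith) (by positivity)), ?_, ?_⟩
  · have e : y₁.2.1 - y₂.2.1 - (y₁.1 - y₂.1) • y₁.2.2
        = (y₁.2.1 - y₂.2.1 - (y₁.1 - y₂.1) • w) - (y₁.1 - y₂.1) • (y₁.2.2 - w) := by module
    rw [e]
    refine (norm_sub_le _ _).trans ?_
    rw [norm_smul, Real.norm_eq_abs]
    have h3 : |y₁.1 - y₂.1| * ‖y₁.2.2 - w‖ ≤ ρ ^ (2 * s) * ρ := by gcongr
    have h4 : ρ ^ (2 * s) * ρ = ρ ^ (1 + 2 * s) := by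
      rw [add_comm, Real.rpow_add_one hρ.ne']
    have h5 := two_mul_rpow_le hρ.le (by linarith : 1 ≤ 1 + 2 * s)
    linarith
  · have e : y₁.2.2 - y₂.2.2 = (y₁.2.2 - w) - (y₂.2.2 - w) := by abel
    rw [e]
    refine (norm_sub_le _ _).trans ?_
    linarith

/-- Centre of a cylinder with latest time at least `tm` that contains `y`: the transport of `y` to
the time `max tm (τ + r^{2s})`. The lower bound on the time keeps the cylinder of radius `r` inside
the slab even when `y` is close to the initial time. -/
def cylCenter {d : ℕ} (s r τ : ℝ) (y : Pt d) (tm : ℝ) : Pt d :=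
  (max tm (τ + r ^ (2 * s)), y.2.1 + (max tm (τ + r ^ (2 * s)) - y.1) • y.2.2, y.2.2)

theorem cylinder_cylCenter_subset {d : ℕ} {s r τ T tm : ℝ} (hrT : r ^ (2 * s) ≤ T - τ)
    (htm : tm ≤ T) (y : Pt d) : cylinder s r (cylCenter s r τ y tm) ⊆ slab d τ T := by
  rintro z ⟨h1, h2, -, -⟩
  simp only [cylCenter] at h1 h2
  refine ⟨?_, h2.trans (max_le htm (by linarith))⟩
  have := le_max_right tm (τ + r ^ (2 * s))
  linarith

theorem mem_cylinder_cylCenter {d : ℕ} {s r τ tm : ℝ} {y z : Pt d} (hτ : τ < z.1)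
    (h1 : tm - r ^ (2 * s) < z.1) (h2 : z.1 ≤ max tm (τ + r ^ (2 * s)))
    (hx : ‖z.2.1 - y.2.1 - (z.1 - y.1) • y.2.2‖ < r ^ (1 + 2 * s)) (hv : ‖z.2.2 - y.2.2‖ < r) :
    z ∈ cylinder s r (cylCenter s r τ y tm) := by
  refine ⟨?_, h2, ?_, hv⟩
  · simp only [cylCenter]
    rcases max_cases tm (τ + r ^ (2 * s)) with ⟨h, _⟩ | ⟨h, _⟩ <;> rw [h] <;> linarith
  · refine lt_of_le_of_lt (le_of_eq ?_) hx
    simp only [cylCenter]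
    congr 1
    module

theorem lt_time_of_mem_cylinder {d : ℕ} {s r τ T : ℝ} (hr : 0 < r) {z₀ z : Pt d}
    (hsub : cylinder s r z₀ ⊆ slab d τ T) (hz : z ∈ cylinder s r z₀) : τ < z.1 ∧ z.1 ≤ T := by
  refine ⟨?_, (hsub hz).2⟩
  obtain ⟨h1, h2, -, -⟩ := hz
  set t' := (z.1 + (z₀.1 - r ^ (2 * s))) / 2
  have hm : (t', z₀.2.1 + (t' - z₀.1) • z₀.2.2, z₀.2.2) ∈ cylinder s r z₀ := by
    refine ⟨by simp only [t']; linarith, by simp only [t']; linarith, ?_, ?_⟩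
    · simp only [add_sub_cancel_left, sub_self, norm_zero]; positivity
    · simpa using hr
  have h3 : τ ≤ t' := (hsub hm).1
  simp only [t'] at h3
  linarith

/-! ### Pointwise consequences of the weighted norms -/

theorem one_add_norm_rpow_neg_le {d : ℕ} {q : ℝ} (hq : 0 ≤ q) {u v : Vel d} (h : ‖v - u‖ ≤ 1) :
    (1 + ‖u‖) ^ (-q) ≤ 2 ^ q * (1 + ‖v‖) ^ (-q) := by
  have h1 : ‖v‖ ≤ ‖v - u‖ + ‖u‖ := by simpa using norm_add_le (v - u) u
  have h2 : (1 + ‖v‖) / 2 ≤ 1 + ‖u‖ := by linarith [norm_nonneg u]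
  refine (Real.rpow_le_rpow_of_nonpos (by positivity) h2 (by linarith)).trans_eq ?_
  rw [Real.div_rpow (by positivity) (by norm_num), div_eq_mul_inv, ← Real.rpow_neg (by norm_num),
    neg_neg, mul_comm]

theorem exists_poly_of_weightedSeminorm_lt {d : ℕ} {s β q τ T A : ℝ} {g : Pt d → ℝ}
    (h : weightedSeminorm s β q τ T g < ENNReal.ofReal A) {z : Pt d} {r : ℝ} (hr : 0 < r)
    (hr1 : r ≤ 1) (hsub : cylinder s r z ⊆ slab d τ T) :
    ∀ z₀ ∈ cylinder s r z, ∃ p : MvPolynomial (Var d) ℝ, KDegLT s β p ∧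
      ∀ y ∈ cylinder s r z, |g y - MvPolynomial.eval (coords y) p|
        ≤ A * (1 + ‖z.2.2‖) ^ (-q) * kdist s y z₀ ^ β := by
  have hY : 0 < (1 + ‖z.2.2‖) ^ q := by positivity
  have h1 : ENNReal.ofReal ((1 + ‖z.2.2‖) ^ q) * holderSeminorm s β g (cylinder s r z)
      < ENNReal.ofReal A :=
    lt_of_le_of_lt (le_iSup_of_le z (le_iSup_of_le r
      (le_iSup (fun _ : 0 < r ∧ r ≤ 1 ∧ cylinder s r z ⊆ slab d τ T =>
        ENNReal.ofReal ((1 + ‖z.2.2‖) ^ q) * holderSeminorm s β g (cylinder s r z))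
        ⟨hr, hr1, hsub⟩))) h
  have h2 : holderSeminorm s β g (cylinder s r z)
      < ENNReal.ofReal (A * (1 + ‖z.2.2‖) ^ (-q)) := by
    rw [mul_comm, ← ENNReal.lt_div_iff_mul_lt (Or.inl (ENNReal.ofReal_pos.mpr hY).ne')
      (Or.inl ENNReal.ofReal_ne_top), ← ENNReal.ofReal_div_of_pos hY] at h1
    rwa [Real.rpow_neg (by positivity), ← div_eq_mul_inv]
  unfold holderSeminorm at h2
  simp only [iInf_lt_iff] at h2
  obtain ⟨C, hC, hlt⟩ := h2
  have hCle : (C : ℝ) ≤ A * (1 + ‖z.2.2‖) ^ (-q) := by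
    have := ENNReal.toReal_le_of_le_ofReal (b := A * (1 + ‖z.2.2‖) ^ (-q)) ?_ hlt.le
    · simpa using this
    · by_contra hneg
      rw [ENNReal.ofReal_of_nonpos (not_le.mp hneg).le] at hlt
      exact absurd hlt (by simp)
  intro z₀ hz₀
  obtain ⟨p, hp, hb⟩ := hC z₀ hz₀
  exact ⟨p, hp, fun y hy => (hb y hy).trans
    (mul_le_mul_of_nonneg_right hCle (Real.rpow_nonneg (kdist_nonneg _ _ _) _))⟩

theorem monomialDegree_nonneg {d : ℕ} {s : ℝ} (hs : 0 < s) (m : Var d →₀ ℕ) :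
    0 ≤ monomialDegree s m := by
  unfold monomialDegree; positivity

/-- The seminorm of order zero is a weighted supremum: no polynomial but `0` has degree `< 0`. -/
theorem abs_le_of_weightedSeminorm_lt {d : ℕ} {s q τ T A r : ℝ} {g : Pt d → ℝ} (hs : 0 < s)
    (h : weightedSeminorm s 0 q τ T g < ENNReal.ofReal A) (hr : 0 < r) (hr1 : r ≤ 1)
    (hrT : r ^ (2 * s) ≤ T - τ) {y : Pt d} (h1 : τ < y.1) (h2 : y.1 ≤ T) :
    |g y| ≤ A * (1 + ‖y.2.2‖) ^ (-q) := by
  have hy : y ∈ cylinder s r (cylCenter s r τ y y.1) :=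
    mem_cylinder_cylCenter h1 (by linarith [show 0 < r ^ (2 * s) by positivity]) (le_max_left _ _)
      (by simp; positivity) (by simpa using hr)
  obtain ⟨p, hp, hb⟩ := exists_poly_of_weightedSeminorm_lt h hr hr1
    (cylinder_cylCenter_subset hrT h2 y) y hy
  have hp0 : p = 0 := by
    rw [← MvPolynomial.support_eq_empty, Finset.eq_empty_iff_forall_notMem]
    exact fun m hm => absurd (hp m hm) (not_lt.mpr (monomialDegree_nonneg hs m))
  simpa [hp0, cylCenter] using hb y hy

/-- Hölder continuity of order `α ≤ 1` with decay `(1+|v|)^{-q}` on the slab, for increments of the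
velocity of length at most one. -/
def KineticHolder {d : ℕ} (s α q τ T C : ℝ) (f : Pt d → ℝ) : Prop :=
  ∀ (y₁ y₂ : Pt d) (ρ : ℝ), 0 < ρ → τ < y₁.1 → y₁.1 ≤ T → τ < y₂.1 → y₂.1 ≤ T →
    KNear s ρ y₁ y₂ → ‖y₁.2.2 - y₂.2.2‖ ≤ 1 →
    |f y₁ - f y₂| ≤ C * (1 + ‖y₁.2.2‖) ^ (-q) * ρ ^ α

theorem abs_sub_le_of_le_dist {d : ℕ} {s α q τ T A r r₀ ρ : ℝ} {f : Pt d → ℝ} (hs : 0 < s)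
    (hα : 0 < α) (hq : 0 ≤ q) (hA : 0 ≤ A)
    (h : weightedSeminorm s 0 q τ T f < ENNReal.ofReal A) (hr : 0 < r) (hr1 : r ≤ 1)
    (hrT : r ^ (2 * s) ≤ T - τ) (hr₀ : 0 < r₀) (hρ : r₀ ≤ ρ) {y₁ y₂ : Pt d}
    (h1 : τ < y₁.1) (h1' : y₁.1 ≤ T) (h2 : τ < y₂.1) (h2' : y₂.1 ≤ T)
    (hv : ‖y₁.2.2 - y₂.2.2‖ ≤ 1) :
    |f y₁ - f y₂| ≤ (1 + 2 ^ q) * r₀ ^ (-α) * A * (1 + ‖y₁.2.2‖) ^ (-q) * ρ ^ α := by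
  set Y := (1 + ‖y₁.2.2‖) ^ (-q)
  have hY : 0 < Y := by positivity
  have b1 := abs_le_of_weightedSeminorm_lt hs h hr hr1 hrT h1 h1'
  have b2 := abs_le_of_weightedSeminorm_lt hs h hr hr1 hrT h2 h2'
  have b3 := one_add_norm_rpow_neg_le hq hv
  have b4 : 1 ≤ r₀ ^ (-α) * ρ ^ α := by
    rw [Real.rpow_neg hr₀.le, inv_mul_eq_div, one_le_div (by positivity)]
    exact Real.rpow_le_rpow hr₀.le hρ hα.le
  calc |f y₁ - f y₂| ≤ |f y₁| + |f y₂| := abs_sub _ _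
    _ ≤ A * Y + A * (2 ^ q * Y) := add_le_add b1 (b2.trans (mul_le_mul_of_nonneg_left b3 hA))
    _ = (1 + 2 ^ q) * A * Y * 1 := by ring
    _ ≤ (1 + 2 ^ q) * A * Y * (r₀ ^ (-α) * ρ ^ α) := by gcongr
    _ = _ := by ring

/-- For distances below `r` both points lie in one cylinder inside the slab, on which the expansion of
`f` is a constant; for larger distances the decay of `f` suffices. -/
theorem exists_holder_of_weightedNorm_lt {d : ℕ} {s α q r : ℝ} (hs : 0 < s) (hα0 : 0 < α)
    (hα : α ≤ min 1 (2 * s)) (hq : 0 ≤ q) (hr : 0 < r) (hr1 : r ≤ 1) :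
    ∃ C : ℝ, 0 ≤ C ∧ ∀ (τ T A : ℝ) (f : Pt d → ℝ), r ^ (2 * s) ≤ T - τ → 0 ≤ A →
      weightedNorm s α q τ T f < ENNReal.ofReal A →
      KineticHolder s α q τ T (C * A) f := by
  refine ⟨1 + (1 + 2 ^ q) * r ^ (-α), by positivity, ?_⟩
  intro τ T A f hrT hA hN y₁ y₂ ρ hρ h1 h1' h2 h2' hn hv
  have hsup : weightedSeminorm s 0 q τ T f < ENNReal.ofReal A := lt_of_le_of_lt le_self_add hN
  have hreg : weightedSeminorm s α q τ T f < ENNReal.ofReal A := lt_of_le_of_lt le_add_self hN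
  set Y := (1 + ‖y₁.2.2‖) ^ (-q)
  have hY : 0 < Y := by positivity
  have hρα : 0 < ρ ^ α := by positivity
  rcases lt_or_ge ρ r with hρr | hρr
  · have hpw : ∀ e : ℝ, 0 < e → ρ ^ e < r ^ e := fun e he => Real.rpow_lt_rpow hρ.le hρr he
    have ht := abs_le.mp (hn.time.trans (hpw (2 * s) (by positivity)).le)
    have ht' := abs_lt.mp (hn.time.trans_lt (hpw (2 * s) (by positivity)))
    set tm := max y₁.1 y₂.1
    have m1 : y₁ ∈ cylinder s r (cylCenter s r τ y₁ tm) :=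
      mem_cylinder_cylCenter h1 (by
        rcases max_cases y₁.1 y₂.1 with ⟨h, _⟩ | ⟨h, _⟩ <;> simp only [tm, h] <;>
          linarith [show 0 < r ^ (2 * s) by positivity])
        (le_max_of_le_left (le_max_left _ _)) (by simp; positivity) (by simpa using hr)
    have m2 : y₂ ∈ cylinder s r (cylCenter s r τ y₁ tm) := by
      refine mem_cylinder_cylCenter h2 (by
        rcases max_cases y₁.1 y₂.1 with ⟨h, _⟩ | ⟨h, _⟩ <;> simp only [tm, h] <;>
          linarith [show 0 < r ^ (2 * s) by positivity])
        (le_max_of_le_left (le_max_right _ _)) ?_ ?_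
      · refine lt_of_le_of_lt (le_of_eq ?_) (hn.pos.trans_lt (hpw _ (by positivity)))
        rw [← norm_neg]; congr 1; module
      · rw [norm_sub_rev]; exact hn.vel.trans_lt hρr
    obtain ⟨p, hp, hb⟩ := exists_poly_of_weightedSeminorm_lt hreg hr hr1
      (cylinder_cylCenter_subset hrT (max_le h1' h2') y₁) y₁ m1
    obtain ⟨c, hc⟩ := exists_eval_eq_const hs hα hp
    have b1 := hb y₁ m1
    have b2 := hb y₂ m2
    rw [hc, kdist_self hs, Real.zero_rpow hα0.ne', mul_zero] at b1
    rw [hc] at b2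
    have b3 : kdist s y₂ y₁ ^ α ≤ ρ ^ α :=
      Real.rpow_le_rpow (kdist_nonneg _ _ _) (hn.kdist_le hs hρ.le) hα0.le
    have b4 : f y₁ = c := by
      have := abs_nonpos_iff.mp b1; linarith
    rw [b4, abs_sub_comm]
    calc |f y₂ - c| ≤ A * Y * ρ ^ α := b2.trans (mul_le_mul_of_nonneg_left b3 (by positivity))
      _ ≤ _ := by
        have : 0 ≤ (1 + 2 ^ q) * r ^ (-α) * (A * Y * ρ ^ α) := by positivity
        linarith
  · refine (abs_sub_le_of_le_dist hs hα0 hq hA hsup hr hr1 hrT hr hρr h1 h1' h2 h2' hv).trans ?_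
    have : 0 ≤ A * Y * ρ ^ α := by positivity
    linarith

/-! ### Second differences of functions with Taylor expansions of order `β < 3` -/

/-- `φ` has at `v` a Taylor expansion of order `β` with linear part `ℓ`, quadratic part `Q` and
remainder at most `N |h|^β` for `|h| < r`. -/
structure HasTaylor {d : ℕ} (β r N : ℝ) (φ : Vel d → ℝ) (v : Vel d) (ℓ : Vel d →ₗ[ℝ] ℝ)
    (Q : Vel d →ₗ[ℝ] Vel d →ₗ[ℝ] ℝ) : Prop where
  linear : β ≤ 1 → ℓ = 0
  quadratic : β ≤ 2 → Q = 0
  bound : ∀ h, ‖h‖ < r → |φ (v + h) - φ v - ℓ h - Q h h| ≤ N * ‖h‖ ^ β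

/-- `φ` is bounded by `N` and has Taylor expansions of order `β` at all points of the unit ball
around `v₀`. -/
def HasTaylorNear {d : ℕ} (β r N : ℝ) (φ : Vel d → ℝ) (v₀ : Vel d) : Prop :=
  ∀ v, ‖v - v₀‖ ≤ 1 → |φ v| ≤ N ∧ ∃ ℓ Q, HasTaylor β r N φ v ℓ Q

theorem HasTaylor.secondDiff_sub_le {d : ℕ} {β r N : ℝ} {φ : Vel d → ℝ} {v : Vel d}
    {ℓ : Vel d →ₗ[ℝ] ℝ} {Q : Vel d →ₗ[ℝ] Vel d →ₗ[ℝ] ℝ} (h : HasTaylor β r N φ v ℓ Q)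
    {a : Vel d} (ha : ‖a‖ < r) : |secondDiff φ v a - 2 * Q a a| ≤ 2 * N * ‖a‖ ^ β := by
  have h1 := abs_le.mp (h.bound a ha)
  have h2 := abs_le.mp (h.bound (-a) (by rwa [norm_neg]))
  rw [norm_neg, ← sub_eq_add_neg] at h2
  simp only [map_neg, LinearMap.neg_apply, neg_neg] at h2
  unfold secondDiff
  rw [abs_le]
  constructor <;> linarith [h1.1, h1.2, h2.1, h2.2]

theorem HasTaylorNear.nonneg {d : ℕ} {β r N : ℝ} {φ : Vel d → ℝ} {v₀ : Vel d}
    (h : HasTaylorNear β r N φ v₀) : 0 ≤ N :=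
  (abs_nonneg _).trans (h v₀ (by simp)).1

theorem HasTaylorNear.abs_secondDiff_le {d : ℕ} {β r N : ℝ} {φ : Vel d → ℝ} {v₀ : Vel d}
    (h : HasTaylorNear β r N φ v₀) {v a : Vel d} (hv : ‖v - v₀‖ + ‖a‖ ≤ 1) :
    |secondDiff φ v a| ≤ 4 * N := by
  have h0 := abs_le.mp (h v (by linarith [norm_nonneg a])).1
  have h1 := abs_le.mp (h (v + a) (by
    rw [show v + a - v₀ = (v - v₀) + a by abel]; exact (norm_add_le _ _).trans hv)).1
  have h2 := abs_le.mp (h (v - a) (by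
    rw [show v - a - v₀ = (v - v₀) - a by abel]; exact (norm_sub_le _ _).trans hv)).1
  unfold secondDiff
  rw [abs_le]
  constructor <;> linarith [h0.1, h0.2, h1.1, h1.2, h2.1, h2.2]

/-- A bound for a quadratic form on one sphere propagates by homogeneity. -/
theorem quadratic_le_of_sphere {d : ℕ} (Q : Vel d →ₗ[ℝ] Vel d →ₗ[ℝ] ℝ) {ρ B : ℝ} (hρ : 0 < ρ)
    (hB : ∀ a, ‖a‖ = ρ → |Q a a| ≤ B) (a : Vel d) : |Q a a| ≤ B * (‖a‖ / ρ) ^ 2 := by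
  rcases eq_or_ne a 0 with rfl | ha
  · simp
  have ha' : 0 < ‖a‖ := norm_pos_iff.mpr ha
  have h := hB ((ρ / ‖a‖) • a) (by
    rw [norm_smul, Real.norm_of_nonneg (by positivity)]; field_simp)
  simp only [map_smul, LinearMap.smul_apply, smul_eq_mul] at h
  rw [← mul_assoc, abs_mul, abs_of_nonneg (by positivity)] at h
  have e : |Q a a| = (ρ / ‖a‖ * (ρ / ‖a‖) * |Q a a|) * (‖a‖ / ρ) ^ 2 := by field_simp
  rw [e]
  gcongr

/-- The quadratic part is recovered from second differences on the sphere of radius `r / 2`. -/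
theorem HasTaylorNear.abs_quadratic_le {d : ℕ} {β r N : ℝ} {φ : Vel d → ℝ} {v₀ : Vel d}
    (h : HasTaylorNear β r N φ v₀) (hβ : 0 ≤ β) (hr : 0 < r) (hr1 : r ≤ 1) {v : Vel d}
    (hv : ‖v - v₀‖ ≤ 1 / 2) {ℓ : Vel d →ₗ[ℝ] ℝ} {Q : Vel d →ₗ[ℝ] Vel d →ₗ[ℝ] ℝ}
    (hT : HasTaylor β r N φ v ℓ Q) (a : Vel d) : |Q a a| ≤ 12 * N / r ^ 2 * ‖a‖ ^ 2 := by
  have hN := h.nonneg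
  have key := quadratic_le_of_sphere Q (ρ := r / 2) (B := 3 * N) (by positivity) (fun a ha => ?_) a
  · refine key.trans_eq ?_
    field_simp
    ring
  · have h1 := abs_le.mp (hT.secondDiff_sub_le (a := a) (by rw [ha]; linarith))
    have h2 := abs_le.mp (h.abs_secondDiff_le (v := v) (a := a) (by rw [ha]; linarith))
    have h3 : ‖a‖ ^ β ≤ 1 := Real.rpow_le_one (norm_nonneg _) (by rw [ha]; linarith) hβ
    have h4 : 2 * N * ‖a‖ ^ β ≤ 2 * N := by nlinarith
    rw [abs_le]
    constructor <;> linarith [h1.1, h1.2, h2.1, h2.2]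

/-- For `β > 2` the second difference is only of order `|a|²`; the exponent `2s + c` below is at most
`min β 2`. -/
theorem HasTaylorNear.secondDiff_le_rpow {d : ℕ} {β r N e : ℝ} {φ : Vel d → ℝ} {v₀ : Vel d}
    (h : HasTaylorNear β r N φ v₀) (hβ : 0 ≤ β) (hr : 0 < r) (hr1 : r ≤ 1) (heβ : e ≤ β)
    (he2 : e ≤ 2) (he : 0 ≤ e) {a : Vel d} (ha : ‖a‖ < r) :
    |secondDiff φ v₀ a| ≤ (24 / r ^ 2 + 2) * N * ‖a‖ ^ e := by
  have hN := h.nonneg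
  obtain ⟨ℓ, Q, hT⟩ := (h v₀ (by simp)).2
  have h1 := hT.secondDiff_sub_le ha
  have h2 := h.abs_quadratic_le hβ hr hr1 (by simp) hT a
  have ha1 : ‖a‖ ≤ 1 := by linarith
  have h3 : ‖a‖ ^ β ≤ ‖a‖ ^ e := by
    rcases eq_or_lt_of_le (norm_nonneg a) with h0 | h0
    · rw [← h0]
      rcases eq_or_lt_of_le he with he0 | he0
      · rw [← he0, Real.rpow_zero]; exact Real.rpow_le_one le_rfl zero_le_one hβ
      · rw [Real.zero_rpow he0.ne', Real.zero_rpow (by linarith)]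
    · exact Real.rpow_le_rpow_of_exponent_ge h0 ha1 heβ
  have h4 : ‖a‖ ^ 2 ≤ ‖a‖ ^ e := by
    rw [← Real.rpow_two]
    rcases eq_or_lt_of_le (norm_nonneg a) with h0 | h0
    · rw [← h0, Real.zero_rpow (by norm_num)]; positivity
    · exact Real.rpow_le_rpow_of_exponent_ge h0 ha1 he2
  calc |secondDiff φ v₀ a| = |(secondDiff φ v₀ a - 2 * Q a a) + 2 * Q a a| := by ring_nf
    _ ≤ |secondDiff φ v₀ a - 2 * Q a a| + |2 * Q a a| := abs_add_le _ _
    _ ≤ 2 * N * ‖a‖ ^ β + 2 * (12 * N / r ^ 2 * ‖a‖ ^ 2) := by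
        rw [abs_mul 2, abs_of_pos (by norm_num : (0 : ℝ) < 2)]
        gcongr
    _ ≤ 2 * N * ‖a‖ ^ e + 2 * (12 * N / r ^ 2 * ‖a‖ ^ e) := by gcongr
    _ = _ := by ring

/-- The linear part is recovered from values of `φ` at distance `r / 2`. -/
theorem HasTaylorNear.sub_le_rpow {d : ℕ} {α β r N : ℝ} {φ : Vel d → ℝ} {v₀ : Vel d}
    (h : HasTaylorNear β r N φ v₀) (hα : 0 < α) (hα1 : α ≤ 1) (hαβ : α ≤ β) (hr : 0 < r)
    (hr1 : r ≤ 1) {a : Vel d} (ha : ‖a‖ ≤ r / 2) :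
    |φ (v₀ + a) - φ v₀| ≤ (12 / r ^ 2 + 4 / r + 1) * N * ‖a‖ ^ α := by
  have hN := h.nonneg
  have hβ : 0 ≤ β := by linarith
  rcases eq_or_ne a 0 with rfl | ha0
  · simp [Real.zero_rpow hα.ne']
  have hapos : 0 < ‖a‖ := norm_pos_iff.mpr ha0
  have ha1 : ‖a‖ ≤ 1 := by linarith
  obtain ⟨ℓ, Q, hT⟩ := (h v₀ (by simp)).2
  have h1 := hT.bound a (by linarith)
  have h2 := h.abs_quadratic_le hβ hr hr1 (by simp) hT a
  have h3 : |ℓ a| ≤ 4 / r * N * ‖a‖ := by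
    have hn : ‖((r / 2) / ‖a‖) • a‖ = r / 2 := by
      rw [norm_smul, Real.norm_of_nonneg (by positivity)]; field_simp
    set e := ((r / 2) / ‖a‖) • a
    have b1 := abs_le.mp (hT.bound e (by linarith))
    have b2 := abs_le.mp (hT.bound (-e) (by rw [norm_neg]; linarith))
    have b3 := abs_le.mp (h (v₀ + e) (by rw [add_sub_cancel_left]; linarith)).1
    have b4 := abs_le.mp (h (v₀ + -e) (by rw [add_sub_cancel_left, norm_neg]; linarith)).1
    simp only [map_neg, LinearMap.neg_apply, neg_neg, norm_neg] at b2
    have b5 : N * ‖e‖ ^ β ≤ N := by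
      have := Real.rpow_le_one (norm_nonneg e) (by linarith) hβ
      nlinarith
    have b6 : |ℓ e| ≤ 2 * N := by
      rw [abs_le]
      constructor <;> linarith [b1.1, b1.2, b2.1, b2.2, b3.1, b3.2, b4.1, b4.2]
    have b7 : ℓ e = (r / 2) / ‖a‖ * ℓ a := by simp [e]
    rw [b7, abs_mul, abs_of_pos (by positivity)] at b6
    rw [div_mul_eq_mul_div, div_le_iff₀ hapos] at b6
    rw [div_mul_eq_mul_div, div_mul_eq_mul_div, le_div_iff₀ hr]
    linarith
  have p1 : ‖a‖ ^ β ≤ ‖a‖ ^ α := Real.rpow_le_rpow_of_exponent_ge hapos ha1 hαβ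
  have p2 : ‖a‖ ^ 2 ≤ ‖a‖ ^ α := by
    rw [← Real.rpow_two]; exact Real.rpow_le_rpow_of_exponent_ge hapos ha1 (by linarith)
  have p3 : ‖a‖ ≤ ‖a‖ ^ α := by
    simpa using Real.rpow_le_rpow_of_exponent_ge hapos ha1 hα1
  calc |φ (v₀ + a) - φ v₀| = |(φ (v₀ + a) - φ v₀ - ℓ a - Q a a) + ℓ a + Q a a| := by ring_nf
    _ ≤ |φ (v₀ + a) - φ v₀ - ℓ a - Q a a| + |ℓ a| + |Q a a| := abs_add_three _ _ _
    _ ≤ N * ‖a‖ ^ β + 4 / r * N * ‖a‖ + 12 * N / r ^ 2 * ‖a‖ ^ 2 := by gcongr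
    _ ≤ N * ‖a‖ ^ α + 4 / r * N * ‖a‖ ^ α + 12 * N / r ^ 2 * ‖a‖ ^ α := by gcongr
    _ = _ := by ring

/-- A Taylor expansion of order `β > 1` makes its linear part a derivative. -/
theorem HasTaylor.hasFDerivAt {d : ℕ} {β r N : ℝ} {φ : Vel d → ℝ} {v : Vel d}
    {ℓ : Vel d →ₗ[ℝ] ℝ} {Q : Vel d →ₗ[ℝ] Vel d →ₗ[ℝ] ℝ} (h : HasTaylor β r N φ v ℓ Q)
    (hβ : 1 < β) (hr : 0 < r) {q : ℝ} (hQ : ∀ a, |Q a a| ≤ q * ‖a‖ ^ 2) :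
    HasFDerivAt φ (LinearMap.toContinuousLinearMap ℓ) v := by
  rw [hasFDerivAt_iff_isLittleO_nhds_zero]
  have h1 : (fun a : Vel d => φ (v + a) - φ v - ℓ a - Q a a) =O[𝓝 0] fun a => ‖a‖ ^ β := by
    refine Asymptotics.IsBigO.of_bound N ?_
    filter_upwards [Metric.ball_mem_nhds (0 : Vel d) hr] with a ha
    rw [Real.norm_eq_abs, Real.norm_of_nonneg (by positivity)]
    exact h.bound a (by simpa using ha)
  have h2 : (fun a : Vel d => ‖a‖ ^ β) =o[𝓝 0] fun a => a := by
    refine Asymptotics.IsLittleO.of_norm_right ?_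
    have h3 : (fun a : Vel d => ‖a‖ ^ (β - 1) * ‖a‖) =o[𝓝 0] fun a => 1 * ‖a‖ := by
      refine Asymptotics.IsLittleO.mul_isBigO ?_ (Asymptotics.isBigO_refl _ _)
      rw [Asymptotics.isLittleO_one_iff]
      have : Continuous fun a : Vel d => ‖a‖ ^ (β - 1) :=
        continuous_norm.rpow_const fun _ => Or.inr (by linarith)
      simpa [Real.zero_rpow (by linarith : β - 1 ≠ 0)] using this.tendsto 0
    refine (h3.congr (fun a => ?_) (fun a => one_mul _))
    rcases eq_or_lt_of_le (norm_nonneg a) with h0 | h0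
    · rw [← h0, mul_zero, Real.zero_rpow (by linarith)]
    · rw [← Real.rpow_add_one h0.ne', sub_add_cancel]
  have h4 : (fun a : Vel d => Q a a) =o[𝓝 0] fun a => a := by
    have h5 : (fun a : Vel d => Q a a) =O[𝓝 0] fun a => ‖a‖ ^ 2 := by
      refine Asymptotics.IsBigO.of_bound q (Eventually.of_forall fun a => ?_)
      rw [Real.norm_eq_abs, Real.norm_of_nonneg (by positivity)]
      exact hQ a
    exact h5.trans_isLittleO (Asymptotics.isLittleO_norm_pow_id one_lt_two)
  have h6 := (h1.trans_isLittleO h2).add h4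
  refine h6.congr_left fun a => ?_
  simp

/-- The gradient satisfies a second-difference bound of order `β - 1`; both sides are tested on
vectors of length `|a|`, for which the expansions at `v`, `v + a` and `v - a` can be compared. -/
theorem HasTaylorNear.gradient_secondDiff_le {d : ℕ} {β r N : ℝ} {φ : Vel d → ℝ} {v₀ : Vel d}
    (h : HasTaylorNear β r N φ v₀) (hβ0 : 0 ≤ β) (hβ3 : β ≤ 3) {v a : Vel d}
    (har : ‖a‖ < r / 2)
    {ℓ ℓp ℓm : Vel d →ₗ[ℝ] ℝ} {Q Qp Qm : Vel d →ₗ[ℝ] Vel d →ₗ[ℝ] ℝ}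
    (hT : HasTaylor β r N φ v ℓ Q) (hTp : HasTaylor β r N φ (v + a) ℓp Qp)
    (hTm : HasTaylor β r N φ (v - a) ℓm Qm) {e : Vel d} (he : ‖e‖ = ‖a‖) :
    |ℓp e + ℓm e - 2 * ℓ e| ≤ 18 * N * ‖a‖ ^ β := by
  have hN := h.nonneg
  have hsum : ∀ x y : Vel d, ‖x‖ = ‖a‖ → ‖y‖ = ‖a‖ → ‖x + y‖ < r ∧
      N * ‖x + y‖ ^ β ≤ 8 * (N * ‖a‖ ^ β) := by
    intro x y hx hy
    have h1 : ‖x + y‖ ≤ 2 * ‖a‖ := by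
      refine (norm_add_le _ _).trans ?_
      rw [hx, hy]; linarith
    refine ⟨by linarith, ?_⟩
    have h2 : ‖x + y‖ ^ β ≤ 8 * ‖a‖ ^ β := by
      refine (Real.rpow_le_rpow (norm_nonneg _) h1 hβ0).trans ?_
      rw [Real.mul_rpow (by norm_num) (norm_nonneg _)]
      refine mul_le_mul_of_nonneg_right ?_ (by positivity)
      calc (2 : ℝ) ^ β ≤ 2 ^ (3 : ℝ) := Real.rpow_le_rpow_of_exponent_le (by norm_num) hβ3
        _ = 8 := by norm_num
    nlinarith
  have hee : ‖-e‖ = ‖a‖ := by rw [norm_neg, he]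
  have haa : ‖-a‖ = ‖a‖ := norm_neg a
  obtain ⟨r1, q1⟩ := hsum a e rfl he
  obtain ⟨r2, q2⟩ := hsum a (-e) rfl hee
  obtain ⟨r3, q3⟩ := hsum (-a) e haa he
  obtain ⟨r4, q4⟩ := hsum (-a) (-e) haa hee
  have b1 := abs_le.mp ((hT.bound _ r1).trans q1)
  have b2 := abs_le.mp ((hT.bound _ r2).trans q2)
  have b3 := abs_le.mp ((hT.bound _ r3).trans q3)
  have b4 := abs_le.mp ((hT.bound _ r4).trans q4)
  have hr0 : ‖a‖ < r := by linarith [norm_nonneg a]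
  have c1 := abs_le.mp (hTp.bound e (by rw [he]; exact hr0))
  have c2 := abs_le.mp (hTp.bound (-e) (by rw [hee]; exact hr0))
  have c3 := abs_le.mp (hTm.bound e (by rw [he]; exact hr0))
  have c4 := abs_le.mp (hTm.bound (-e) (by rw [hee]; exact hr0))
  rw [he] at c1 c3
  rw [hee] at c2 c4
  have n1 : v + (a + e) = v + a + e := by abel
  have n2 : v + (a + -e) = v + a + -e := by abel
  have n3 : v + (-a + e) = v - a + e := by abel
  have n4 : v + (-a + -e) = v - a + -e := by abel
  rw [n1] at b1
  rw [n2] at b2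
  rw [n3] at b3
  rw [n4] at b4
  simp only [map_add, map_neg, LinearMap.add_apply, LinearMap.neg_apply, neg_neg] at b1 b2 b3 b4 c1 c2 c3 c4
  rw [abs_le]
  constructor <;>
    linarith [b1.1, b1.2, b2.1, b2.2, b3.1, b3.2, b4.1, b4.2, c1.1, c1.2, c2.1, c2.2, c3.1, c3.2,
      c4.1, c4.2]

/-- Second differences at two base points for `β ≤ 1`, where `φ` itself is Hölder continuous. -/
theorem HasTaylorNear.secondDiff_sub_le_of_le_one {d : ℕ} {β r N : ℝ} {φ : Vel d → ℝ} {v₀ : Vel d}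
    (h : HasTaylorNear β r N φ v₀) (hβ1 : β ≤ 1) {v a : Vel d}
    (hv : ‖v - v₀‖ < r) (ha : ‖a‖ ≤ 1) :
    |secondDiff φ v₀ a - secondDiff φ v a| ≤ 4 * N * ‖v - v₀‖ ^ β := by
  have key : ∀ u : Vel d, ‖u‖ ≤ 1 → |φ (v + u) - φ (v₀ + u)| ≤ N * ‖v - v₀‖ ^ β := by
    intro u hu
    obtain ⟨ℓ, Q, hT⟩ := (h (v₀ + u) (by rwa [add_sub_cancel_left])).2
    have := hT.bound (v - v₀) hv
    rw [hT.linear hβ1, hT.quadratic (by linarith)] at this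
    simp only [LinearMap.zero_apply, sub_zero] at this
    rwa [show v₀ + u + (v - v₀) = v + u by abel] at this
  have k0 := abs_le.mp (key 0 (by simp))
  have k1 := abs_le.mp (key a ha)
  have k2 := abs_le.mp (key (-a) (by rwa [norm_neg]))
  rw [add_zero, add_zero] at k0
  rw [← sub_eq_add_neg, ← sub_eq_add_neg] at k2
  unfold secondDiff
  rw [abs_le]
  constructor <;> linarith [k0.1, k0.2, k1.1, k1.2, k2.1, k2.2]

/-- For `β > 1` the mean value inequality is applied to the second difference as a function of the base
point; its derivative is the second difference of the gradient. -/
theorem HasTaylorNear.secondDiff_sub_le_of_one_lt {d : ℕ} {β r N : ℝ} {φ : Vel d → ℝ} {v₀ : Vel d}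
    (h : HasTaylorNear β r N φ v₀) (hβ1 : 1 < β) (hβ3 : β ≤ 3) (hr : 0 < r) (hr1 : r ≤ 1)
    {v a : Vel d} (hv : ‖v - v₀‖ ≤ 1 / 8) (ha : ‖a‖ < r / 4) :
    |secondDiff φ v₀ a - secondDiff φ v a| ≤ 18 * N * ‖a‖ ^ (β - 1) * ‖v - v₀‖ := by
  have hN := h.nonneg
  rcases eq_or_ne a 0 with rfl | ha0
  · have e : ∀ u, secondDiff φ u 0 = 0 := fun u => by simp [secondDiff]; ring
    rw [e, e, sub_self, abs_zero]
    positivity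
  have hapos : 0 < ‖a‖ := norm_pos_iff.mpr ha0
  have hD : ∀ u : Vel d, ∃ ℓ Q, ‖u - v₀‖ ≤ 1 / 2 → HasTaylor β r N φ u ℓ Q ∧
      HasFDerivAt φ (LinearMap.toContinuousLinearMap ℓ) u := by
    intro u
    by_cases hu : ‖u - v₀‖ ≤ 1 / 2
    · obtain ⟨ℓ, Q, hT⟩ := (h u (by linarith)).2
      exact ⟨ℓ, Q, fun _ => ⟨hT, hT.hasFDerivAt hβ1 hr
        (h.abs_quadratic_le (by linarith) hr hr1 hu hT)⟩⟩
    · exact ⟨0, 0, fun hu' => absurd hu' hu⟩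
  choose ℓ Q hℓ using hD
  have hball : ∀ u ∈ Metric.closedBall v₀ (1 / 8), ‖u - v₀‖ ≤ 1 / 2 ∧ ‖u + a - v₀‖ ≤ 1 / 2 ∧
      ‖u - a - v₀‖ ≤ 1 / 2 := by
    intro u hu
    rw [mem_closedBall_iff_norm] at hu
    refine ⟨by linarith, ?_, ?_⟩
    · rw [show u + a - v₀ = (u - v₀) + a by abel]
      exact (norm_add_le _ _).trans (by linarith)
    · rw [show u - a - v₀ = (u - v₀) - a by abel]
      exact (norm_sub_le _ _).trans (by linarith)
  have hder : ∀ u ∈ Metric.closedBall v₀ (1 / 8), HasFDerivWithinAt (fun u => secondDiff φ u a)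
      (LinearMap.toContinuousLinearMap (ℓ (u + a)) + LinearMap.toContinuousLinearMap (ℓ (u - a))
        - (2 : ℝ) • LinearMap.toContinuousLinearMap (ℓ u)) (Metric.closedBall v₀ (1 / 8)) u := by
    intro u hu
    obtain ⟨b0, b1, b2⟩ := hball u hu
    have d0 := (hℓ u b0).2
    have d1 := (hasFDerivAt_comp_add_right a).mpr (hℓ (u + a) b1).2
    have d2 : HasFDerivAt (fun u => φ (u - a)) (LinearMap.toContinuousLinearMap (ℓ (u - a))) u := by
      have := (hasFDerivAt_comp_add_right (f := φ) (x := u) (-a)).mpr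
        (by rw [← sub_eq_add_neg]; exact (hℓ (u - a) b2).2)
      simpa only [← sub_eq_add_neg] using this
    exact ((d1.add d2).sub (d0.const_mul 2)).hasFDerivWithinAt
  have hnorm : ∀ u ∈ Metric.closedBall v₀ (1 / 8),
      ‖LinearMap.toContinuousLinearMap (ℓ (u + a)) + LinearMap.toContinuousLinearMap (ℓ (u - a))
        - (2 : ℝ) • LinearMap.toContinuousLinearMap (ℓ u)‖ ≤ 18 * N * ‖a‖ ^ (β - 1) := by
    intro u hu
    obtain ⟨b0, b1, b2⟩ := hball u hu
    refine ContinuousLinearMap.opNorm_le_bound _ (by positivity) fun x => ?_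
    rcases eq_or_ne x 0 with rfl | hx
    · simp
    have hx' : 0 < ‖x‖ := norm_pos_iff.mpr hx
    have hn : ‖(‖a‖ / ‖x‖) • x‖ = ‖a‖ := by
      rw [norm_smul, Real.norm_of_nonneg (by positivity)]; field_simp
    have key := h.gradient_secondDiff_le (by linarith) hβ3 (by linarith) (hℓ u b0).1
      (hℓ (u + a) b1).1 (hℓ (u - a) b2).1 hn
    simp only [map_smul, smul_eq_mul] at key
    rw [show ‖a‖ / ‖x‖ * ℓ (u + a) x + ‖a‖ / ‖x‖ * ℓ (u - a) x - 2 * (‖a‖ / ‖x‖ * ℓ u x)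
      = ‖a‖ / ‖x‖ * (ℓ (u + a) x + ℓ (u - a) x - 2 * ℓ u x) by ring, abs_mul,
      abs_of_pos (by positivity), div_mul_eq_mul_div, div_le_iff₀ hx'] at key
    have e : ‖a‖ ^ β = ‖a‖ ^ (β - 1) * ‖a‖ := by
      rw [← Real.rpow_add_one hapos.ne', sub_add_cancel]
    rw [e] at key
    have key' : ‖a‖ * |ℓ (u + a) x + ℓ (u - a) x - 2 * ℓ u x|
        ≤ ‖a‖ * (18 * N * ‖a‖ ^ (β - 1) * ‖x‖) := by linarith
    simpa [Real.norm_eq_abs] using le_of_mul_le_mul_left key' hapos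
  have := (convex_closedBall v₀ (1 / 8)).norm_image_sub_le_of_norm_hasFDerivWithin_le hder hnorm
    (x := v) (y := v₀) (by rwa [mem_closedBall_iff_norm]) (Metric.mem_closedBall_self (by norm_num))
  rw [norm_sub_rev v₀ v] at this
  exact this

/-! ### Local regularity of functions of order `2s + α` -/

/-- The expansion of `g` at `y`, valid in a cylinder inside the slab that contains `y`. -/
theorem exists_slabQuadratic {d : ℕ} {s α q τ T A r : ℝ} {g : Pt d → ℝ} (hs0 : 0 < s) (hs1 : s < 1)
    (hα0 : 0 < α) (hα : α ≤ min 1 (2 * s))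
    (h : weightedSeminorm s (2 * s + α) q τ T g < ENNReal.ofReal A) (hr : 0 < r) (hr1 : r ≤ 1)
    (hrT : r ^ (2 * s) ≤ T - τ) {y : Pt d} {tm : ℝ} (h1 : τ < y.1) (h2 : y.1 ≤ tm) (h3 : tm ≤ T)
    (h4 : tm - r ^ (2 * s) < y.1) :
    ∃ P : Pt d → ℝ, IsSlabQuadratic (2 * s + α) P ∧ P y = g y ∧
      ∀ z ∈ cylinder s r (cylCenter s r τ y tm),
        |g z - P z| ≤ A * (1 + ‖y.2.2‖) ^ (-q) * kdist s z y ^ (2 * s + α) := by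
  have hy : y ∈ cylinder s r (cylCenter s r τ y tm) :=
    mem_cylinder_cylCenter h1 h4 (le_max_of_le_left h2) (by simp; positivity) (by simpa using hr)
  obtain ⟨p, hp, hb⟩ := exists_poly_of_weightedSeminorm_lt h hr hr1
    (cylinder_cylCenter_subset hrT h3 y) y hy
  refine ⟨_, isSlabQuadratic_eval hs0 hs1 hα hp, ?_, hb⟩
  have := hb y hy
  rw [kdist_self hs0, Real.zero_rpow (by positivity), mul_zero] at this
  have := abs_nonpos_iff.mp this
  linarith

/-- Two points with the same velocity: the expansion only contributes its time coefficient, which is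
bounded by comparing values at times a fixed distance apart. -/
theorem abs_sub_le_of_same_velocity {d : ℕ} {s α q τ T A r ρ : ℝ} {g : Pt d → ℝ} (hs0 : 0 < s)
    (hs1 : s < 1) (hα0 : 0 < α) (hα : α ≤ min 1 (2 * s)) (hA : 0 ≤ A)
    (h : weightedNorm s (2 * s + α) q τ T g < ENNReal.ofReal A) (hr : 0 < r) (hr1 : r ≤ 1)
    (hrT : r ^ (2 * s) ≤ T - τ) (hρ0 : 0 < ρ) (hρ : ρ < r) {y₁ y₂ : Pt d} (h1 : τ < y₁.1)
    (h1' : y₁.1 ≤ T) (h2 : τ < y₂.1) (h2' : y₂.1 ≤ T) (hn : KNear s ρ y₁ y₂)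
    (hv : y₁.2.2 = y₂.2.2) :
    |g y₁ - g y₂| ≤ A * (1 + ‖y₁.2.2‖) ^ (-q) *
      (12 / r ^ (2 * s) * |y₁.1 - y₂.1| + ρ ^ (2 * s + α)) := by
  have hsup : weightedSeminorm s 0 q τ T g < ENNReal.ofReal A := lt_of_le_of_lt le_self_add h
  have hreg : weightedSeminorm s (2 * s + α) q τ T g < ENNReal.ofReal A :=
    lt_of_le_of_lt le_add_self h
  set Y := (1 + ‖y₁.2.2‖) ^ (-q)
  have hY : 0 < Y := by positivity
  set β := 2 * s + α
  have hβ : 0 < β := by positivity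
  set D := r ^ (2 * s)
  have hD : 0 < D := by positivity
  have hpw : ∀ e : ℝ, 0 < e → ρ ^ e < r ^ e := fun e he => Real.rpow_lt_rpow hρ0.le hρ he
  have ht := abs_lt.mp (hn.time.trans_lt (hpw (2 * s) (by positivity)))
  set tm := max y₁.1 y₂.1
  have hm1 : tm - D < y₁.1 := by
    rcases max_cases y₁.1 y₂.1 with ⟨h, _⟩ | ⟨h, _⟩ <;> simp only [tm, h] <;> linarith
  have hm2 : tm - D < y₂.1 := by
    rcases max_cases y₁.1 y₂.1 with ⟨h, _⟩ | ⟨h, _⟩ <;> simp only [tm, h] <;> linarith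
  have hmT : tm ≤ T := max_le h1' h2'
  obtain ⟨P, ⟨e, c, ℓ, Q, -, -, hP⟩, hPy, hb⟩ := exists_slabQuadratic hs0 hs1 hα0 hα hreg hr hr1 hrT
    h1 (le_max_left y₁.1 y₂.1) hmT hm1
  have m2 : y₂ ∈ cylinder s r (cylCenter s r τ y₁ tm) := by
    refine mem_cylinder_cylCenter h2 hm2 (le_max_of_le_left (le_max_right _ _)) ?_ ?_
    · refine lt_of_le_of_lt (le_of_eq ?_) (hn.pos.trans_lt (hpw _ (by positivity)))
      rw [← norm_neg]; congr 1; module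
    · rw [norm_sub_rev]; exact hn.vel.trans_lt hρ
  set tb := max tm (τ + D)
  have hb1 : tm ≤ tb := le_max_left _ _
  have hb2 : τ + D ≤ tb := le_max_right _ _
  have hb3 : tb ≤ T := max_le hmT (by linarith)
  have hb4 : tb - D < y₁.1 := by
    rcases max_cases tm (τ + D) with ⟨h, _⟩ | ⟨h, _⟩ <;> simp only [tb, h] <;> linarith
  have hb5 : y₁.1 ≤ tb := (le_max_left _ _).trans hb1
  -- a time in the cylinder at distance at least `D / 4` from the time of `y₁`
  obtain ⟨t₃, c1, c2, c3, c4⟩ : ∃ t₃, tb - D < t₃ ∧ t₃ ≤ tb ∧ D / 4 ≤ |t₃ - y₁.1| ∧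
      |t₃ - y₁.1| ≤ D := by
    rcases le_or_gt y₁.1 (tb - D / 2) with h | h
    · exact ⟨tb, by linarith, le_rfl, by rw [abs_of_nonneg] <;> linarith,
        by rw [abs_of_nonneg] <;> linarith⟩
    · exact ⟨tb - 3 / 4 * D, by linarith, by linarith,
        by rw [abs_of_nonpos] <;> linarith, by rw [abs_of_nonpos] <;> linarith⟩
  set y₃ : Pt d := (t₃, y₁.2.1 + (t₃ - y₁.1) • y₁.2.2, y₁.2.2)
  have m3 : y₃ ∈ cylinder s r (cylCenter s r τ y₁ tm) := by
    refine mem_cylinder_cylCenter (by simp only [y₃]; linarith) (by simp only [y₃]; linarith)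
      (by simp only [y₃]; exact c2) ?_ ?_
    · simp only [y₃, add_sub_cancel_left, sub_self, norm_zero]; positivity
    · simpa [y₃] using hr
  have k3 : kdist s y₃ y₁ ≤ r := by
    refine kdist_le hs0 hr.le y₁.2.2 c4 ?_ (by simpa [y₃] using hr.le) (by simpa using hr.le)
    simp only [y₃, add_sub_cancel_left, sub_self, norm_zero]; positivity
  have k3' : kdist s y₃ y₁ ^ β ≤ 1 :=
    Real.rpow_le_one (kdist_nonneg _ _ _) (k3.trans hr1) hβ.le
  have g3 := abs_le.mp ((hb y₃ m3).trans (mul_le_of_le_one_right (by positivity) k3'))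
  have s1 := abs_le.mp (abs_le_of_weightedSeminorm_lt hs0 hsup hr hr1 hrT h1 h1')
  have s3 := abs_le.mp (abs_le_of_weightedSeminorm_lt hs0 hsup hr hr1 hrT (y := y₃)
    (by simp only [y₃]; linarith) (by simp only [y₃]; linarith))
  have hc3 : P y₃ - P y₁ = c * (t₃ - y₁.1) := by
    rw [hP, hP]; simp only [y₃]; ring
  have hc : |c| * (D / 4) ≤ 3 * (A * Y) := by
    calc |c| * (D / 4) ≤ |c| * |t₃ - y₁.1| := by gcongr
      _ = |P y₃ - P y₁| := by rw [hc3, abs_mul]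
      _ ≤ 3 * (A * Y) := by
        rw [abs_le, hPy]
        change -(A * Y) ≤ g y₃ ∧ g y₃ ≤ A * Y at s3
        constructor <;> linarith [g3.1, g3.2, s1.1, s1.2, s3.1, s3.2]
  have hc' : |c| ≤ A * Y * (12 / D) := by
    rw [mul_div_assoc', le_div_iff₀ hD]; linarith
  have k2 : kdist s y₂ y₁ ^ β ≤ ρ ^ β :=
    Real.rpow_le_rpow (kdist_nonneg _ _ _) (hn.kdist_le hs0 hρ0.le) hβ.le
  have g2 := (hb y₂ m2).trans (mul_le_mul_of_nonneg_left k2 (by positivity))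
  have hc2 : P y₁ - P y₂ = c * (y₁.1 - y₂.1) := by
    rw [hP, hP, hv]; ring
  calc |g y₁ - g y₂| = |(P y₁ - P y₂) - (g y₂ - P y₂)| := by rw [hPy]; ring_nf
    _ ≤ |P y₁ - P y₂| + |g y₂ - P y₂| := abs_sub _ _
    _ ≤ A * Y * (12 / D) * |y₁.1 - y₂.1| + A * Y * ρ ^ β := by
        rw [hc2, abs_mul]; gcongr
    _ = _ := by ring

/-- The expansion of `g` at `(t, x, v)`, restricted to the velocities and centred at `v`. -/
theorem hasTaylorNear_fiber {d : ℕ} {s α q τ T A r : ℝ} {g : Pt d → ℝ} (hs0 : 0 < s)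
    (hs1 : s < 1) (hα0 : 0 < α) (hα : α ≤ min 1 (2 * s)) (hq : 0 ≤ q) (hA : 0 ≤ A)
    (h : weightedNorm s (2 * s + α) q τ T g < ENNReal.ofReal A) (hr : 0 < r) (hr1 : r ≤ 1)
    (hrT : r ^ (2 * s) ≤ T - τ) {t : ℝ} (h1 : τ < t) (h2 : t ≤ T) (x v₀ : Vel d) :
    HasTaylorNear (2 * s + α) r (2 ^ q * A * (1 + ‖v₀‖) ^ (-q)) (fun u => g (t, x, u)) v₀ := by
  have hsup : weightedSeminorm s 0 q τ T g < ENNReal.ofReal A := lt_of_le_of_lt le_self_add h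
  have hreg : weightedSeminorm s (2 * s + α) q τ T g < ENNReal.ofReal A :=
    lt_of_le_of_lt le_add_self h
  have hD : 0 < r ^ (2 * s) := by positivity
  intro v hv
  have hY : A * (1 + ‖v‖) ^ (-q) ≤ 2 ^ q * A * (1 + ‖v₀‖) ^ (-q) := by
    have := one_add_norm_rpow_neg_le hq (u := v) (v := v₀) (by rwa [norm_sub_rev])
    nlinarith
  refine ⟨(abs_le_of_weightedSeminorm_lt hs0 hsup hr hr1 hrT (y := (t, x, v)) h1 h2).trans hY, ?_⟩
  obtain ⟨P, ⟨e, c, ℓ, Q, hl, hQ, hP⟩, hPy, hb⟩ := exists_slabQuadratic hs0 hs1 hα0 hα hreg hr hr1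
    hrT (y := (t, x, v)) h1 le_rfl h2 (by simp only; linarith)
  refine ⟨ℓ + Q v + Q.flip v, Q, ⟨fun hβ => ?_, hQ, fun a ha => ?_⟩⟩
  · rw [hl hβ, hQ (by linarith)]
    exact LinearMap.ext fun w => by simp
  · have hm : (t, x, v + a) ∈ cylinder s r (cylCenter s r τ (t, x, v) t) :=
      mem_cylinder_cylCenter h1 (by simp only; linarith) (le_max_left _ _) (by simp; positivity)
        (by simpa using ha)
    have hk : kdist s (t, x, v + a) (t, x, v) ≤ ‖a‖ :=
      kdist_le hs0 (norm_nonneg a) v (by simp; positivity) (by simp; positivity) (by simp)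
        (by simp)
    have hk' := Real.rpow_le_rpow (kdist_nonneg _ _ _) hk (by positivity : 0 ≤ 2 * s + α)
    have e1 : g (t, x, v + a) - g (t, x, v) - (ℓ + Q v + Q.flip v) a - Q a a
        = g (t, x, v + a) - P (t, x, v + a) := by
      rw [← hPy, hP, hP]
      simp only [map_add, LinearMap.add_apply, LinearMap.flip_apply]
      ring
    rw [e1]
    exact (hb _ hm).trans (mul_le_mul hY hk' (Real.rpow_nonneg (kdist_nonneg _ _ _) _)
      (by positivity))

/-- A function of order `2s + α` is also Hölder continuous of order `α`. -/
theorem exists_holder_of_weightedNorm_lt_of_high_order {d : ℕ} {s α q r : ℝ} (hs0 : 0 < s)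
    (hs1 : s < 1) (hα0 : 0 < α) (hα : α ≤ min 1 (2 * s)) (hq : 0 ≤ q) (hr : 0 < r) (hr1 : r ≤ 1) :
    ∃ C : ℝ, 0 ≤ C ∧ ∀ (τ T A : ℝ) (g : Pt d → ℝ), r ^ (2 * s) ≤ T - τ → 0 ≤ A →
      weightedNorm s (2 * s + α) q τ T g < ENNReal.ofReal A →
      KineticHolder s α q τ T (C * A) g := by
  have hα1 : α ≤ 1 := hα.trans (min_le_left _ _)
  have hα2 : α ≤ 2 * s := hα.trans (min_le_right _ _)
  set C1 := (12 / r ^ 2 + 4 / r + 1) * 2 ^ q + 2 ^ q * (12 / r ^ (2 * s) + 2)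
  have hC1 : 0 ≤ C1 := by positivity
  refine ⟨C1 + (1 + 2 ^ q) * (r / 4) ^ (-α), by positivity, ?_⟩
  intro τ T A g hrT hA hN y₁ y₂ ρ hρ h1 h1' h2 h2' hn hv
  have hsup : weightedSeminorm s 0 q τ T g < ENNReal.ofReal A := lt_of_le_of_lt le_self_add hN
  set Y := (1 + ‖y₁.2.2‖) ^ (-q)
  have hY : 0 < Y := by positivity
  have hρα : 0 < ρ ^ α := by positivity
  rcases lt_or_ge ρ (r / 4) with hρr | hρr
  · set y₃ : Pt d := (y₁.1, y₁.2.1, y₂.2.2)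
    have b1 : |g y₃ - g y₁| ≤ (12 / r ^ 2 + 4 / r + 1) * (2 ^ q * A * Y) * ρ ^ α := by
      have h := (hasTaylorNear_fiber hs0 hs1 hα0 hα hq hA hN hr hr1 hrT h1 h1' y₁.2.1
        y₁.2.2).sub_le_rpow hα0 hα1 (by linarith) hr hr1 (a := y₂.2.2 - y₁.2.2)
        (by rw [norm_sub_rev]; linarith [hn.vel])
      rw [add_sub_cancel] at h
      refine h.trans ?_
      gcongr
      rw [norm_sub_rev]; exact hn.vel
    have hn3 : KNear s (2 * ρ) y₃ y₂ := by
      refine ⟨hn.time.trans (Real.rpow_le_rpow hρ.le (by linarith) (by positivity)), ?_, ?_⟩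
      · have e : y₃.2.1 - y₂.2.1 - (y₃.1 - y₂.1) • y₃.2.2
            = (y₁.2.1 - y₂.2.1 - (y₁.1 - y₂.1) • y₁.2.2)
              + (y₁.1 - y₂.1) • (y₁.2.2 - y₂.2.2) := by simp only [y₃]; module
        rw [e]
        refine (norm_add_le _ _).trans ?_
        rw [norm_smul, Real.norm_eq_abs]
        have h3 : |y₁.1 - y₂.1| * ‖y₁.2.2 - y₂.2.2‖ ≤ ρ ^ (2 * s) * ρ :=
          mul_le_mul hn.time hn.vel (norm_nonneg _) (by positivity)
        have h4 : ρ ^ (2 * s) * ρ = ρ ^ (1 + 2 * s) := by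
          rw [add_comm, Real.rpow_add_one hρ.ne']
        have h5 := two_mul_rpow_le hρ.le (by linarith : 1 ≤ 1 + 2 * s)
        linarith [hn.pos]
      · simp [y₃]; positivity
    have b2 := abs_sub_le_of_same_velocity hs0 hs1 hα0 hα hA hN hr hr1 hrT (ρ := 2 * ρ)
      (by positivity) (by linarith) (y₁ := y₃) h1 h1' h2 h2' hn3 rfl
    have b3 : (1 + ‖y₂.2.2‖) ^ (-q) ≤ 2 ^ q * Y := one_add_norm_rpow_neg_le hq hv
    have b4 : |y₃.1 - y₂.1| ≤ ρ ^ α :=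
      hn.time.trans (Real.rpow_le_rpow_of_exponent_ge hρ (by linarith) hα2)
    have b5 : (2 * ρ) ^ (2 * s + α) ≤ 2 * ρ ^ α := by
      refine (Real.rpow_le_rpow_of_exponent_ge (by positivity) (by linarith)
        (by linarith : α ≤ 2 * s + α)).trans ?_
      rw [Real.mul_rpow (by norm_num) hρ.le]
      gcongr
      simpa using Real.rpow_le_rpow_of_exponent_le (by norm_num : (1 : ℝ) ≤ 2) hα1
    have b6 : |g y₃ - g y₂| ≤ A * (2 ^ q * Y) * (12 / r ^ (2 * s) * ρ ^ α + 2 * ρ ^ α) := by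
      refine b2.trans ?_
      change A * (1 + ‖y₂.2.2‖) ^ (-q) * _ ≤ _
      gcongr
    calc |g y₁ - g y₂| = |(g y₃ - g y₂) - (g y₃ - g y₁)| := by ring_nf
      _ ≤ |g y₃ - g y₂| + |g y₃ - g y₁| := abs_sub _ _
      _ ≤ C1 * A * Y * ρ ^ α := by
          refine (add_le_add b6 b1).trans_eq ?_
          simp only [C1]; ring
      _ ≤ _ := by
          have : 0 ≤ (1 + 2 ^ q) * (r / 4) ^ (-α) * (A * Y * ρ ^ α) := by positivity
          linarith
  · refine (abs_sub_le_of_le_dist hs0 hα0 hq hA hsup hr hr1 hrT (by positivity) hρr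
      h1 h1' h2 h2' hv).trans ?_
    have : 0 ≤ C1 * (A * Y * ρ ^ α) := by positivity
    linarith

/-! ### Second differences at two base points -/

/-- The change of `(t, x)` at fixed velocity costs `R^β` with `R = ρ^{2s/(1+2s)}`, because
translating the velocity by `a` shears the positions; the change of velocity costs `ρ |a|^{β-1}`. -/
theorem exists_secondDiff_sub_le_add {d : ℕ} {s α q r : ℝ} (hs0 : 0 < s)
    (hs1 : s < 1) (hα0 : 0 < α) (hα : α ≤ min 1 (2 * s)) (hq : 0 ≤ q) (hr : 0 < r) (hr1 : r ≤ 1) :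
    ∃ C : ℝ, 0 ≤ C ∧ ∀ (τ T A : ℝ) (g : Pt d → ℝ), r ^ (2 * s) ≤ T - τ → 0 ≤ A →
      weightedNorm s (2 * s + α) q τ T g < ENNReal.ofReal A →
      ∀ (z₁ z₂ : Pt d) (ρ R : ℝ), 0 < ρ → ρ ≤ R → R ≤ r / 16 → ρ ^ (2 * s) = R ^ (1 + 2 * s) →
        τ < z₁.1 → z₁.1 ≤ T → τ < z₂.1 → z₂.1 ≤ T → KNear s ρ z₁ z₂ → ∀ a : Vel d, ‖a‖ ≤ r / 16 →
        (2 * s + α ≤ 1 → |secondDiff (fun u => g (z₁.1, z₁.2.1, u)) z₁.2.2 a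
            - secondDiff (fun u => g (z₂.1, z₂.2.1, u)) z₂.2.2 a|
          ≤ C * A * (1 + ‖z₁.2.2‖) ^ (-q) * R ^ (2 * s + α)) ∧
        (1 < 2 * s + α → |secondDiff (fun u => g (z₁.1, z₁.2.1, u)) z₁.2.2 a
            - secondDiff (fun u => g (z₂.1, z₂.2.1, u)) z₂.2.2 a|
          ≤ C * A * (1 + ‖z₁.2.2‖) ^ (-q) * (R ^ (2 * s + α) + ‖a‖ ^ (2 * s + α - 1) * ρ)) := by
  have hα1 : α ≤ 1 := hα.trans (min_le_left _ _)
  have hα2 : α ≤ 2 * s := hα.trans (min_le_right _ _)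
  set β := 2 * s + α
  have hβ : 0 < β := by positivity
  have hβ3 : β ≤ 3 := by simp only [β]; linarith
  set c0 := 12 / r ^ (2 * s) + 27
  have hc0 : 0 ≤ c0 := by positivity
  refine ⟨2 ^ q * (4 * c0 + 18), by positivity, ?_⟩
  intro τ T A g hrT hA hN z₁ z₂ ρ R hρ hρR hRr hρeq h1 h1' h2 h2' hn a ha
  set Y := (1 + ‖z₁.2.2‖) ^ (-q)
  have hY : 0 < Y := by positivity
  have hR : 0 < R := hρ.trans_le hρR
  have hR1 : R ≤ 1 := by linarith
  have hρ1 : ρ ≤ 1 := by linarith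
  have ha1 : ‖a‖ ≤ 1 / 16 := by linarith
  have hv : ‖z₁.2.2 - z₂.2.2‖ ≤ 1 / 16 := by linarith [hn.vel]
  set φ₁ := fun u : Vel d => g (z₁.1, z₁.2.1, u)
  set φ₂ := fun u : Vel d => g (z₂.1, z₂.2.1, u)
  have hA1 : ∀ e : Vel d, ‖e‖ ≤ 1 / 2 →
      |φ₁ (z₂.2.2 + e) - φ₂ (z₂.2.2 + e)| ≤ 2 ^ q * A * Y * (c0 * R ^ β) := by
    intro e he
    set y₁ : Pt d := (z₁.1, z₁.2.1, z₂.2.2 + e)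
    set y₂ : Pt d := (z₂.1, z₂.2.1, z₂.2.2 + e)
    have hR3 : 3 * R ^ (1 + 2 * s) ≤ (3 * R) ^ (1 + 2 * s) := by
      rw [Real.mul_rpow (by norm_num) hR.le]
      refine mul_le_mul_of_nonneg_right ?_ (by positivity)
      simpa using Real.rpow_le_rpow_of_exponent_le (by norm_num : (1 : ℝ) ≤ 3)
        (by linarith : 1 ≤ 1 + 2 * s)
    have hnear : KNear s (3 * R) y₁ y₂ := by
      refine ⟨?_, ?_, ?_⟩
      · refine hn.time.trans ?_
        rw [hρeq]
        refine (Real.rpow_le_rpow_of_exponent_ge hR hR1 (by linarith : 2 * s ≤ 1 + 2 * s)).trans ?_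
        exact Real.rpow_le_rpow hR.le (by linarith) (by positivity)
      · have e1 : y₁.2.1 - y₂.2.1 - (y₁.1 - y₂.1) • y₁.2.2
            = (z₁.2.1 - z₂.2.1 - (z₁.1 - z₂.1) • z₁.2.2)
              + (z₁.1 - z₂.1) • ((z₁.2.2 - z₂.2.2) - e) := by simp only [y₁, y₂]; module
        rw [e1]
        refine (norm_add_le _ _).trans ?_
        rw [norm_smul, Real.norm_eq_abs]
        have p1 : ‖(z₁.2.2 - z₂.2.2) - e‖ ≤ 1 := (norm_sub_le _ _).trans (by linarith)
        have p2 : |z₁.1 - z₂.1| * ‖(z₁.2.2 - z₂.2.2) - e‖ ≤ ρ ^ (2 * s) * 1 :=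
          mul_le_mul hn.time p1 (norm_nonneg _) (by positivity)
        have p3 : ρ ^ (1 + 2 * s) ≤ ρ ^ (2 * s) :=
          Real.rpow_le_rpow_of_exponent_ge hρ hρ1 (by linarith)
        have p4 : 0 ≤ R ^ (1 + 2 * s) := by positivity
        rw [hρeq] at p2 p3
        linarith [hn.pos]
      · simp [y₁, y₂]; positivity
    have b := abs_sub_le_of_same_velocity hs0 hs1 hα0 hα hA hN hr hr1 hrT (ρ := 3 * R)
      (by positivity) (by linarith) (y₁ := y₁) (y₂ := y₂) h1 h1' h2 h2' hnear rfl
    have b3 : (1 + ‖z₂.2.2 + e‖) ^ (-q) ≤ 2 ^ q * Y := by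
      refine one_add_norm_rpow_neg_le hq ?_
      rw [show z₁.2.2 - (z₂.2.2 + e) = (z₁.2.2 - z₂.2.2) - e by abel]
      exact (norm_sub_le _ _).trans (by linarith)
    have b4 : |y₁.1 - y₂.1| ≤ R ^ β := by
      refine hn.time.trans ?_
      rw [hρeq]
      exact Real.rpow_le_rpow_of_exponent_ge hR hR1 (by simp only [β]; linarith)
    have b5 : (3 * R) ^ β ≤ 27 * R ^ β := by
      rw [Real.mul_rpow (by norm_num) hR.le]
      gcongr
      calc (3 : ℝ) ^ β ≤ 3 ^ (3 : ℝ) := Real.rpow_le_rpow_of_exponent_le (by norm_num) hβ3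
        _ = 27 := by norm_num
    calc |φ₁ (z₂.2.2 + e) - φ₂ (z₂.2.2 + e)|
        ≤ A * (1 + ‖z₂.2.2 + e‖) ^ (-q) * (12 / r ^ (2 * s) * |y₁.1 - y₂.1| + (3 * R) ^ β) := b
      _ ≤ A * (2 ^ q * Y) * (12 / r ^ (2 * s) * R ^ β + 27 * R ^ β) := by gcongr
      _ = _ := by simp only [c0]; ring
  have hA2 : |secondDiff φ₁ z₂.2.2 a - secondDiff φ₂ z₂.2.2 a|
      ≤ 2 ^ q * A * Y * (4 * c0 * R ^ β) := by
    have k0 := abs_le.mp (hA1 0 (by simp))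
    have k1 := abs_le.mp (hA1 a (by linarith))
    have k2 := abs_le.mp (hA1 (-a) (by rw [norm_neg]; linarith))
    rw [add_zero] at k0
    rw [← sub_eq_add_neg] at k2
    unfold secondDiff
    rw [abs_le]
    constructor <;> linarith [k0.1, k0.2, k1.1, k1.2, k2.1, k2.2]
  have hT := hasTaylorNear_fiber hs0 hs1 hα0 hα hq hA hN hr hr1 hrT h1 h1' z₁.2.1 z₁.2.2
  have htri : |secondDiff φ₁ z₁.2.2 a - secondDiff φ₂ z₂.2.2 a|
      ≤ |secondDiff φ₁ z₁.2.2 a - secondDiff φ₁ z₂.2.2 a|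
        + |secondDiff φ₁ z₂.2.2 a - secondDiff φ₂ z₂.2.2 a| := abs_sub_le _ _ _
  constructor
  · intro hβ1
    have b := hT.secondDiff_sub_le_of_le_one hβ1 (v := z₂.2.2) (a := a)
      (by rw [norm_sub_rev]; linarith [hn.vel]) (by linarith)
    have b' : ‖z₂.2.2 - z₁.2.2‖ ^ β ≤ R ^ β := by
      refine Real.rpow_le_rpow (norm_nonneg _) ?_ hβ.le
      rw [norm_sub_rev]; exact hn.vel.trans hρR
    calc _ ≤ 4 * (2 ^ q * A * Y) * R ^ β + 2 ^ q * A * Y * (4 * c0 * R ^ β) :=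
          htri.trans (add_le_add (b.trans (by gcongr)) hA2)
      _ ≤ _ := by
          have : 0 ≤ 2 ^ q * A * Y * R ^ β := by positivity
          linarith
  · intro hβ1
    have b := hT.secondDiff_sub_le_of_one_lt hβ1 hβ3 hr hr1 (v := z₂.2.2) (a := a)
      (by rw [norm_sub_rev]; linarith) (by linarith)
    have b' : ‖z₂.2.2 - z₁.2.2‖ ≤ ρ := by rw [norm_sub_rev]; exact hn.vel
    calc _ ≤ 18 * (2 ^ q * A * Y) * ‖a‖ ^ (β - 1) * ρ + 2 ^ q * A * Y * (4 * c0 * R ^ β) :=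
          htri.trans (add_le_add (b.trans (by gcongr)) hA2)
      _ ≤ _ := by
          have : 0 ≤ 2 ^ q * A * Y * R ^ β := by positivity
          have : 0 ≤ 2 ^ q * A * Y * c0 * (‖a‖ ^ (β - 1) * ρ) := by positivity
          linarith

/-- The second differences at two points at distance `ρ` differ by `R^α |a|^{2s}`, with a gain of a
power of `|a|/R` or `R/|a|`, where `R = ρ^{2s/(1+2s)}`. Below the scale `R` the quadratic parts of
the two expansions are compared on the sphere of radius `R` and scaled down. -/
theorem exists_secondDiff_sub_le {d : ℕ} {s α q r c : ℝ} (hs0 : 0 < s)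
    (hs1 : s < 1) (hα0 : 0 < α) (hα : α ≤ min 1 (2 * s)) (hq : 0 ≤ q) (hr : 0 < r) (hr1 : r ≤ 1)
    (hcα : c ≤ α) (hcs : c ≤ 2 - 2 * s) (hcs' : c ≤ 2 * s) (hc2 : c ≤ 1 / 2)
    (hc0 : 0 < c) :
    ∃ C : ℝ, 0 ≤ C ∧ ∀ (τ T A : ℝ) (g : Pt d → ℝ), r ^ (2 * s) ≤ T - τ → 0 ≤ A →
      weightedNorm s (2 * s + α) q τ T g < ENNReal.ofReal A →
      ∀ (z₁ z₂ : Pt d) (ρ R : ℝ), 0 < ρ → R ≤ r / 16 → R = ρ ^ (2 * s / (1 + 2 * s)) →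
        τ < z₁.1 → z₁.1 ≤ T → τ < z₂.1 → z₂.1 ≤ T → KNear s ρ z₁ z₂ → ∀ a : Vel d,
        (‖a‖ < R → |secondDiff (fun u => g (z₁.1, z₁.2.1, u)) z₁.2.2 a
            - secondDiff (fun u => g (z₂.1, z₂.2.1, u)) z₂.2.2 a|
          ≤ C * A * R ^ α * ((1 + ‖z₁.2.2‖) ^ (-q) * (‖a‖ ^ (2 * s) * (‖a‖ / R) ^ c))) ∧
        (R ≤ ‖a‖ → ‖a‖ ≤ r / 16 → |secondDiff (fun u => g (z₁.1, z₁.2.1, u)) z₁.2.2 a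
            - secondDiff (fun u => g (z₂.1, z₂.2.1, u)) z₂.2.2 a|
          ≤ C * A * R ^ α * ((1 + ‖z₁.2.2‖) ^ (-q) * (‖a‖ ^ (2 * s) * (R / ‖a‖) ^ c))) := by
  obtain ⟨C, hC, h⟩ := exists_secondDiff_sub_le_add (d := d) hs0 hs1 hα0 hα hq hr hr1
  have hα1 : α ≤ 1 := hα.trans (min_le_left _ _)
  set β := 2 * s + α
  have hβ : 0 < β := by positivity
  refine ⟨2 * C + 8 * (2 ^ q * 2 ^ q), by positivity, ?_⟩
  intro τ T A g hrT hA hN z₁ z₂ ρ R hρ hRr hReq h1 h1' h2 h2' hn a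
  set Y := (1 + ‖z₁.2.2‖) ^ (-q)
  have hY : 0 < Y := by positivity
  have hR : 0 < R := by rw [hReq]; positivity
  have hR1 : R ≤ 1 := by linarith
  have hρ1 : ρ ≤ 1 := by
    by_contra hcon
    have : 1 < ρ ^ (2 * s / (1 + 2 * s)) := Real.one_lt_rpow (not_le.mp hcon) (by positivity)
    linarith
  have hρR : ρ ≤ R := by
    rw [hReq]
    simpa using Real.rpow_le_rpow_of_exponent_ge hρ hρ1
      (by rw [div_le_one (by positivity)]; linarith : 2 * s / (1 + 2 * s) ≤ 1)
  -- `s < 1` gives `2s / (1 + 2s) < 2 / 3`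
  have hρR' : ρ ≤ R ^ (3 / 2 : ℝ) := by
    rw [hReq, ← Real.rpow_mul hρ.le]
    refine le_trans (le_of_eq (Real.rpow_one ρ).symm)
      (Real.rpow_le_rpow_of_exponent_ge hρ hρ1 ?_)
    rw [div_mul_eq_mul_div, div_le_one (by positivity)]
    linarith
  have hρeq : ρ ^ (2 * s) = R ^ (1 + 2 * s) := by
    rw [hReq, ← Real.rpow_mul hρ.le]
    congr 1; field_simp
  have hraw := h τ T A g hrT hA hN z₁ z₂ ρ R hρ hρR hRr hρeq h1 h1' h2 h2' hn
  set φ₁ := fun u : Vel d => g (z₁.1, z₁.2.1, u)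
  set φ₂ := fun u : Vel d => g (z₂.1, z₂.2.1, u)
  have hRβ : R ^ β = R ^ α * R ^ (2 * s) := by rw [← Real.rpow_add hR, add_comm]
  constructor
  · intro haR
    have hq2 : (1 : ℝ) ≤ 2 ^ q := Real.one_le_rpow (by norm_num) hq
    have hT1 := hasTaylorNear_fiber hs0 hs1 hα0 hα hq hA hN hr hr1 hrT h1 h1' z₁.2.1 z₁.2.2
    have hT2 := hasTaylorNear_fiber hs0 hs1 hα0 hα hq hA hN hr hr1 hrT h2 h2' z₂.2.1 z₂.2.2
    obtain ⟨ℓ₁, Q₁, k1⟩ := (hT1 z₁.2.2 (by simp)).2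
    obtain ⟨ℓ₂, Q₂, k2⟩ := (hT2 z₂.2.2 (by simp)).2
    set N := 2 ^ q * 2 ^ q * A * Y
    have hN1 : 2 ^ q * A * Y ≤ N := by
      have : 0 ≤ 2 ^ q * A * Y := by positivity
      simp only [N]; nlinarith
    have hN2 : 2 ^ q * A * (1 + ‖z₂.2.2‖) ^ (-q) ≤ N := by
      have := one_add_norm_rpow_neg_le hq (u := z₂.2.2) (v := z₁.2.2) (by linarith [hn.vel])
      calc _ ≤ 2 ^ q * A * (2 ^ q * Y) := by gcongr
        _ = N := by simp only [N]; ring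
    have hN0 : 0 ≤ N := by positivity
    have hlt : ∀ b : Vel d, ‖b‖ ≤ R → ‖b‖ < r := fun b hb => by linarith
    have hE1 : ∀ b : Vel d, ‖b‖ ≤ R → |secondDiff φ₁ z₁.2.2 b - 2 * Q₁ b b| ≤ 2 * N * ‖b‖ ^ β :=
      fun b hb => (k1.secondDiff_sub_le (hlt b hb)).trans (by gcongr)
    have hE2 : ∀ b : Vel d, ‖b‖ ≤ R → |secondDiff φ₂ z₂.2.2 b - 2 * Q₂ b b| ≤ 2 * N * ‖b‖ ^ β :=
      fun b hb => (k2.secondDiff_sub_le (hlt b hb)).trans (by gcongr)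
    have hsphere : ∀ b : Vel d, ‖b‖ = R →
        |(Q₁ - Q₂) b b| ≤ (C * A * Y + 2 * N) * R ^ β := by
      intro b hb
      have d1 := abs_le.mp (hE1 b hb.le)
      have d2 := abs_le.mp (hE2 b hb.le)
      have d3 : |secondDiff φ₁ z₁.2.2 b - secondDiff φ₂ z₂.2.2 b| ≤ 2 * (C * A * Y) * R ^ β := by
        rcases le_or_gt β 1 with hβ1 | hβ1
        · refine ((hraw b (by linarith)).1 hβ1).trans ?_
          have : 0 ≤ C * A * Y * R ^ β := by positivity
          linarith
        · refine ((hraw b (by linarith)).2 hβ1).trans ?_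
          rw [hb]
          have : R ^ (β - 1) * ρ ≤ R ^ β := by
            calc R ^ (β - 1) * ρ ≤ R ^ (β - 1) * R := by gcongr
              _ = R ^ β := by rw [← Real.rpow_add_one hR.ne', sub_add_cancel]
          have h0 : 0 ≤ C * A * Y := by positivity
          nlinarith
      have d3 := abs_le.mp d3
      rw [hb] at d1 d2
      simp only [LinearMap.sub_apply]
      rw [abs_le]
      constructor <;> linarith [d1.1, d1.2, d2.1, d2.2, d3.1, d3.2]
    have hQ := abs_le.mp (quadratic_le_of_sphere (Q₁ - Q₂) hR hsphere a)
    have d1 := abs_le.mp (hE1 a haR.le)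
    have d2 := abs_le.mp (hE2 a haR.le)
    simp only [LinearMap.sub_apply] at hQ
    set x := ‖a‖ / R
    have hx0 : 0 ≤ x := by positivity
    have hx1 : x ≤ 1 := by rw [div_le_one hR]; exact haR.le
    have hax : ‖a‖ = R * x := by simp only [x]; field_simp
    have e1 : ‖a‖ ^ β ≤ R ^ β * x ^ (2 * s + c) := by
      rw [hax, Real.mul_rpow hR.le hx0]
      exact mul_le_mul_of_nonneg_left (Real.rpow_le_rpow_of_exponent_ge' hx0 hx1 (by positivity)
        (by simp only [β]; linarith)) (by positivity)
    have e2 : x ^ 2 ≤ x ^ (2 * s + c) := by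
      rw [← Real.rpow_two]
      exact Real.rpow_le_rpow_of_exponent_ge' hx0 hx1 (by positivity) (by linarith)
    have e3 : R ^ α * (‖a‖ ^ (2 * s) * x ^ c) = R ^ β * x ^ (2 * s + c) := by
      rw [hRβ, hax, Real.mul_rpow hR.le hx0, Real.rpow_add' hx0 (by positivity)]
      ring
    have e4 : (C * A * Y + 2 * N) * R ^ β * x ^ 2
        ≤ (C * A * Y + 2 * N) * (R ^ β * x ^ (2 * s + c)) := by
      rw [mul_assoc]; gcongr
    have e5 : 2 * N * ‖a‖ ^ β ≤ 2 * N * (R ^ β * x ^ (2 * s + c)) := by gcongr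
    have e6 : (2 * C + 8 * (2 ^ q * 2 ^ q)) * A * R ^ α * (Y * (‖a‖ ^ (2 * s) * x ^ c))
        = (2 * (C * A * Y) + 8 * N) * (R ^ β * x ^ (2 * s + c)) := by
      rw [← e3]; simp only [N]; ring
    rw [e6, abs_le]
    constructor <;> linarith [d1.1, d1.2, d2.1, d2.2, hQ.1, hQ.2]
  · intro hRa har
    have hx : 0 < ‖a‖ := hR.trans_le hRa
    have hx1 : ‖a‖ ≤ 1 := by linarith
    have hq0 : 0 < R / ‖a‖ := by positivity
    have hq1 : R / ‖a‖ ≤ 1 := by rw [div_le_one hx]; exact hRa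
    set G := R ^ α * (‖a‖ ^ (2 * s) * (R / ‖a‖) ^ c)
    have hG : 0 ≤ G := by positivity
    have e1 : R ^ β ≤ G := by
      have : R ^ (2 * s) = ‖a‖ ^ (2 * s) * (R / ‖a‖) ^ (2 * s) := by
        rw [← Real.mul_rpow hx.le hq0.le]; congr 1; field_simp
      rw [hRβ, this]
      simp only [G]
      have := Real.rpow_le_rpow_of_exponent_ge hq0 hq1 hcs'
      gcongr
    have e2 : ‖a‖ ^ (β - 1) * ρ ≤ G := by
      have p1 : (R / ‖a‖) ^ (1 - α) * R ^ (1 / 2 : ℝ) ≤ (R / ‖a‖) ^ c := by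
        have p2 : (R / ‖a‖) ^ (1 - α) ≤ 1 := Real.rpow_le_one hq0.le hq1 (by linarith)
        have p3 : R ^ (1 / 2 : ℝ) ≤ (R / ‖a‖) ^ (1 / 2 : ℝ) :=
          Real.rpow_le_rpow hR.le (le_div_self hR.le hx hx1) (by norm_num)
        have p4 := Real.rpow_le_rpow_of_exponent_ge hq0 hq1 hc2
        calc _ ≤ 1 * R ^ (1 / 2 : ℝ) := by gcongr
          _ ≤ _ := by rw [one_mul]; exact p3.trans p4
      calc ‖a‖ ^ (β - 1) * ρ ≤ ‖a‖ ^ (β - 1) * R ^ (3 / 2 : ℝ) := by gcongr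
        _ = R ^ α * (‖a‖ ^ (2 * s) * ((R / ‖a‖) ^ (1 - α) * R ^ (1 / 2 : ℝ))) := by
            rw [Real.div_rpow hR.le hx.le, show β - 1 = 2 * s - (1 - α) by simp only [β]; ring,
              Real.rpow_sub hx, show (3 / 2 : ℝ) = α + (1 - α) + 1 / 2 by ring,
              Real.rpow_add hR, Real.rpow_add hR]
            field_simp
        _ ≤ G := by simp only [G]; gcongr
    have h0 : 0 ≤ C * A * Y := by positivity
    have e6 : (2 * C + 8 * (2 ^ q * 2 ^ q)) * A * R ^ α * (Y * (‖a‖ ^ (2 * s) * (R / ‖a‖) ^ c))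
        = 2 * (C * A * Y * G) + 8 * (2 ^ q * 2 ^ q) * A * Y * G := by simp only [G]; ring
    have h3 : 0 ≤ 8 * (2 ^ q * 2 ^ q) * A * Y * G := by positivity
    have h4 : C * A * Y * R ^ β ≤ C * A * Y * G := by gcongr
    have h5 : C * A * Y * (‖a‖ ^ (β - 1) * ρ) ≤ C * A * Y * G := by gcongr
    rw [e6]
    rcases le_or_gt β 1 with hβ1 | hβ1
    · refine ((hraw a har).1 hβ1).trans ?_
      have : 0 ≤ C * A * Y * G := by positivity
      linarith
    · refine ((hraw a har).2 hβ1).trans ?_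
      rw [mul_add]
      linarith

/-! ### Estimates for the collision operator -/

/-- Continuity on cylinders gives continuity of the velocity profiles: through every point of the slab
after the initial time there is a cylinder inside the slab with an interior velocity slice. -/
theorem continuous_fiber {d : ℕ} {s τ T r : ℝ} {f : Pt d → ℝ} (hr : 0 < r) (hr1 : r ≤ 1)
    (hrT : r ^ (2 * s) ≤ T - τ)
    (hf : ∀ (z : Pt d) (r : ℝ), 0 < r → r ≤ 1 → cylinder s r z ⊆ slab d τ T →
      ContinuousOn f (cylinder s r z)) {t : ℝ} (h1 : τ < t) (h2 : t ≤ T) (x : Vel d) :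
    Continuous fun u => f (t, x, u) := by
  have hD : 0 < r ^ (2 * s) := by positivity
  rw [continuous_iff_continuousAt]
  intro v
  have hc := hf _ r hr hr1 (cylinder_cylCenter_subset hrT h2 (t, x, v))
  have hmap : MapsTo (fun u : Vel d => ((t, x, u) : Pt d)) (Metric.ball v r)
      (cylinder s r (cylCenter s r τ (t, x, v) t)) := by
    intro u hu
    rw [mem_ball_iff_norm] at hu
    exact mem_cylinder_cylCenter h1 (by simp only; linarith) (le_max_left _ _)
      (by simp; positivity) hu
  exact (hc.comp (Continuous.continuousOn (by fun_prop)) hmap).continuousAt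
    (Metric.ball_mem_nhds v hr)

/-- Adding `w` to both velocities shears the positions by `|t₁ - t₂| |w| ≤ R^{1+2s} |w|`. -/
theorem KNear.shift {d : ℕ} {s ρ R : ℝ} (hs : 0 < s) (hρ : 0 < ρ) (hρR : ρ ≤ R) (hρ1 : ρ ≤ 1)
    (hρeq : ρ ^ (2 * s) = R ^ (1 + 2 * s)) {z₁ z₂ : Pt d} (h : KNear s ρ z₁ z₂) (w : Vel d) :
    KNear s (R * (1 + ‖w‖) ^ (1 / (1 + 2 * s))) (z₁.1, z₁.2.1, z₁.2.2 + w)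
      (z₂.1, z₂.2.1, z₂.2.2 + w) := by
  have hR : 0 < R := hρ.trans_le hρR
  have h1 : 1 ≤ (1 + ‖w‖) ^ (1 / (1 + 2 * s)) :=
    Real.one_le_rpow (by linarith [norm_nonneg w]) (by positivity)
  have h2 : ρ ≤ R * (1 + ‖w‖) ^ (1 / (1 + 2 * s)) :=
    hρR.trans (le_mul_of_one_le_right hR.le h1)
  refine ⟨h.time.trans (Real.rpow_le_rpow hρ.le h2 (by positivity)), ?_, ?_⟩
  · rw [Real.mul_rpow hR.le (by positivity), ← hρeq, ← Real.rpow_mul (by positivity),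
      one_div_mul_cancel (by positivity), Real.rpow_one]
    have e : z₁.2.1 - z₂.2.1 - (z₁.1 - z₂.1) • (z₁.2.2 + w)
        = (z₁.2.1 - z₂.2.1 - (z₁.1 - z₂.1) • z₁.2.2) - (z₁.1 - z₂.1) • w := by module
    change ‖z₁.2.1 - z₂.2.1 - (z₁.1 - z₂.1) • (z₁.2.2 + w)‖ ≤ _
    rw [e]
    refine (norm_sub_le _ _).trans ?_
    rw [norm_smul, Real.norm_eq_abs]
    have p1 : |z₁.1 - z₂.1| * ‖w‖ ≤ ρ ^ (2 * s) * ‖w‖ :=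
      mul_le_mul_of_nonneg_right h.time (norm_nonneg w)
    have p2 : ρ ^ (1 + 2 * s) ≤ ρ ^ (2 * s) :=
      Real.rpow_le_rpow_of_exponent_ge hρ hρ1 (by linarith)
    linarith [h.pos]
  · simp only [add_sub_add_right_eq_sub]
    exact h.vel.trans h2

/-- The increment of a Hölder continuous function between the two points with velocities shifted by
`w`. -/
theorem KineticHolder.shift {d : ℕ} {s α q τ T C ρ R : ℝ} {f : Pt d → ℝ}
    (hf : KineticHolder s α q τ T C f) (hs : 0 < s) (hρ : 0 < ρ) (hρR : ρ ≤ R)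
    (hρ1 : ρ ≤ 1) (hρeq : ρ ^ (2 * s) = R ^ (1 + 2 * s)) {z₁ z₂ : Pt d}
    (h1 : τ < z₁.1) (h1' : z₁.1 ≤ T) (h2 : τ < z₂.1) (h2' : z₂.1 ≤ T) (h : KNear s ρ z₁ z₂)
    (w : Vel d) :
    |f (z₁.1, z₁.2.1, z₁.2.2 + w) - f (z₂.1, z₂.2.1, z₂.2.2 + w)|
      ≤ C * R ^ α * ((1 + ‖z₁.2.2 + w‖) ^ (-q) * (1 + ‖w‖) ^ (α / (1 + 2 * s))) := by
  have hR : 0 < R := hρ.trans_le hρR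
  have := hf (z₁.1, z₁.2.1, z₁.2.2 + w) (z₂.1, z₂.2.1, z₂.2.2 + w)
    (R * (1 + ‖w‖) ^ (1 / (1 + 2 * s))) (by positivity) h1 h1' h2 h2'
    (h.shift hs hρ hρR hρ1 hρeq w) (by simp only [add_sub_add_right_eq_sub]; exact h.vel.trans hρ1)
  refine this.trans_eq ?_
  rw [Real.mul_rpow hR.le (by positivity), ← Real.rpow_mul (by positivity), one_div_mul_eq_div]
  ring

/-- The exponent gained by the second differences near the diagonal. -/
def gainExponent (s α : ℝ) : ℝ := min (min α (2 - 2 * s)) (min (2 * s) (1 / 2))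

theorem gainExponent_pos {s α : ℝ} (hs0 : 0 < s) (hs1 : s < 1) (hα : 0 < α) :
    0 < gainExponent s α :=
  lt_min (lt_min hα (by linarith)) (lt_min (by linarith) (by norm_num))

/-- The second difference of a single function of order `2s + α` satisfies the hypotheses of
`exists_lintegral_collision_le` at the fixed scale `r₁`. -/
theorem exists_secondDiff_bounds {d : ℕ} {s α q r r₁ : ℝ} (hs0 : 0 < s) (hs1 : s < 1)
    (hα0 : 0 < α) (hα : α ≤ min 1 (2 * s)) (hq : 0 ≤ q) (hr : 0 < r) (hr1 : r ≤ 1) (hr₁ : 0 < r₁)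
    (hr₁' : r₁ < r) :
    ∃ C : ℝ, 0 ≤ C ∧ ∀ (τ T A : ℝ) (g : Pt d → ℝ), r ^ (2 * s) ≤ T - τ → 0 ≤ A →
      weightedNorm s (2 * s + α) q τ T g < ENNReal.ofReal A →
      ∀ z : Pt d, τ < z.1 → z.1 ≤ T → ∀ a : Vel d,
        (‖a‖ < r₁ → |secondDiff (fun u => g (z.1, z.2.1, u)) z.2.2 a|
          ≤ C * A * ((1 + ‖z.2.2‖) ^ (-q) * (‖a‖ ^ (2 * s) * (‖a‖ / r₁) ^ gainExponent s α))) ∧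
        (r₁ ≤ ‖a‖ → ‖a‖ ≤ r₁ → |secondDiff (fun u => g (z.1, z.2.1, u)) z.2.2 a|
          ≤ C * A * ((1 + ‖z.2.2‖) ^ (-q) * (‖a‖ ^ (2 * s) * (r₁ / ‖a‖) ^ gainExponent s α))) ∧
        (r₁ < ‖a‖ → |secondDiff (fun u => g (z.1, z.2.1, u)) z.2.2 a|
          ≤ C * A * (‖a‖ ^ (0 : ℝ) * ((1 + ‖z.2.2‖) ^ (-q) + (1 + ‖z.2.2 + a‖) ^ (-q)
            + (1 + ‖z.2.2 - a‖) ^ (-q)))) := by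
  set c := gainExponent s α
  have hc : 0 < c := gainExponent_pos hs0 hs1 hα0
  have hc1 : c ≤ α := (min_le_left _ _).trans (min_le_left _ _)
  have hc2 : c ≤ 2 - 2 * s := (min_le_left _ _).trans (min_le_right _ _)
  set C1 := (24 / r ^ 2 + 2) * 2 ^ q
  have hC1 : 0 ≤ C1 := by positivity
  refine ⟨C1 + 2, by positivity, ?_⟩
  intro τ T A g hrT hA hN z h1 h2 a
  set Y := (1 + ‖z.2.2‖) ^ (-q)
  have hY : 0 < Y := by positivity
  have hsup : weightedSeminorm s 0 q τ T g < ENNReal.ofReal A := lt_of_le_of_lt le_self_add hN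
  have hT := hasTaylorNear_fiber hs0 hs1 hα0 hα hq hA hN hr hr1 hrT h1 h2 z.2.1 z.2.2
  have key : ‖a‖ ≤ r₁ → |secondDiff (fun u => g (z.1, z.2.1, u)) z.2.2 a|
      ≤ (C1 + 2) * A * (Y * (‖a‖ ^ (2 * s) * (‖a‖ / r₁) ^ c)) := by
    intro ha
    have b := hT.secondDiff_le_rpow (e := 2 * s + c) (by positivity) hr hr1 (by linarith)
      (by linarith) (by positivity) (a := a) (by linarith)
    have e : ‖a‖ ^ (2 * s + c) ≤ ‖a‖ ^ (2 * s) * (‖a‖ / r₁) ^ c := by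
      rw [Real.rpow_add' (norm_nonneg a) (by positivity)]
      refine mul_le_mul_of_nonneg_left (Real.rpow_le_rpow (norm_nonneg a) ?_ hc.le) (by positivity)
      exact le_div_self (norm_nonneg a) hr₁ (by linarith)
    calc _ ≤ C1 * A * Y * ‖a‖ ^ (2 * s + c) := b.trans_eq (by simp only [C1]; ring)
      _ ≤ C1 * A * Y * (‖a‖ ^ (2 * s) * (‖a‖ / r₁) ^ c) := by gcongr
      _ ≤ _ := by
        have : 0 ≤ 2 * A * Y * (‖a‖ ^ (2 * s) * (‖a‖ / r₁) ^ c) := by positivity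
        linarith
  refine ⟨fun ha => key ha.le, fun ha ha' => ?_, fun ha => ?_⟩
  · have e : ‖a‖ = r₁ := le_antisymm ha' ha
    have := key ha'
    rw [e] at this ⊢
    exact this
  · have s0 := abs_le.mp (abs_le_of_weightedSeminorm_lt hs0 hsup hr hr1 hrT h1 h2)
    have s1 := abs_le.mp (abs_le_of_weightedSeminorm_lt hs0 hsup hr hr1 hrT
      (y := (z.1, z.2.1, z.2.2 + a)) h1 h2)
    have s2 := abs_le.mp (abs_le_of_weightedSeminorm_lt hs0 hsup hr hr1 hrT
      (y := (z.1, z.2.1, z.2.2 - a)) h1 h2)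
    simp only at s1 s2
    rw [Real.rpow_zero, one_mul]
    set Y1 := (1 + ‖z.2.2 + a‖) ^ (-q)
    set Y2 := (1 + ‖z.2.2 - a‖) ^ (-q)
    have p1 : 0 ≤ A * Y := by positivity
    have p2 : 0 ≤ A * Y1 := by positivity
    have p3 : 0 ≤ A * Y2 := by positivity
    have p4 : 0 ≤ C1 * A * (Y + Y1 + Y2) := by positivity
    change |g (z.1, z.2.1, z.2.2 + a) + g (z.1, z.2.1, z.2.2 - a) - 2 * g z| ≤ _
    rw [abs_le]
    constructor <;> linarith [s0.1, s0.2, s1.1, s1.2, s2.1, s2.2]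

theorem measurable_secondDiff {d : ℕ} {φ : Vel d → ℝ} (hφ : Continuous φ) (v : Vel d) :
    Measurable (secondDiff φ v) := by
  unfold secondDiff
  exact Continuous.measurable (by fun_prop)

/-- Existence of the principal value, its representation by second differences, and the pointwise
bound. -/
theorem exists_Q₁_pointwise {d : ℕ} (hd : 2 ≤ d) {s γ α q r : ℝ} (Lam : ℝ) (hs0 : 0 < s)
    (hs1 : s < 1) (hγ : 0 ≤ γ + 2 * s) (hα0 : 0 < α) (hα : α ≤ min 1 (2 * s))
    (hq : (d : ℝ) + γ + 2 * s < q) (hr : 0 < r) (hr1 : r ≤ 1) :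
    ∃ C : ℝ, 0 ≤ C ∧ ∀ (lam : ℝ) (b : ℝ → ℝ), IsNonCutoff d s γ lam Lam b →
      ∀ (τ T A A' : ℝ) (f g : Pt d → ℝ), r ^ (2 * s) ≤ T - τ → 0 ≤ A → 0 ≤ A' →
      weightedSeminorm s 0 q τ T f < ENNReal.ofReal A →
      weightedNorm s (2 * s + α) q τ T g < ENNReal.ofReal A' →
      ∀ z : Pt d, τ < z.1 → z.1 ≤ T → Continuous (fun u => f (z.1, z.2.1, u)) →
        Continuous (fun u => g (z.1, z.2.1, u)) →
        Q₁WellDefined γ b f g z ∧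
        Integrable (fun a => secondDiff (fun u => g (z.1, z.2.1, u)) z.2.2 a
          * planeOp γ b (fun w => f (z.1, z.2.1, z.2.2 + w)) a) ∧
        Q₁ γ b f g z = (1 / 2) * ∫ a, secondDiff (fun u => g (z.1, z.2.1, u)) z.2.2 a
          * planeOp γ b (fun w => f (z.1, z.2.1, z.2.2 + w)) a ∧
        |Q₁ γ b f g z| ≤ C * A * A' * (1 + ‖z.2.2‖) ^ (-(q - γ - 2 * s)) := by
  have hd0 : (0 : ℝ) ≤ d := by positivity
  have hq0 : 0 ≤ q := by linarith
  obtain ⟨CK, hCK, hK⟩ := exists_planeOp_le hd Lam hγ (le_refl (0 : ℝ)) (q := q) (by linarith)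
  obtain ⟨CE, hCE, hE⟩ := exists_secondDiff_bounds (d := d) hs0 hs1 hα0 hα hq0 hr hr1 (r₁ := r / 2)
    (by positivity) (by linarith)
  have hgain := gainExponent_pos hs0 hs1 hα0
  have hI := fun r₁ : ℝ => fun h : 0 < r₁ => exists_lintegral_collision_le hd (s := s) (q := q)
    (m := γ + 2 * s + 1 + 0) (κ := 0) (r₁ := r₁) (by linarith) (by linarith) le_rfl (by linarith)
    hgain h
  obtain ⟨CI, hCI, hI0⟩ := hI (r / 2) (by positivity)
  refine ⟨CI * CK * CE, by positivity, ?_⟩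
  intro lam b hb τ T A A' f g hrT hA hA' hf hg z h1 h2 hfc hgc
  set F : Vel d → ℝ := fun w => f (z.1, z.2.1, z.2.2 + w)
  set φ : Vel d → ℝ := fun u => g (z.1, z.2.1, u)
  have hFm : Measurable F := (hfc.comp (continuous_const.add continuous_id)).measurable
  have hFb : ∀ w, |F w| ≤ A * ((1 + ‖z.2.2 + w‖) ^ (-q) * (1 + ‖w‖) ^ (0 : ℝ)) := by
    intro w
    rw [Real.rpow_zero, mul_one]
    exact abs_le_of_weightedSeminorm_lt hs0 hf hr hr1 hrT (y := (z.1, z.2.1, z.2.2 + w)) h1 h2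
  have hKF := hK lam b hb F z.2.2 A hFm hA hFb
  have hKm := measurable_planeOp hd γ hb.measurable hFm
  have hφs : ∀ u, |φ u| ≤ A' * (1 + ‖u‖) ^ (-q) := fun u =>
    abs_le_of_weightedSeminorm_lt hs0 (lt_of_le_of_lt le_self_add hg) hr hr1 hrT
      (y := (z.1, z.2.1, u)) h1 h2
  have hlin := hI0 z.2.2 (r / 2) (CE * A') (CK * A) (secondDiff φ z.2.2) (planeOp γ b F)
    (by positivity) le_rfl (by positivity) (by positivity) (fun a ha => (hKF a ha).2)
    (fun a => (hE τ T A' g hrT hA' hg z h1 h2 a).1)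
    (fun a => (hE τ T A' g hrT hA' hg z h1 h2 a).2.1)
    (fun a => (hE τ T A' g hrT hA' hg z h1 h2 a).2.2)
  have hint : Integrable (fun a => secondDiff φ z.2.2 a * planeOp γ b F a) :=
    integrable_of_lintegral_ofReal_abs_le
      ((measurable_secondDiff hgc z.2.2).aestronglyMeasurable.mul hKm.aestronglyMeasurable) hlin
  -- away from the diagonal the first difference is integrable against the kernel
  have htr : ∀ ε : ℝ, 0 < ε → IntegrableOn (fun a => (g (z.1, z.2.1, z.2.2 + a) - g z)
      * planeOp γ b F a) {a : Vel d | ε < ‖a‖} := by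
    intro ε hε
    obtain ⟨Cε, -, hIε⟩ := hI ε hε
    have m2 : MeasurableSet {a : Vel d | ε < ‖a‖} := measurableSet_lt measurable_const (by fun_prop)
    rw [← integrable_indicator_iff m2]
    set D : Vel d → ℝ := {a : Vel d | ε < ‖a‖}.indicator fun a => φ (z.2.2 + a) - φ z.2.2
    have hD0 : ∀ a, ‖a‖ ≤ ε → D a = 0 := fun a ha =>
      indicator_of_notMem (by simpa using ha) _
    have hDm : Measurable D := (Continuous.measurable (by fun_prop)).indicator m2
    have hlinε := hIε z.2.2 ε A' (CK * A) D (planeOp γ b F) hε le_rfl hA' (by positivity)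
      (fun a ha => (hKF a ha).2)
      (fun a ha => by rw [hD0 a ha.le, abs_zero]; positivity)
      (fun a _ ha => by rw [hD0 a ha, abs_zero]; positivity)
      (fun a ha => by
        have e : D a = φ (z.2.2 + a) - φ z.2.2 := indicator_of_mem (by exact ha) _
        rw [e, Real.rpow_zero, one_mul]
        refine (abs_sub _ _).trans ((add_le_add (hφs _) (hφs _)).trans ?_)
        have : 0 ≤ A' * (1 + ‖z.2.2 - a‖) ^ (-q) := by positivity
        linarith)
    refine (integrable_of_lintegral_ofReal_abs_le
      (hDm.aestronglyMeasurable.mul hKm.aestronglyMeasurable) hlinε).congr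
      (Eventually.of_forall fun a => ?_)
    by_cases ha : ε < ‖a‖ <;> simp [D, indicator, ha, φ]
  obtain ⟨ht, heq⟩ := Q₁_principal_value htr hint
  refine ⟨⟨?_, fun ε hε => integrableOn_collisionIntegrand (htr ε hε), ht⟩, hint, heq, ?_⟩
  · intro v' hv'
    exact (hKF (v' - z.2.2) (sub_ne_zero.mpr hv')).1
  · rw [heq, abs_mul, abs_of_pos (by norm_num : (0 : ℝ) < 1 / 2)]
    have hb := abs_integral_le_of_lintegral (by positivity) hlin
    rw [show γ + 2 * s + 1 + 0 - 1 - q + 0 = -(q - γ - 2 * s) by ring] at hb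
    have h0 := abs_nonneg (∫ a, secondDiff φ z.2.2 a * planeOp γ b F a)
    linarith

/-! ### Hölder continuity of the collision operator -/

theorem one_add_rpow_le_of_lt {x r₁ κ : ℝ} (hr₁ : 0 < r₁) (hκ : 0 ≤ κ) (hx : r₁ < x) :
    (1 + x) ^ κ ≤ (1 + 1 / r₁) ^ κ * x ^ κ ∧ 1 ≤ (1 + 1 / r₁) ^ κ * x ^ κ := by
  have hx0 : 0 < x := hr₁.trans hx
  have h : 1 + x ≤ (1 + 1 / r₁) * x := by
    have : 1 ≤ 1 / r₁ * x := by rw [one_div_mul_eq_div, one_le_div hr₁]; exact hx.le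
    linarith
  have h1 : (1 + x) ^ κ ≤ (1 + 1 / r₁) ^ κ * x ^ κ := by
    rw [← Real.mul_rpow (by positivity) hx0.le]
    exact Real.rpow_le_rpow (by positivity) h hκ
  exact ⟨h1, (Real.one_le_rpow (by linarith) hκ).trans h1⟩

/-- Away from the diagonal the difference of the second differences is controlled by the Hölder
continuity of order `α` alone. The shear at the velocity `v ± a` costs the factor `‖a‖^{α/(1+2s)}`. -/
theorem KineticHolder.secondDiff_sub_le {d : ℕ} {s α q τ T C ρ R r₁ : ℝ} {g : Pt d → ℝ}
    (hg : KineticHolder s α q τ T C g) (hC : 0 ≤ C) (hs : 0 < s) (hα : 0 < α) (hρ : 0 < ρ)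
    (hρR : ρ ≤ R) (hρ1 : ρ ≤ 1) (hρeq : ρ ^ (2 * s) = R ^ (1 + 2 * s)) {z₁ z₂ : Pt d}
    (h1 : τ < z₁.1) (h1' : z₁.1 ≤ T) (h2 : τ < z₂.1) (h2' : z₂.1 ≤ T) (h : KNear s ρ z₁ z₂)
    (hr₁ : 0 < r₁) {a : Vel d} (ha : r₁ < ‖a‖) :
    |secondDiff (fun u => g (z₁.1, z₁.2.1, u)) z₁.2.2 a
        - secondDiff (fun u => g (z₂.1, z₂.2.1, u)) z₂.2.2 a|
      ≤ 2 * (1 + 1 / r₁) ^ (α / (1 + 2 * s)) * C * R ^ α * (‖a‖ ^ (α / (1 + 2 * s))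
        * ((1 + ‖z₁.2.2‖) ^ (-q) + (1 + ‖z₁.2.2 + a‖) ^ (-q) + (1 + ‖z₁.2.2 - a‖) ^ (-q))) := by
  have hR : 0 < R := hρ.trans_le hρR
  have key := hg.shift hs hρ hρR hρ1 hρeq h1 h1' h2 h2' h
  have k1 := key a
  have k2 := key (-a)
  have k0 := key 0
  rw [norm_neg, ← sub_eq_add_neg, ← sub_eq_add_neg] at k2
  rw [norm_zero, add_zero, add_zero, add_zero, Real.one_rpow, mul_one] at k0
  obtain ⟨w1, w0⟩ := one_add_rpow_le_of_lt hr₁ (κ := α / (1 + 2 * s)) (by positivity) ha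
  set W := (1 + 1 / r₁) ^ (α / (1 + 2 * s)) * ‖a‖ ^ (α / (1 + 2 * s))
  set Y := (1 + ‖z₁.2.2‖) ^ (-q)
  set Y1 := (1 + ‖z₁.2.2 + a‖) ^ (-q)
  set Y2 := (1 + ‖z₁.2.2 - a‖) ^ (-q)
  have hY : 0 ≤ Y := by positivity
  have hY1 : 0 ≤ Y1 := by positivity
  have hY2 : 0 ≤ Y2 := by positivity
  have hD : 0 ≤ C * R ^ α := by positivity
  have hW : 0 ≤ W := zero_le_one.trans w0
  have l1 := k1.trans (mul_le_mul_of_nonneg_left (mul_le_mul_of_nonneg_left w1 hY1) hD)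
  have l2 := k2.trans (mul_le_mul_of_nonneg_left (mul_le_mul_of_nonneg_left w1 hY2) hD)
  have l0 := k0.trans (mul_le_mul_of_nonneg_left (le_mul_of_one_le_right hY w0) hD)
  have e : 2 * (1 + 1 / r₁) ^ (α / (1 + 2 * s)) * C * R ^ α * (‖a‖ ^ (α / (1 + 2 * s))
        * (Y + Y1 + Y2)) = 2 * (C * R ^ α * (Y * W)) + 2 * (C * R ^ α * (Y1 * W))
        + 2 * (C * R ^ α * (Y2 * W)) := by simp only [W]; ring
  rw [e]
  have n1 : 0 ≤ C * R ^ α * (Y1 * W) := by positivity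
  have n2 : 0 ≤ C * R ^ α * (Y2 * W) := by positivity
  unfold secondDiff
  have b1 := abs_le.mp l1
  have b2 := abs_le.mp l2
  have b0 := abs_le.mp l0
  rw [abs_le]
  constructor <;> linarith [b1.1, b1.2, b2.1, b2.2, b0.1, b0.2]

/-- The collision operator is Hölder continuous of order `2sα/(1+2s)`. With
`E_i` the second differences of `g` and `K_i` the kernels at `z_i`, the difference is the integral
of `E₁ (K₁ - K₂) + (E₁ - E₂) K₂`; each part is estimated at the scale `R = ρ^{2s/(1+2s)}`, for which
the shear `ρ^{2s}` of the positions is of size `R^{1+2s}`. -/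
theorem exists_Q₁_holder {d : ℕ} (hd : 2 ≤ d) {s γ α q r : ℝ} (Lam : ℝ) (hs0 : 0 < s)
    (hs1 : s < 1) (hγ : 0 ≤ γ + 2 * s) (hα0 : 0 < α) (hα : α ≤ min 1 (2 * s))
    (hq : (d : ℝ) + γ + 2 * s + α / (1 + 2 * s) < q) (hr : 0 < r) (hr1 : r ≤ 1) :
    ∃ C : ℝ, 0 ≤ C ∧ ∀ (lam : ℝ) (b : ℝ → ℝ), IsNonCutoff d s γ lam Lam b →
      ∀ (τ T A A' : ℝ) (f g : Pt d → ℝ), r ^ (2 * s) ≤ T - τ → 0 ≤ A → 0 ≤ A' →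
      weightedNorm s α q τ T f < ENNReal.ofReal A →
      weightedNorm s (2 * s + α) q τ T g < ENNReal.ofReal A' →
      (∀ t x, τ < t → t ≤ T → Continuous (fun u => f (t, x, u))) →
      (∀ t x, τ < t → t ≤ T → Continuous (fun u => g (t, x, u))) →
      KineticHolder s (2 * s * α / (1 + 2 * s)) (q - γ - 2 * s - α / (1 + 2 * s)) τ T
        (C * A * A') (Q₁ γ b f g) := by
  set κ := α / (1 + 2 * s) with hκdef
  have hκ : 0 < κ := by positivity
  have hα2 : α ≤ 2 * s := hα.trans (min_le_right _ _)
  have hκs : κ < 2 * s := by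
    rw [hκdef, div_lt_iff₀ (by positivity)]
    nlinarith
  have hd0 : (0 : ℝ) ≤ d := by positivity
  have hq0 : 0 ≤ q := by linarith
  set r₁ := r / 16 with hr₁def
  have hr₁ : 0 < r₁ := by positivity
  have hgain := gainExponent_pos hs0 hs1 hα0
  obtain ⟨Cp, hCp, hP⟩ := exists_Q₁_pointwise hd Lam hs0 hs1 hγ hα0 hα (q := q) (by linarith) hr hr1
  obtain ⟨CK0, hCK0, hK0⟩ := exists_planeOp_le hd Lam hγ (le_refl (0 : ℝ)) (q := q) (by linarith)
  obtain ⟨CK1, hCK1, hK1⟩ := exists_planeOp_le hd Lam hγ hκ.le (q := q) (by linarith)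
  obtain ⟨CE, hCE, hE⟩ := exists_secondDiff_bounds (d := d) hs0 hs1 hα0 hα hq0 hr hr1 hr₁
    (by linarith)
  obtain ⟨CD, hCD, hD⟩ := exists_secondDiff_sub_le (d := d) (c := gainExponent s α) hs0 hs1 hα0 hα
    hq0 hr hr1 ((min_le_left _ _).trans (min_le_left _ _))
    ((min_le_left _ _).trans (min_le_right _ _)) ((min_le_right _ _).trans (min_le_left _ _))
    ((min_le_right _ _).trans (min_le_right _ _)) hgain
  obtain ⟨Cf, hCf, hF⟩ := exists_holder_of_weightedNorm_lt (d := d) hs0 hα0 hα hq0 hr hr1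
  obtain ⟨Cg, hCg, hG⟩ := exists_holder_of_weightedNorm_lt_of_high_order (d := d) hs0 hs1 hα0 hα hq0
    hr hr1
  obtain ⟨CI1, hCI1, hI1⟩ := exists_lintegral_collision_le hd (s := s) (q := q)
    (m := γ + 2 * s + 1 + κ) (κ := 0) (r₁ := r₁) (by linarith) (by linarith) le_rfl (by linarith)
    hgain hr₁
  obtain ⟨CI2, hCI2, hI2⟩ := exists_lintegral_collision_le hd (s := s) (q := q)
    (m := γ + 2 * s + 1 + 0) (κ := κ) (r₁ := r₁) (by linarith) (by linarith) hκ.le hκs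
    hgain hr₁
  set CE2 := CD + 2 * (1 + 1 / r₁) ^ κ * Cg with hCE2def
  have hCE2 : 0 ≤ CE2 := by positivity
  set q' := q - γ - 2 * s - κ with hq'def
  have hq' : 0 ≤ q' := by linarith
  set Cn := CI1 * (CK1 * Cf) * CE + CI2 * (CK0 * 2 ^ q) * CE2 with hCn
  set Cr := Cp * (1 + 2 ^ q') * r₁ ^ (-α) with hCr
  have hCn0 : 0 ≤ Cn := by positivity
  have hCr0 : 0 ≤ Cr := by positivity
  refine ⟨Cn + Cr, by positivity, ?_⟩
  intro lam b hb τ T A A' f g hrT hA hA' hf hg hfc hgc z₁ z₂ ρ hρ h1 h1' h2 h2' hn hv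
  have hf0 : weightedSeminorm s 0 q τ T f < ENNReal.ofReal A := lt_of_le_of_lt le_self_add hf
  obtain ⟨-, i1, e1, p1⟩ := hP lam b hb τ T A A' f g hrT hA hA' hf0 hg z₁ h1 h1' (hfc _ _ h1 h1')
    (hgc _ _ h1 h1')
  obtain ⟨-, i2, e2, p2⟩ := hP lam b hb τ T A A' f g hrT hA hA' hf0 hg z₂ h2 h2' (hfc _ _ h2 h2')
    (hgc _ _ h2 h2')
  set R := ρ ^ (2 * s / (1 + 2 * s)) with hRdef
  have hR : 0 < R := by positivity
  have hRα : ρ ^ (2 * s * α / (1 + 2 * s)) = R ^ α := by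
    rw [hRdef, ← Real.rpow_mul hρ.le]; congr 1; ring
  rw [hRα]
  set Y := (1 + ‖z₁.2.2‖) ^ (-q') with hYdef
  have hY : 0 < Y := by positivity
  rcases le_or_gt R r₁ with hRr | hRr
  · have hR1 : R ≤ 1 := by linarith
    have hρ1 : ρ ≤ 1 := by
      by_contra hcon
      exact absurd hR1 (not_le.mpr (Real.one_lt_rpow (not_le.mp hcon) (by positivity)))
    have hρR : ρ ≤ R := by
      have := Real.rpow_le_rpow_of_exponent_ge hρ hρ1
        (show 2 * s / (1 + 2 * s) ≤ 1 by rw [div_le_one (by positivity)]; linarith)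
      rwa [Real.rpow_one] at this
    have hρeq : ρ ^ (2 * s) = R ^ (1 + 2 * s) := by
      rw [hRdef, ← Real.rpow_mul hρ.le, div_mul_cancel₀ _ (by positivity)]
    set F₁ : Vel d → ℝ := fun w => f (z₁.1, z₁.2.1, z₁.2.2 + w)
    set F₂ : Vel d → ℝ := fun w => f (z₂.1, z₂.2.1, z₂.2.2 + w)
    set E₁ := secondDiff (fun u => g (z₁.1, z₁.2.1, u)) z₁.2.2
    set E₂ := secondDiff (fun u => g (z₂.1, z₂.2.1, u)) z₂.2.2
    have hF₁m : Measurable F₁ :=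
      ((hfc _ _ h1 h1').comp (continuous_const.add continuous_id)).measurable
    have hF₂m : Measurable F₂ :=
      ((hfc _ _ h2 h2').comp (continuous_const.add continuous_id)).measurable
    have hE₁m : Measurable E₁ := measurable_secondDiff (hgc _ _ h1 h1') _
    have hE₂m : Measurable E₂ := measurable_secondDiff (hgc _ _ h2 h2') _
    have hF₁b : ∀ w, |F₁ w| ≤ A * ((1 + ‖z₁.2.2 + w‖) ^ (-q) * (1 + ‖w‖) ^ (0 : ℝ)) := by
      intro w
      rw [Real.rpow_zero, mul_one]
      exact abs_le_of_weightedSeminorm_lt hs0 hf0 hr hr1 hrT (y := (z₁.1, z₁.2.1, z₁.2.2 + w)) h1 h1'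
    have hF₂b : ∀ w, |F₂ w| ≤ 2 ^ q * A * ((1 + ‖z₁.2.2 + w‖) ^ (-q) * (1 + ‖w‖) ^ (0 : ℝ)) := by
      intro w
      rw [Real.rpow_zero, mul_one]
      have l1 := abs_le_of_weightedSeminorm_lt hs0 hf0 hr hr1 hrT
        (y := (z₂.1, z₂.2.1, z₂.2.2 + w)) h2 h2'
      have l2 := one_add_norm_rpow_neg_le hq0 (u := z₂.2.2 + w) (v := z₁.2.2 + w)
        (by rw [add_sub_add_right_eq_sub]; exact hv)
      exact (l1.trans (mul_le_mul_of_nonneg_left l2 hA)).trans_eq (by ring)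
    have hFb : ∀ w, |F₁ w - F₂ w|
        ≤ Cf * A * R ^ α * ((1 + ‖z₁.2.2 + w‖) ^ (-q) * (1 + ‖w‖) ^ κ) :=
      (hF τ T A f hrT hA hf).shift hs0 hρ hρR hρ1 hρeq h1 h1' h2 h2' hn
    have hKF₁ := hK0 lam b hb F₁ z₁.2.2 A hF₁m hA hF₁b
    have hKF₂ := hK0 lam b hb F₂ z₁.2.2 (2 ^ q * A) hF₂m (by positivity) hF₂b
    have hKF := hK1 lam b hb (fun w => F₁ w - F₂ w) z₁.2.2 (Cf * A * R ^ α) (hF₁m.sub hF₂m)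
      (by positivity) hFb
    have l1 := hI1 z₁.2.2 r₁ (CE * A') (CK1 * (Cf * A * R ^ α)) E₁
      (planeOp γ b (fun w => F₁ w - F₂ w)) hr₁ le_rfl (by positivity) (by positivity)
      (fun a ha => (hKF a ha).2)
      (fun a => (hE τ T A' g hrT hA' hg z₁ h1 h1' a).1)
      (fun a => (hE τ T A' g hrT hA' hg z₁ h1 h1' a).2.1)
      (fun a => (hE τ T A' g hrT hA' hg z₁ h1 h1' a).2.2)
    have hDD := hD τ T A' g hrT hA' hg z₁ z₂ ρ R hρ hRr hRdef h1 h1' h2 h2' hn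
    have hmono : ∀ X : ℝ, 0 ≤ X → CD * A' * R ^ α * X ≤ CE2 * A' * R ^ α * X := by
      intro X hX
      have : CD ≤ CE2 := le_add_of_nonneg_right (by positivity)
      gcongr
    have l2 := hI2 z₁.2.2 R (CE2 * A' * R ^ α) (CK0 * (2 ^ q * A)) (fun a => E₁ a - E₂ a)
      (planeOp γ b F₂) hR hRr (by positivity) (by positivity)
      (fun a ha => (hKF₂ a ha).2)
      (fun a ha => ((hDD a).1 ha).trans (hmono _ (by positivity)))
      (fun a ha ha' => ((hDD a).2 ha ha').trans (hmono _ (by positivity)))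
      (fun a ha => by
        refine ((hG τ T A' g hrT hA' hg).secondDiff_sub_le (by positivity) hs0 hα0 hρ hρR hρ1 hρeq
          h1 h1' h2 h2' hn hr₁ ha).trans ?_
        have hle : 2 * (1 + 1 / r₁) ^ κ * (Cg * A') * R ^ α ≤ CE2 * A' * R ^ α := by
          have : 0 ≤ CD * A' * R ^ α := by positivity
          rw [hCE2def]
          linarith
        exact mul_le_mul_of_nonneg_right hle (by positivity))
    have n1 : Integrable (fun a => E₁ a * planeOp γ b (fun w => F₁ w - F₂ w) a) :=
      integrable_of_lintegral_ofReal_abs_le (hE₁m.aestronglyMeasurable.mul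
        (measurable_planeOp hd γ hb.measurable (hF₁m.sub hF₂m)).aestronglyMeasurable) l1
    have n2 : Integrable (fun a => (E₁ a - E₂ a) * planeOp γ b F₂ a) :=
      integrable_of_lintegral_ofReal_abs_le ((hE₁m.sub hE₂m).aestronglyMeasurable.mul
        (measurable_planeOp hd γ hb.measurable hF₂m).aestronglyMeasurable) l2
    -- at `a = 0` the kernel vanishes by the convention `x / 0 = 0`
    have hsplit : ∀ a, E₁ a * planeOp γ b F₁ a - E₂ a * planeOp γ b F₂ a
        = E₁ a * planeOp γ b (fun w => F₁ w - F₂ w) a + (E₁ a - E₂ a) * planeOp γ b F₂ a := by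
      intro a
      rcases eq_or_ne a 0 with rfl | ha
      · simp [planeOp]
      · rw [planeOp_sub γ b F₁ F₂ a (hKF₁ a ha).1 (hKF₂ a ha).1]
        ring
    have hdiff : Q₁ γ b f g z₁ - Q₁ γ b f g z₂
        = (1 / 2) * ((∫ a, E₁ a * planeOp γ b (fun w => F₁ w - F₂ w) a)
          + ∫ a, (E₁ a - E₂ a) * planeOp γ b F₂ a) := by
      rw [e1, e2, ← mul_sub, ← integral_sub i1 i2, ← integral_add n1 n2]
      simp only [← hsplit]
    have b1 := abs_le.mp (abs_integral_le_of_lintegral (by positivity) l1)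
    have b2 := abs_le.mp (abs_integral_le_of_lintegral (by positivity) l2)
    rw [show γ + 2 * s + 1 + κ - 1 - q + 0 = -q' by rw [hq'def]; ring] at b1
    rw [show γ + 2 * s + 1 + 0 - 1 - q + κ = -q' by rw [hq'def]; ring] at b2
    have c1 : CI1 * (CK1 * (Cf * A * R ^ α)) * (CE * A') * Y
        + CI2 * (CK0 * (2 ^ q * A)) * (CE2 * A' * R ^ α) * Y = Cn * A * A' * Y * R ^ α := by
      rw [hCn]; ring
    have c2 : 0 ≤ Cr * A * A' * Y * R ^ α := by positivity
    have c3 : 0 ≤ Cn * A * A' * Y * R ^ α := by positivity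
    have c4 : (Cn + Cr) * A * A' * Y * R ^ α = Cn * A * A' * Y * R ^ α
      + Cr * A * A' * Y * R ^ α := by ring
    rw [hdiff, abs_le, c4]
    constructor <;> linarith [b1.1, b1.2, b2.1, b2.2]
  · have hdecay : ∀ v : Vel d, (1 + ‖v‖) ^ (-(q - γ - 2 * s)) ≤ (1 + ‖v‖) ^ (-q') := fun v =>
      Real.rpow_le_rpow_of_exponent_le (by linarith [norm_nonneg v]) (by linarith)
    have b1 := p1.trans (mul_le_mul_of_nonneg_left (hdecay z₁.2.2) (by positivity))
    have b2 := p2.trans (mul_le_mul_of_nonneg_left ((hdecay z₂.2.2).trans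
      (one_add_norm_rpow_neg_le hq' hv)) (by positivity))
    have b4 : 1 ≤ r₁ ^ (-α) * R ^ α := by
      rw [Real.rpow_neg hr₁.le, inv_mul_eq_div, one_le_div (by positivity)]
      exact Real.rpow_le_rpow hr₁.le hRr.le hα0.le
    calc |Q₁ γ b f g z₁ - Q₁ γ b f g z₂| ≤ |Q₁ γ b f g z₁| + |Q₁ γ b f g z₂| := abs_sub _ _
      _ ≤ Cp * A * A' * Y + Cp * A * A' * (2 ^ q' * Y) := add_le_add b1 b2
      _ = Cp * (1 + 2 ^ q') * A * A' * Y * 1 := by ring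
      _ ≤ Cp * (1 + 2 ^ q') * A * A' * Y * (r₁ ^ (-α) * R ^ α) := by gcongr
      _ = Cr * A * A' * Y * R ^ α := by rw [hCr]; ring
      _ ≤ (Cn + Cr) * A * A' * Y * R ^ α := by gcongr; linarith

/-! ### Weighted norms from pointwise estimates -/

/-- A bound for the weighted seminorm from expansions on all cylinders inside the slab. -/
theorem weightedSeminorm_le {d : ℕ} {s β q τ T D : ℝ} {h : Pt d → ℝ} (hD : 0 ≤ D)
    (hh : ∀ (z : Pt d) (r : ℝ), 0 < r → r ≤ 1 → cylinder s r z ⊆ slab d τ T →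
      ∀ y₀ ∈ cylinder s r z, ∃ p : MvPolynomial (Var d) ℝ, KDegLT s β p ∧
        ∀ y ∈ cylinder s r z, |h y - MvPolynomial.eval (coords y) p|
          ≤ D * (1 + ‖z.2.2‖) ^ (-q) * kdist s y y₀ ^ β) :
    weightedSeminorm s β q τ T h ≤ ENNReal.ofReal D := by
  refine iSup_le fun z => iSup_le fun r => iSup_le fun hr => ?_
  have hY : 0 < (1 + ‖z.2.2‖) ^ q := by positivity
  have hb : HolderBound s β h (cylinder s r z) (D * (1 + ‖z.2.2‖) ^ (-q)).toNNReal := by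
    intro y₀ hy₀
    rw [Real.coe_toNNReal _ (by positivity)]
    exact hh z r hr.1 hr.2.1 hr.2.2 y₀ hy₀
  have hs : holderSeminorm s β h (cylinder s r z) ≤ ENNReal.ofReal (D * (1 + ‖z.2.2‖) ^ (-q)) :=
    iInf₂_le _ hb
  refine (mul_le_mul_right hs _).trans_eq ?_
  rw [← ENNReal.ofReal_mul hY.le]
  congr 1
  rw [Real.rpow_neg (by positivity)]
  field_simp

theorem norm_sub_center_le_one {d : ℕ} {s r : ℝ} (hr1 : r ≤ 1) {z y : Pt d}
    (hy : y ∈ cylinder s r z) : ‖z.2.2 - y.2.2‖ ≤ 1 := by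
  rw [norm_sub_rev]
  exact hy.2.2.2.le.trans hr1

theorem weightedSeminorm_zero_le {d : ℕ} {s q τ T B : ℝ} {h : Pt d → ℝ} (hq : 0 ≤ q) (hB : 0 ≤ B)
    (hh : ∀ y : Pt d, τ < y.1 → y.1 ≤ T → |h y| ≤ B * (1 + ‖y.2.2‖) ^ (-q)) :
    weightedSeminorm s 0 q τ T h ≤ ENNReal.ofReal (2 ^ q * B) := by
  refine weightedSeminorm_le (by positivity) fun z r hr hr1 hsub y₀ _ => ⟨0, ?_, fun y hy => ?_⟩
  · intro m hm
    simp at hm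
  · obtain ⟨t1, t2⟩ := lt_time_of_mem_cylinder hr hsub hy
    rw [map_zero, sub_zero, Real.rpow_zero, mul_one]
    refine (hh y t1 t2).trans ((mul_le_mul_of_nonneg_left
      (one_add_norm_rpow_neg_le hq (norm_sub_center_le_one hr1 hy)) hB).trans_eq (by ring))

theorem kDegLT_C {d : ℕ} {s β : ℝ} (hβ : 0 < β) (c : ℝ) :
    KDegLT s β (MvPolynomial.C c : MvPolynomial (Var d) ℝ) := by
  intro m hm
  have hm0 : m = 0 := by
    rw [MvPolynomial.mem_support_iff, MvPolynomial.coeff_C] at hm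
    by_contra hne
    exact hm (if_neg (Ne.symm hne))
  simpa [hm0, monomialDegree] using hβ

/-- For points at kinetic distance less than `1/2` the Hölder estimate applies; for larger distances
the decay of the function suffices. -/
theorem KineticHolder.weightedSeminorm_le {d : ℕ} {s β q τ T B C : ℝ} {h : Pt d → ℝ} (hs : 0 < s)
    (hβ : 0 < β) (hq : 0 ≤ q) (hB : 0 ≤ B) (hC : 0 ≤ C)
    (hb : ∀ y : Pt d, τ < y.1 → y.1 ≤ T → |h y| ≤ B * (1 + ‖y.2.2‖) ^ (-q))
    (hh : KineticHolder s β q τ T C h) :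
    weightedSeminorm s β q τ T h ≤ ENNReal.ofReal (2 ^ q * 2 ^ β * (C + 2 * B)) := by
  refine KineticBoltzmann.weightedSeminorm_le (by positivity)
    fun z r hr hr1 hsub y₀ hy₀ => ⟨MvPolynomial.C (h y₀), kDegLT_C hβ _, fun y hy => ?_⟩
  rw [MvPolynomial.eval_C]
  obtain ⟨t1, t2⟩ := lt_time_of_mem_cylinder hr hsub hy
  obtain ⟨t1', t2'⟩ := lt_time_of_mem_cylinder hr hsub hy₀
  have w := one_add_norm_rpow_neg_le hq (norm_sub_center_le_one hr1 hy)
  have w' := one_add_norm_rpow_neg_le hq (norm_sub_center_le_one hr1 hy₀)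
  set Y := (1 + ‖z.2.2‖) ^ (-q)
  have hY : 0 < Y := by positivity
  have hk := kdist_nonneg s y y₀
  rcases lt_or_ge (kdist s y y₀) (1 / 2) with hlt | hge
  · have key : ∀ ρ, kdist s y y₀ < ρ → ρ < 1 / 2 →
        |h y - h y₀| ≤ 2 ^ q * 2 ^ β * C * Y * ρ ^ β := by
      intro ρ h1 h2
      have hρ : 0 < ρ := hk.trans_lt h1
      have hn := KNear.of_kdist_lt hs hρ h1
      refine (hh y y₀ (2 * ρ) (by positivity) t1 t2 t1' t2' hn (by linarith [hn.vel])).trans ?_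
      rw [Real.mul_rpow (by norm_num) hρ.le]
      calc _ ≤ C * (2 ^ q * Y) * (2 ^ β * ρ ^ β) := by gcongr
        _ = _ := by ring
    have hlim : Tendsto (fun ρ : ℝ => 2 ^ q * 2 ^ β * C * Y * ρ ^ β) (𝓝[>] (kdist s y y₀))
        (𝓝 (2 ^ q * 2 ^ β * C * Y * kdist s y y₀ ^ β)) :=
      (((Real.continuous_rpow_const hβ.le).tendsto _).const_mul _).mono_left nhdsWithin_le_nhds
    have hle : |h y - h y₀| ≤ 2 ^ q * 2 ^ β * C * Y * kdist s y y₀ ^ β := by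
      refine ge_of_tendsto hlim ?_
      filter_upwards [Ioo_mem_nhdsGT hlt] with ρ hρ using key ρ hρ.1 hρ.2
    have : 0 ≤ 2 ^ q * 2 ^ β * (2 * B) * Y * kdist s y y₀ ^ β := by positivity
    linarith
  · have hpow : 1 ≤ 2 ^ β * kdist s y y₀ ^ β := by
      rw [← Real.mul_rpow (by norm_num) hk]
      exact Real.one_le_rpow (by linarith) hβ.le
    have b1 := (hb y t1 t2).trans (mul_le_mul_of_nonneg_left w hB)
    have b2 := (hb y₀ t1' t2').trans (mul_le_mul_of_nonneg_left w' hB)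
    calc |h y - h y₀| ≤ |h y| + |h y₀| := abs_sub _ _
      _ ≤ 2 ^ q * (2 * B) * Y * 1 := by linarith
      _ ≤ 2 ^ q * (2 * B) * Y * (2 ^ β * kdist s y y₀ ^ β) := by gcongr
      _ ≤ 2 ^ q * (C + 2 * B) * Y * (2 ^ β * kdist s y y₀ ^ β) := by gcongr; linarith
      _ = _ := by ring

theorem KineticHolder.continuousOn {d : ℕ} {s β q τ T C : ℝ} {h : Pt d → ℝ}
    (hβ : 0 < β) (hh : KineticHolder s β q τ T C h) :
    ContinuousOn h {y | τ < y.1 ∧ y.1 ≤ T} := by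
  intro y₀ hy₀
  rw [ContinuousWithinAt, Metric.tendsto_nhds]
  intro ε hε
  have hlim : Tendsto (fun ρ : ℝ => C * (1 + ‖y₀.2.2‖) ^ (-q) * ρ ^ β) (𝓝[>] 0) (𝓝 0) := by
    have := (((Real.continuous_rpow_const hβ.le).tendsto 0).const_mul
      (C * (1 + ‖y₀.2.2‖) ^ (-q))).mono_left (nhdsWithin_le_nhds (s := Ioi 0))
    rwa [Real.zero_rpow hβ.ne', mul_zero] at this
  obtain ⟨ρ, hρε, hρ, hρ1⟩ := ((hlim.eventually (gt_mem_nhds hε)).and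
    (Ioo_mem_nhdsGT (zero_lt_one (α := ℝ)))).exists
  have n1 : ∀ᶠ y : Pt d in 𝓝 y₀, |y₀.1 - y.1| < ρ ^ (2 * s) := by
    refine Tendsto.eventually_lt_const (v := |y₀.1 - y₀.1|) (by simp; positivity)
      (Continuous.tendsto (by fun_prop) _)
  have n2 : ∀ᶠ y : Pt d in 𝓝 y₀,
      ‖y₀.2.1 - y.2.1 - (y₀.1 - y.1) • y₀.2.2‖ < ρ ^ (1 + 2 * s) := by
    refine Tendsto.eventually_lt_const (v := ‖y₀.2.1 - y₀.2.1 - (y₀.1 - y₀.1) • y₀.2.2‖)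
      (by simp; positivity) (Continuous.tendsto (by fun_prop) _)
  have n3 : ∀ᶠ y : Pt d in 𝓝 y₀, ‖y₀.2.2 - y.2.2‖ < ρ := by
    refine Tendsto.eventually_lt_const (v := ‖y₀.2.2 - y₀.2.2‖) (by simpa using hρ)
      (Continuous.tendsto (by fun_prop) _)
  filter_upwards [nhdsWithin_le_nhds n1, nhdsWithin_le_nhds n2, nhdsWithin_le_nhds n3,
    self_mem_nhdsWithin] with y k1 k2 k3 hy
  rw [dist_comm, Real.dist_eq]
  exact (hh y₀ y ρ hρ hy₀.1 hy₀.2 hy.1 hy.2 ⟨k1.le, k2.le, k3.le⟩ (k3.le.trans hρ1.le)).trans_lt hρε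

theorem weightedSeminorm_mono {d : ℕ} {s β q q' τ T : ℝ} (h : q ≤ q') (f : Pt d → ℝ) :
    weightedSeminorm s β q τ T f ≤ weightedSeminorm s β q' τ T f := by
  refine iSup_mono fun z => iSup_mono fun r => iSup_mono fun _ => ?_
  refine mul_le_mul_left (ENNReal.ofReal_le_ofReal ?_) _
  exact Real.rpow_le_rpow_of_exponent_le (by linarith [norm_nonneg z.2.2]) h

theorem weightedNorm_mono {d : ℕ} {s β q q' τ T : ℝ} (h : q ≤ q') (f : Pt d → ℝ) :
    weightedNorm s β q τ T f ≤ weightedNorm s β q' τ T f :=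
  add_le_add (weightedSeminorm_mono h f) (weightedSeminorm_mono h f)

/-- A radius for which cylinders fit into every time interval of length `δ`. -/
theorem exists_cylinder_radius {s δ : ℝ} (hs : 0 < s) (hδ : 0 < δ) :
    ∃ r : ℝ, 0 < r ∧ r ≤ 1 ∧ r ^ (2 * s) ≤ δ := by
  refine ⟨min 1 (δ ^ (1 / (2 * s))), by positivity, min_le_left _ _, ?_⟩
  refine (Real.rpow_le_rpow (by positivity) (min_le_right _ _) (by positivity)).trans_eq ?_
  rw [← Real.rpow_mul hδ.le, one_div_mul_cancel (by positivity), Real.rpow_one]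

theorem lt_ofReal_toReal_add {N : ℝ≥0∞} (hN : N < ⊤) {ε : ℝ} (hε : 0 < ε) :
    N < ENNReal.ofReal (N.toReal + ε) := by
  rw [ENNReal.lt_ofReal_iff_toReal_lt hN.ne]
  linarith

/-- The bilinear bound for the weighted norms, together with the continuity of `Q₁(f,g)`. -/
theorem exists_weightedNorm_Q₁_le {d : ℕ} (hd : 2 ≤ d) {s γ α q r : ℝ} (Lam : ℝ) (hs0 : 0 < s)
    (hs1 : s < 1) (hγ : 0 ≤ γ + 2 * s) (hα0 : 0 < α) (hα : α ≤ min 1 (2 * s))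
    (hq : (d : ℝ) + γ + 2 * s + α / (1 + 2 * s) < q) (hr : 0 < r) (hr1 : r ≤ 1) :
    ∃ C : ℝ≥0, ∀ (lam : ℝ) (b : ℝ → ℝ), IsNonCutoff d s γ lam Lam b →
      ∀ (τ T : ℝ) (f g : Pt d → ℝ), r ^ (2 * s) ≤ T - τ → MemFast s α τ T f →
      MemFast s (2 * s + α) τ T g →
      ContinuousOn (Q₁ γ b f g) {y | τ < y.1 ∧ y.1 ≤ T} ∧
      weightedNorm s (2 * s * α / (1 + 2 * s)) (q - γ - 2 * s - α / (1 + 2 * s)) τ T (Q₁ γ b f g)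
        ≤ C * weightedNorm s α q τ T f * weightedNorm s (2 * s + α) q τ T g := by
  have hκ : 0 < α / (1 + 2 * s) := by positivity
  have hd0 : (0 : ℝ) ≤ d := by positivity
  set κ := α / (1 + 2 * s)
  set q' := q - γ - 2 * s - κ with hq'def
  have hq' : 0 ≤ q' := by linarith
  set β := 2 * s * α / (1 + 2 * s)
  have hβ : 0 < β := by positivity
  obtain ⟨C1, hC1, h1⟩ := exists_Q₁_pointwise hd Lam hs0 hs1 hγ hα0 hα (q := q) (by linarith) hr hr1
  obtain ⟨C2, hC2, h2⟩ := exists_Q₁_holder hd Lam hs0 hs1 hγ hα0 hα hq hr hr1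
  set D := 2 ^ q' * C1 + 2 ^ q' * 2 ^ β * (C2 + 2 * C1)
  have hD : 0 ≤ D := by positivity
  refine ⟨D.toNNReal, ?_⟩
  intro lam b hb τ T f g hrT hf hg
  have hN := hf.2 q (by linarith)
  have hN' := hg.2 q (by linarith)
  have hfc : ∀ t x, τ < t → t ≤ T → Continuous (fun u => f (t, x, u)) := fun t x h h' =>
    continuous_fiber hr hr1 hrT hf.1 h h' x
  have hgc : ∀ t x, τ < t → t ≤ T → Continuous (fun u => g (t, x, u)) := fun t x h h' =>
    continuous_fiber hr hr1 hrT hg.1 h h' x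
  set N := weightedNorm s α q τ T f
  set N' := weightedNorm s (2 * s + α) q τ T g
  have hH : ∀ ε : ℝ, 0 < ε → KineticHolder s β q' τ T
      (C2 * (N.toReal + ε) * (N'.toReal + ε)) (Q₁ γ b f g) := fun ε hε =>
    h2 lam b hb τ T _ _ f g hrT (by positivity) (by positivity) (lt_ofReal_toReal_add hN hε)
      (lt_ofReal_toReal_add hN' hε) hfc hgc
  refine ⟨(hH 1 one_pos).continuousOn hβ, ?_⟩
  have key : ∀ ε : ℝ, 0 < ε → weightedNorm s β q' τ T (Q₁ γ b f g)
      ≤ ENNReal.ofReal (D * (N.toReal + ε) * (N'.toReal + ε)) := by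
    intro ε hε
    have hP : ∀ y : Pt d, τ < y.1 → y.1 ≤ T → |Q₁ γ b f g y|
        ≤ C1 * (N.toReal + ε) * (N'.toReal + ε) * (1 + ‖y.2.2‖) ^ (-q') := by
      intro y hy hy'
      refine (h1 lam b hb τ T (N.toReal + ε) (N'.toReal + ε) f g hrT (by positivity) (by positivity)
        (lt_of_le_of_lt le_self_add (lt_ofReal_toReal_add hN hε)) (lt_ofReal_toReal_add hN' hε)
        y hy hy' (hfc _ _ hy hy') (hgc _ _ hy hy')).2.2.2.trans ?_
      refine mul_le_mul_of_nonneg_left ?_ (by positivity)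
      exact Real.rpow_le_rpow_of_exponent_le (by linarith [norm_nonneg y.2.2]) (by linarith)
    refine (add_le_add (weightedSeminorm_zero_le hq' (by positivity) hP)
      ((hH ε hε).weightedSeminorm_le hs0 hβ hq' (by positivity) (by positivity) hP)).trans_eq ?_
    rw [← ENNReal.ofReal_add (by positivity) (by positivity)]
    congr 1
    simp only [D]
    ring
  have hlim : Tendsto (fun ε : ℝ => ENNReal.ofReal (D * (N.toReal + ε) * (N'.toReal + ε)))
      (𝓝[>] 0) (𝓝 (ENNReal.ofReal (D * (N.toReal + 0) * (N'.toReal + 0)))) :=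
    ((ENNReal.continuous_ofReal.comp (by fun_prop)).tendsto 0).mono_left nhdsWithin_le_nhds
  refine (ge_of_tendsto hlim ?_).trans_eq ?_
  · filter_upwards [self_mem_nhdsWithin] with ε hε using key ε hε
  · rw [add_zero, add_zero, ENNReal.ofReal_mul (by positivity), ENNReal.ofReal_mul hD,
      ENNReal.ofReal_toReal hN.ne, ENNReal.ofReal_toReal hN'.ne]
    rfl

end KineticBoltzmann

open KineticBoltzmann in
theorem lemma5p6 (d : ℕ) (hd : 2 ≤ d) (s γ α lam Lam : ℝ)
    (hs0 : 0 < s) (hs1 : s < 1) (hγ : -(d : ℝ) < γ)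
    (hγs0 : 0 ≤ γ + 2 * s) (hγs2 : γ + 2 * s ≤ 2)
    (hα0 : 0 < α) (hα1 : α ≤ min 1 (2 * s)) (hlam : 0 < lam) :
    (∀ b : ℝ → ℝ, IsNonCutoff d s γ lam Lam b →
      ∀ τ T : ℝ, τ < T → ∀ f g : Pt d → ℝ,
        MemFast s α τ T f → MemFast s (2 * s + α) τ T g →
          (∀ z : Pt d, τ < z.1 → z.1 ≤ T → Q₁WellDefined γ b f g z) ∧
          MemFast s (2 * s * α / (1 + 2 * s)) τ T (Q₁ γ b f g)) ∧
    (∀ q : ℝ, (d : ℝ) + γ + 2 * s + α / (1 + 2 * s) < q → ∀ δ : ℝ, 0 < δ →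
      ∃ C : ℝ≥0, ∀ b : ℝ → ℝ, IsNonCutoff d s γ lam Lam b →
        ∀ τ T : ℝ, δ ≤ T - τ → ∀ f g : Pt d → ℝ,
          MemFast s α τ T f → MemFast s (2 * s + α) τ T g →
            weightedNorm s (2 * s * α / (1 + 2 * s))
                (q - γ - 2 * s - α / (1 + 2 * s)) τ T (Q₁ γ b f g)
              ≤ (C : ℝ≥0∞) * weightedNorm s α q τ T f * weightedNorm s (2 * s + α) q τ T g) := by
  refine ⟨?_, ?_⟩
  · intro b hb τ T hτT f g hf hg
    obtain ⟨r, hr, hr1, hrT⟩ := exists_cylinder_radius hs0 (sub_pos.mpr hτT)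
    have hκ : 0 < α / (1 + 2 * s) := by positivity
    have hd0 : (0 : ℝ) ≤ d := by positivity
    refine ⟨fun z h1 h2 => ?_, fun z r' hr' _ hsub => ?_, fun q hq => ?_⟩
    · obtain ⟨_, -, h⟩ := exists_Q₁_pointwise hd Lam hs0 hs1 hγs0 hα0 hα1
        (q := d + γ + 2 * s + 1) (by linarith) hr hr1
      have hq : (0 : ℝ) < d + γ + 2 * s + 1 := by linarith
      exact (h lam b hb τ T _ _ f g hrT (by positivity) (by positivity)
        (lt_of_le_of_lt le_self_add (lt_ofReal_toReal_add (hf.2 _ hq) one_pos))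
        (lt_ofReal_toReal_add (hg.2 _ hq) one_pos) z h1 h2
        (continuous_fiber hr hr1 hrT hf.1 h1 h2 _) (continuous_fiber hr hr1 hrT hg.1 h1 h2 _)).1
    · obtain ⟨_, h⟩ := exists_weightedNorm_Q₁_le hd Lam hs0 hs1 hγs0 hα0 hα1
        (q := d + γ + 2 * s + α / (1 + 2 * s) + 1) (by linarith) hr hr1
      exact (h lam b hb τ T f g hrT hf hg).1.mono fun y hy => lt_time_of_mem_cylinder hr' hsub hy
    · -- a decay of order `q + d` is reached, so the order `q` in particular
      obtain ⟨C, h⟩ := exists_weightedNorm_Q₁_le hd Lam hs0 hs1 hγs0 hα0 hα1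
        (q := q + d + γ + 2 * s + α / (1 + 2 * s)) (by linarith) hr hr1
      refine lt_of_le_of_lt (weightedNorm_mono (by linarith) _)
        (lt_of_le_of_lt (h lam b hb τ T f g hrT hf hg).2 ?_)
      exact ENNReal.mul_lt_top (ENNReal.mul_lt_top ENNReal.coe_lt_top (hf.2 _ (by linarith)))
        (hg.2 _ (by linarith))
  · intro q hq δ hδ
    obtain ⟨r, hr, hr1, hrδ⟩ := exists_cylinder_radius hs0 hδ
    obtain ⟨C, h⟩ := exists_weightedNorm_Q₁_le hd Lam hs0 hs1 hγs0 hα0 hα1 hq hr hr1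
    exact ⟨C, fun b hb τ T hT f g hf hg => (h lam b hb τ T f g (hrδ.trans hT) hf hg).2⟩

end
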